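/- Let $n\ge 1$ be an integer, $s\in(0,1)$ and $a=1-2s\in(-1,1)$. Write points of $\mathbb{R}^{n+1}$ as $X=(x,y)$ with $x\in\mathbb{R}^n$, $y\in\mathbb{R}$; let $B_1$ be the open unit ball of $\mathbb{R}^{n+1}$ and $B_1'=B_1\cap\{y=0\}$. Let $H^1(B_1,a)$ and $H^1(\partial B_1,a)$ be the Sobolev spaces with weight $|y|^a$: the function and its weak gradient (on $\partial B_1$, its weak tangential gradient) are square integrable with respect to $|y|^a\,dX$, respectively $|y|^a\,d\mathcal{H}^n$. For $c\in H^1(\partial B_1,a)$ let $$\mathcal{K}_c=\{v\in H^1(B_1,a):\ v\ge 0\text{ on }B_1',\ v=c\text{ on }\partial B_1,\ v(x,y)=v(x,-y)\},$$ where the conditions on $B_1'$ and $\partial B_1$ are understood in the sense of traces, and for $v\in H^1(B_1,a)$ let $$W_{1+s}(v)=\int_{B_1}|\nabla v|^2|y|^a\,dX-(1+s)\int_{\partial B_1}v^2|y|^a\,d\mathcal{H}^n .$$ **Theorem (epiperimetric inequality for $W_{1+s}$).** Let $c\in H^1(\partial B_1,a)$ and let $z(r\theta)=r^{1+s}c(\theta)$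 ($r\geq 0$, $\theta\in\partial B_1$) be its $(1+s)$-homogeneous extension. If $z\in\mathcal{K}_c$, then there is $\zeta\in\mathcal{K}_c$ such that $$W_{1+s}(\zeta)\le(1-\kappa)\,W_{1+s}(z),\qquad \kappa=\frac{1+a}{2n+a+5}.$$ -/

import Mathlib

open MeasureTheory Filter Topology
open scoped ContDiff ENNReal

/-- The ambient space `ℝⁿ⁺¹ = ℝⁿ × ℝ`. A point is `X = (x, y)`; `y` is the last coordinate. -/
abbrev Amb (n : ℕ) : Type := EuclideanSpace ℝ (Fin (n + 1))

/-- The unit sphere `∂B₁ ⊂ ℝⁿ⁺¹`. -/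
abbrev Sph (n : ℕ) : Type := Metric.sphere (0 : Amb n) 1

/-- The coordinate `y` of `X = (x, y)`. -/
def yCoord {n : ℕ} (X : Amb n) : ℝ := X (Fin.last n)

/-- The component `x ∈ ℝⁿ` of `X = (x, y)`. -/
noncomputable def xPart {n : ℕ} (X : Amb n) : EuclideanSpace ℝ (Fin n) :=
  WithLp.toLp 2 fun i : Fin n => X i.castSucc

/-- The reflection `(x, y) ↦ (x, -y)`. -/
noncomputable def reflectY {n : ℕ} (X : Amb n) : Amb n :=
  WithLp.toLp 2 (Function.update (fun i => X i) (Fin.last n) (-yCoord X))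

/-- The measure `|y|^a dX` on the open unit ball `B₁ ⊂ ℝⁿ⁺¹`. -/
noncomputable def ballMeasure (n : ℕ) (a : ℝ) : Measure (Amb n) :=
  (volume.restrict (Metric.ball (0 : Amb n) 1)).withDensity
    fun X => ENNReal.ofReal (|yCoord X| ^ a)

/-- The surface measure `dHⁿ` on `∂B₁`. -/
noncomputable def surfaceMeasure (n : ℕ) : Measure (Sph n) :=
  (volume : Measure (Amb n)).toSphere

/-- The measure `|y|^a dHⁿ` on `∂B₁`. -/
noncomputable def sphereMeasure (n : ℕ) (a : ℝ) : Measure (Sph n) :=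
  (surfaceMeasure n).withDensity fun θ => ENNReal.ofReal (|yCoord (θ : Amb n)| ^ a)

/-! ### The weighted Sobolev space on the ball -/

/-- `G` is the weak (distributional) gradient of `v` in `B₁`, and lies in `L²(B₁, |y|^a)`. -/
def IsWeakGrad {n : ℕ} (a : ℝ) (v : Amb n → ℝ) (G : Amb n → Amb n) : Prop :=
  MemLp G 2 (ballMeasure n a) ∧
  ∀ φ : Amb n → ℝ, ContDiff ℝ ∞ φ → HasCompactSupport φ →
    tsupport φ ⊆ Metric.ball (0 : Amb n) 1 → ∀ i : Fin (n + 1),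
      ∫ X in Metric.ball (0 : Amb n) 1, v X * fderiv ℝ φ X (EuclideanSpace.single i 1) =
        -∫ X in Metric.ball (0 : Amb n) 1, G X i * φ X

/-- `v ∈ H¹(B₁, a)`: both `v` and its weak gradient lie in `L²(B₁, |y|^a)`. -/
def MemH1Ball {n : ℕ} (a : ℝ) (v : Amb n → ℝ) : Prop :=
  MemLp v 2 (ballMeasure n a) ∧ ∃ G, IsWeakGrad a v G

open Classical in
/-- The weak gradient of `v` (unique almost everywhere in `B₁`), for `v ∈ H¹(B₁, a)`. -/
noncomputable def weakGrad {n : ℕ} (a : ℝ) (v : Amb n → ℝ) : Amb n → Amb n :=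
  if h : ∃ G, IsWeakGrad a v G then h.choose else 0

/-! ### The weighted Sobolev space on the sphere -/

/-- `G` is the weak tangential gradient of `c` on `∂B₁`, and lies in `L²(∂B₁, |y|^a)`: by the
divergence theorem on the sphere, whose mean curvature is `n`, it is characterized by
`∫ c (∇_S φ · e - n φ (θ · e)) dHⁿ = -∫ (G · e) φ dHⁿ` for all smooth `φ` and all vectors `e`,
where `∇_S φ · e = ∂_e φ - (θ · e) ∂_θ φ` on `∂B₁`. (It follows that `G` is tangential.) -/
def IsWeakSphereGrad {n : ℕ} (a : ℝ) (c : Sph n → ℝ) (G : Sph n → Amb n) : Prop :=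
  MemLp G 2 (sphereMeasure n a) ∧
  ∀ φ : Amb n → ℝ, ContDiff ℝ ∞ φ → ∀ e : Amb n,
    ∫ θ : Sph n, c θ * (fderiv ℝ φ θ e - inner ℝ (θ : Amb n) e * fderiv ℝ φ θ (θ : Amb n)
        - n * φ θ * inner ℝ (θ : Amb n) e) ∂(surfaceMeasure n) =
      -∫ θ : Sph n, inner ℝ (G θ) e * φ θ ∂(surfaceMeasure n)

/-- `c ∈ H¹(∂B₁, a)`: both `c` and its weak tangential gradient lie in `L²(∂B₁, |y|^a)`. -/
def MemH1Sphere {n : ℕ} (a : ℝ) (c : Sph n → ℝ) : Prop :=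
  MemLp c 2 (sphereMeasure n a) ∧ ∃ G, IsWeakSphereGrad a c G

/-! ### Homogeneous extensions and traces -/

open Classical in
/-- The `0`-homogeneous extension `X ↦ c (X / |X|)` of a function on `∂B₁` (with value `0` at the
origin). -/
noncomputable def radialExt {n : ℕ} (c : Sph n → ℝ) (X : Amb n) : ℝ :=
  if h : X = 0 then 0
  else c ⟨‖X‖⁻¹ • X, by
    rw [mem_sphere_zero_iff_norm, norm_smul, norm_inv, norm_norm,
      inv_mul_cancel₀ (norm_ne_zero_iff.mpr h)]⟩

/-- The `μ`-homogeneous extension `r^μ c(θ)` of a function `c` on `∂B₁`. -/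
noncomputable def homExt {n : ℕ} (μ : ℝ) (c : Sph n → ℝ) (X : Amb n) : ℝ :=
  ‖X‖ ^ μ * radialExt c X

/-- `v = c` on `∂B₁` in the sense of traces: `c ∈ L²(∂B₁, |y|^a)` is the strong `L²` limit of `v`
at `∂B₁` along the radii, i.e. `ε⁻¹ ∫_{1-ε<|X|<1} |v(X) - c(X/|X|)|² |y|^a dX → 0` as `ε → 0⁺`.
Every `v ∈ H¹(B₁, a)` has exactly one such `c` up to null sets, namely its usual trace; for `v`
continuous up to `∂B₁` it is the restriction of `v`. -/
def IsSphereTrace {n : ℕ} (a : ℝ) (v : Amb n → ℝ) (c : Sph n → ℝ) : Prop :=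
  MemLp c 2 (sphereMeasure n a) ∧
  Tendsto (fun ε : ℝ => (ENNReal.ofReal ε)⁻¹ *
      ∫⁻ X in {X : Amb n | 1 - ε < ‖X‖}, ‖v X - radialExt c X‖ₑ ^ 2 ∂(ballMeasure n a))
    (𝓝[>] 0) (𝓝 0)

open Classical in
/-- The trace of `v` on `∂B₁` (unique almost everywhere), for `v ∈ H¹(B₁, a)`. -/
noncomputable def sphereTrace {n : ℕ} (a : ℝ) (v : Amb n → ℝ) : Sph n → ℝ :=
  if h : ∃ c, IsSphereTrace a v c then h.choose else 0

/-- `v = τ` on the thin ball `B₁' = B₁ ∩ {y = 0}` in the sense of traces: `τ ∈ L²(B₁')` is the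
strong `L²` limit of `v` at `B₁'` along the vertical lines, i.e.
`ε⁻¹ ∫_{B₁ ∩ {|y|<ε}} |v(x,y) - τ(x)|² dX → 0` as `ε → 0⁺`. For `-1 < a < 1` every
`v ∈ H¹(B₁, a)` has exactly one such `τ` up to null sets, namely its usual trace; for `v`
continuous on the closed ball it is the restriction of `v`. -/
def IsThinTrace {n : ℕ} (v : Amb n → ℝ) (τ : EuclideanSpace ℝ (Fin n) → ℝ) : Prop :=
  MemLp τ 2 (volume.restrict (Metric.ball (0 : EuclideanSpace ℝ (Fin n)) 1)) ∧
  Tendsto (fun ε : ℝ => (ENNReal.ofReal ε)⁻¹ *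
      ∫⁻ X in Metric.ball (0 : Amb n) 1 ∩ {X : Amb n | |yCoord X| < ε}, ‖v X - τ (xPart X)‖ₑ ^ 2)
    (𝓝[>] 0) (𝓝 0)

/-- `v ≥ 0` on `B₁'` in the sense of traces. -/
def NonnegOnThinBall {n : ℕ} (v : Amb n → ℝ) : Prop :=
  ∃ τ : EuclideanSpace ℝ (Fin n) → ℝ, IsThinTrace v τ ∧
    ∀ᵐ x ∂(volume.restrict (Metric.ball (0 : EuclideanSpace ℝ (Fin n)) 1)), 0 ≤ τ x

/-! ### The admissible class and the Weiss energy -/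

/-- The admissible class
`K_c = {v ∈ H¹(B₁, a) : v ≥ 0 on B₁', v = c on ∂B₁, v(x, y) = v(x, -y)}`. -/
def admissible {n : ℕ} (a : ℝ) (c : Sph n → ℝ) : Set (Amb n → ℝ) :=
  {v | MemH1Ball a v ∧ NonnegOnThinBall v ∧ IsSphereTrace a v c ∧
    ∀ᵐ X ∂(volume.restrict (Metric.ball (0 : Amb n) 1)), v X = v (reflectY X)}

/-- The Weiss energy (centred at the origin, with radius `1`)
`W_lam(v) = ∫_{B₁} |∇v|² |y|^a dX - lam ∫_{∂B₁} v² |y|^a dHⁿ`. -/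
noncomputable def weissEnergy {n : ℕ} (a lam : ℝ) (v : Amb n → ℝ) : ℝ :=
  (∫ X, ‖weakGrad a v X‖ ^ 2 ∂(ballMeasure n a)) -
    lam * ∫ θ, (sphereTrace a v θ) ^ 2 ∂(sphereMeasure n a)

/-! ### Polar coordinates for the weighted measures -/

/-! Notation: h_e is the explicit (1+s)-homogeneous solution of the thin obstacle problem in the
horizontal direction e (`slit`), u = |y|^(2s) (`thinProfile`), and λ(d) = d(d+n+a-1) (`sphEig`) is
the eigenvalue of the weighted spherical Laplacian that corresponds to d-homogeneous solutions of
div(|y|^a ∇v) = 0.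

The trace is split as c = ψ + φ with ψ = C h_e + c₀ u and C ≥ 0, so that φ has zero mean and zero
moments against horizontal linear functions (`exists_profile`). This is possible because the
horizontal moment vector of h_e is a positive multiple of e, while u has no horizontal moments and a
positive mean. The competitor ζ = r^(1+s) ψ + r² φ changes only the homogeneity of φ.

Two spectral inequalities on the sphere carry the estimate. For ψ, ∫|∇ψ|² ≤ λ(1+s) ∫ψ²
(`energy_profile_le`): h_e satisfies its eigenvalue equation when tested against h_e and against u,
because both are small where the flux of h_e through the thin space sits, and u contributes only
λ(2s) ≤ λ(1+s). For φ, ∫|∇φ|² ≥ λ(2) ∫φ² (`spectral_gap_even`), because φ is even in y and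
orthogonal to everything of degree at most one.

The energy of r^α ψ + r^β φ is an explicit combination of integrals over the sphere
(`weissEnergy_homExt_add`). The constant κ is the one for which the mixed terms ∫ψφ and ∫∇ψ·∇φ
cancel in (1-κ) W(z) - W(ζ), so no orthogonality between ψ and φ is needed; the remainder is a
combination with nonnegative coefficients of the defects in the two inequalities
(`epiperimetric_algebra`).

Since r² = r^(1-s) r^(1+s), ζ equals r^(1-s) z + (1 - r^(1-s)) Ψ with Ψ the (1+s)-homogeneous
extension of ψ. On the thin ball both z and Ψ = C h_e are nonnegative, hence so is ζ
(`competitor_mem_admissible`); this is where C ≥ 0 matters, while c₀ may have any sign because u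
vanishes there.

The spectral gap uses neither compactness nor eigenfunctions. On ridge monomials ⟨X,e⟩^j y^(2k) the
weighted spherical Laplacian is triangular for the degree, with diagonal entry λ(j+2k)
(`exists_monL2_grad`); a Hilbert space induction along the degree filtration gives the gap for
polynomials (`spectral_gap_filtration`), and it extends to all even functions by density
(`mem_closure_evenSpan`). -/

theorem measurable_yCoord {n : ℕ} : Measurable (yCoord : Amb n → ℝ) := by
  unfold yCoord; fun_prop

theorem continuous_yCoord {n : ℕ} : Continuous (yCoord : Amb n → ℝ) := by
  unfold yCoord; fun_prop

theorem yCoord_smul {n : ℕ} (r : ℝ) (X : Amb n) : yCoord (r • X) = r * yCoord X := by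
  simp [yCoord]

theorem abs_yCoord_le {n : ℕ} (X : Amb n) : |yCoord X| ≤ ‖X‖ := by
  simpa [yCoord] using PiLp.norm_apply_le X (Fin.last n)

theorem norm_sph {n : ℕ} (θ : Sph n) : ‖(θ : Amb n)‖ = 1 := mem_sphere_zero_iff_norm.1 θ.2

/-- The measure `r^b dr` on `(0, 1)`. -/
noncomputable def radialMeasure (b : ℝ) : Measure ℝ :=
  (volume.restrict (Set.Ioo 0 1)).withDensity fun r => ENNReal.ofReal (r ^ b)

/-- Polar coordinates. -/
def polarMap {n : ℕ} (p : Sph n × ℝ) : Amb n := p.2 • (p.1 : Amb n)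

theorem measurable_polarMap {n : ℕ} : Measurable (polarMap : Sph n × ℝ → Amb n) := by
  unfold polarMap; fun_prop

instance sFinite_radialMeasure (b : ℝ) : SFinite (radialMeasure b) := by
  unfold radialMeasure; infer_instance

instance sFinite_surfaceMeasure (n : ℕ) : IsFiniteMeasure (surfaceMeasure n) := by
  unfold surfaceMeasure; infer_instance

instance sFinite_sphereMeasure (n : ℕ) (a : ℝ) : SFinite (sphereMeasure n a) := by
  unfold sphereMeasure; infer_instance

theorem measurable_weight (n : ℕ) (a : ℝ) :
    Measurable fun X : Amb n => ENNReal.ofReal (|yCoord X| ^ a) := by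
  have := measurable_yCoord (n := n)
  fun_prop

theorem measurable_sphere_weight (n : ℕ) (a : ℝ) :
    Measurable fun θ : Sph n => ENNReal.ofReal (|yCoord (θ : Amb n)| ^ a) :=
  (measurable_weight n a).comp measurable_subtype_coe

theorem lintegral_polar {n : ℕ} {f : Amb n → ℝ≥0∞} (hf : Measurable f) :
    ∫⁻ X, f X = ∫⁻ θ : Sph n, (∫⁻ r in Set.Ioi (0 : ℝ),
      ENNReal.ofReal (r ^ n) * f (r • (θ : Amb n))) ∂(surfaceMeasure n) := by
  have hdim : Module.finrank ℝ (Amb n) - 1 = n := by simp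
  have h1 : ∫⁻ X, f X = ∫⁻ X : ({0}ᶜ : Set (Amb n)), f X ∂(Measure.comap Subtype.val volume) := by
    rw [lintegral_subtype_comap (measurableSet_singleton _).compl, restrict_compl_singleton]
  have hmp := (volume : Measure (Amb n)).measurePreserving_homeomorphUnitSphereProd
  have hm : Measurable fun p : Sph n × Set.Ioi (0 : ℝ) => f (p.2.1 • (p.1 : Amb n)) := by
    apply hf.comp
    fun_prop
  have h2 := hmp.lintegral_comp hm
  rw [h1]
  have h3 : ∀ X : ({0}ᶜ : Set (Amb n)), f X = f ((homeomorphUnitSphereProd (Amb n) X).2.1 •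
      ((homeomorphUnitSphereProd (Amb n) X).1 : Amb n)) := by
    intro X
    congr 1
    simp [smul_smul, mul_inv_cancel₀ (norm_ne_zero_iff.2 (show (X : Amb n) ≠ 0 from X.2))]
  rw [lintegral_congr h3, h2, hdim, lintegral_prod _ hm.aemeasurable]
  apply lintegral_congr
  intro θ
  have hg : Measurable fun r : Set.Ioi (0 : ℝ) => f (r.1 • (θ : Amb n)) :=
    hm.comp (measurable_const.prodMk measurable_id)
  have hg' : Measurable fun r : Set.Ioi (0 : ℝ) => ENNReal.ofReal (r.1 ^ n) := by fun_prop
  unfold Measure.volumeIoiPow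
  rw [lintegral_withDensity_eq_lintegral_mul _ hg' hg]
  simp only [Pi.mul_apply]
  rw [← lintegral_subtype_comap measurableSet_Ioi]

/-- The weight is homogeneous, |y(rθ)|^a = r^a |y(θ)|^a, so it merges with the Jacobian r^n and the
weighted ball becomes a product. Integrals of homogeneous functions thereby factor into a spherical
and a radial integral. -/
theorem measurePreserving_polarMap (n : ℕ) (a : ℝ) :
    MeasurePreserving polarMap ((sphereMeasure n a).prod (radialMeasure (n + a)))
      (ballMeasure n a) := by
  refine ⟨measurable_polarMap, ?_⟩
  ext s hs
  rw [Measure.map_apply measurable_polarMap hs, Measure.prod_apply (measurable_polarMap hs)]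
  have hw := measurable_weight n a
  unfold ballMeasure
  rw [withDensity_apply _ hs, Measure.restrict_restrict hs, ← lintegral_indicator
    (hs.inter measurableSet_ball), lintegral_polar (hw.indicator (hs.inter measurableSet_ball))]
  have hmeas : Measurable fun θ : Sph n =>
      radialMeasure (n + a) (Prod.mk θ ⁻¹' (polarMap ⁻¹' s)) :=
    measurable_measure_prodMk_left (measurable_polarMap hs)
  unfold sphereMeasure
  rw [lintegral_withDensity_eq_lintegral_mul _ (measurable_sphere_weight n a) hmeas]
  apply lintegral_congr
  intro θ
  have hsθ : MeasurableSet (Prod.mk θ ⁻¹' (polarMap ⁻¹' s)) :=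
    measurable_prodMk_left (measurable_polarMap hs)
  simp only [Pi.mul_apply]
  unfold radialMeasure
  rw [withDensity_apply _ hsθ, ← lintegral_const_mul _ (by fun_prop),
    Measure.restrict_restrict hsθ, ← lintegral_indicator (hsθ.inter measurableSet_Ioo),
    ← lintegral_indicator measurableSet_Ioi]
  apply lintegral_congr
  intro r
  by_cases hr : 0 < r
  · have hnorm : ‖r • (θ : Amb n)‖ = r := by
      rw [norm_smul, norm_sph, Real.norm_eq_abs, abs_of_pos hr, mul_one]
    by_cases hr1 : r < 1
    · by_cases hmem : r • (θ : Amb n) ∈ s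
      · rw [Set.indicator_of_mem, Set.indicator_of_mem, Set.indicator_of_mem]
        · rw [yCoord_smul, abs_mul, abs_of_pos hr, Real.mul_rpow hr.le (abs_nonneg _),
            ← ENNReal.ofReal_mul (by positivity), ← ENNReal.ofReal_mul (by positivity),
            Real.rpow_add hr, Real.rpow_natCast]
          congr 1; ring
        · exact ⟨hmem, by simpa [hnorm] using hr1⟩
        · exact hr
        · exact ⟨hmem, hr, hr1⟩
      · rw [Set.indicator_of_notMem, Set.indicator_of_mem (show r ∈ Set.Ioi 0 from hr),
          Set.indicator_of_notMem]
        · simp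
        · exact fun h => hmem h.1
        · exact fun h => hmem h.1
    · rw [Set.indicator_of_notMem, Set.indicator_of_mem (show r ∈ Set.Ioi 0 from hr),
          Set.indicator_of_notMem]
      · simp
      · intro h
        have := h.2
        rw [mem_ball_zero_iff, hnorm] at this
        exact hr1 this
      · exact fun h => hr1 h.2.2
  · rw [Set.indicator_of_notMem (fun h => hr h.2.1),
      Set.indicator_of_notMem (show r ∉ Set.Ioi 0 from hr)]

/-! ### Finiteness of the weighted measures and equivalence with the unweighted ones -/

theorem sphereMeasure_zero (n : ℕ) : sphereMeasure n 0 = surfaceMeasure n := by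
  unfold sphereMeasure; simp

theorem ballMeasure_zero (n : ℕ) :
    ballMeasure n 0 = volume.restrict (Metric.ball (0 : Amb n) 1) := by
  unfold ballMeasure; simp

theorem integrableOn_abs_rpow {a : ℝ} (ha : -1 < a) :
    IntegrableOn (fun x : ℝ => |x| ^ a) (Set.Icc (-1) 1) := by
  have h1 : IntegrableOn (fun x : ℝ => |x| ^ a) (Set.Ioc 0 1) := by
    have := (intervalIntegral.intervalIntegrable_rpow' (a := 0) (b := 1) ha).1
    refine this.congr_fun (fun x hx => ?_) measurableSet_Ioc
    simp only
    rw [abs_of_pos hx.1]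
  have h2 : IntervalIntegrable (fun x : ℝ => |x| ^ a) volume 0 1 :=
    (intervalIntegrable_iff_integrableOn_Ioc_of_le zero_le_one).2 h1
  have h3 : IntervalIntegrable (fun x : ℝ => |x| ^ a) volume (-1) 0 := by
    have := (h2.comp_sub_left 0).symm
    simpa using this
  have h4 := h3.trans h2
  rw [intervalIntegrable_iff_integrableOn_Icc_of_le (by norm_num)] at h4
  exact h4

/-- The ball lies in the cube [-1,1]^(n+1), where the weight is a product of one-variable functions;
the only singular one, |y|^a, is integrable because a > -1. -/
theorem ballMeasure_univ_lt_top (n : ℕ) {a : ℝ} (ha : -1 < a) :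
    ballMeasure n a Set.univ < ⊤ := by
  classical
  unfold ballMeasure
  rw [withDensity_apply _ .univ, Measure.restrict_univ]
  let g : Fin (n + 1) → ℝ → ℝ := fun i =>
    if i = Fin.last n then (Set.Icc (-1) 1).indicator fun x => |x| ^ a
    else (Set.Icc (-1) 1).indicator fun _ => 1
  have hg : ∀ i, Integrable (g i) volume := by
    intro i
    by_cases hi : i = Fin.last n
    · simp only [g, hi, if_true]
      exact (integrable_indicator_iff measurableSet_Icc).2 (integrableOn_abs_rpow ha)
    · simp only [g, hi, if_false]
      rw [integrable_indicator_iff measurableSet_Icc]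
      simp [integrableOn_const_iff]
  have hint : Integrable (fun x : Fin (n + 1) → ℝ => ∏ i, g i (x i)) volume :=
    Integrable.fintype_prod hg
  have hint' : Integrable (fun X : Amb n => ∏ i, g i (X i)) volume :=
    (PiLp.volume_preserving_ofLp (Fin (n + 1))).integrable_comp_of_integrable hint
  refine lt_of_le_of_lt ?_ hint'.2
  rw [← lintegral_indicator measurableSet_ball]
  apply lintegral_mono
  intro X
  by_cases hX : X ∈ Metric.ball (0 : Amb n) 1
  · simp only
    rw [Set.indicator_of_mem hX]
    have hX' : ∀ i, X i ∈ Set.Icc (-1 : ℝ) 1 := by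
      intro i
      have h1 := PiLp.norm_apply_le X i
      rw [mem_ball_zero_iff] at hX
      rw [Real.norm_eq_abs] at h1
      exact abs_le.1 (h1.trans hX.le)
    have : ∏ i, g i (X i) = |yCoord X| ^ a := by
      rw [Fin.prod_univ_castSucc]
      rw [Finset.prod_eq_one]
      · simp only [g, if_true, one_mul]
        rw [Set.indicator_of_mem (hX' _)]
        rfl
      · intro i _
        simp only [g, (Fin.castSucc_lt_last i).ne, if_false]
        rw [Set.indicator_of_mem (hX' _)]
    rw [this, Real.enorm_eq_ofReal (by positivity)]
  · simp only
    rw [Set.indicator_of_notMem hX]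
    exact bot_le

theorem radialMeasure_univ_ne_zero (b : ℝ) : radialMeasure b Set.univ ≠ 0 := by
  unfold radialMeasure
  rw [withDensity_apply _ .univ, Measure.restrict_univ]
  intro h
  rw [lintegral_eq_zero_iff (by fun_prop)] at h
  have h2 := ae_restrict_iff' measurableSet_Ioo |>.1 h
  have : volume (Set.Ioo (0 : ℝ) 1) = 0 := by
    refine measure_mono_null (fun r hr => ?_) h2
    simp only [Set.mem_compl_iff, Set.mem_ofPred_eq, Classical.not_imp]
    refine ⟨hr, ?_⟩
    simp only [Pi.zero_apply, ENNReal.ofReal_eq_zero, not_le]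
    exact Real.rpow_pos_of_pos hr.1 _
  simp at this

/-- The mass of the ball is the mass of the sphere times a nonzero radial mass, so an infinite
sphere would force an infinite ball. -/
theorem isFiniteMeasure_sphereMeasure (n : ℕ) {a : ℝ} (ha : -1 < a) :
    IsFiniteMeasure (sphereMeasure n a) := by
  refine ⟨?_⟩
  have h := ballMeasure_univ_lt_top n ha
  rw [← (measurePreserving_polarMap n a).map_eq, Measure.map_apply measurable_polarMap .univ,
    Set.preimage_univ, ← Set.univ_prod_univ, Measure.prod_prod] at h
  by_contra hc
  rw [not_lt, top_le_iff] at hc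
  rw [hc, ENNReal.top_mul (radialMeasure_univ_ne_zero _)] at h
  exact lt_irrefl _ h

/-- The hyperplane y = 0 is a null set of the ball and a cone. By Fubini in polar coordinates almost
every direction meets it in a null set of radii, whereas a direction inside it would meet it in all
of them. -/
theorem ae_sphere_yCoord_ne (n : ℕ) : ∀ᵐ θ : Sph n ∂(surfaceMeasure n), yCoord (θ : Amb n) ≠ 0 := by
  have h := isFiniteMeasure_sphereMeasure n (a := -1 / 2) (by norm_num)
  have hb : ∀ᵐ X : Amb n ∂(ballMeasure n 0), yCoord X ≠ 0 := by
    rw [ballMeasure_zero]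
    apply ae_restrict_of_ae
    have : (fun X : Amb n => yCoord X ≠ 0) = fun X => X ∉ ((LinearMap.ker
      (EuclideanSpace.proj (Fin.last n) : Amb n →L[ℝ] ℝ).toLinearMap : Submodule ℝ (Amb n)) : Set (Amb n)) := by
      ext X; simp [yCoord]
    rw [this]
    refine measure_eq_zero_iff_ae_notMem.1 (Measure.addHaar_submodule _ _ ?_)
    intro htop
    have h1 : (EuclideanSpace.single (Fin.last n) (1 : ℝ) : Amb n) ∈ LinearMap.ker
      (EuclideanSpace.proj (Fin.last n) : Amb n →L[ℝ] ℝ).toLinearMap := by rw [htop]; trivial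
    simp at h1
  rw [← (measurePreserving_polarMap n 0).map_eq] at hb
  have hb2 := ae_of_ae_map measurable_polarMap.aemeasurable hb
  have hb3 := Measure.ae_ae_of_ae_prod hb2
  rw [sphereMeasure_zero] at hb3
  filter_upwards [hb3] with θ hθ hy
  have : ∀ᵐ r ∂(radialMeasure ((n : ℝ) + 0)), False := by
    filter_upwards [hθ] with r hr
    apply hr
    simp [polarMap, yCoord_smul, hy]
  simp only [ae_iff, not_false_eq_true, Set.ofPred_true] at this
  exact radialMeasure_univ_ne_zero _ this

theorem sphere_weight_ne (n : ℕ) (a : ℝ) :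
    ∀ᵐ θ : Sph n ∂(surfaceMeasure n), ENNReal.ofReal (|yCoord (θ : Amb n)| ^ a) ≠ 0 := by
  filter_upwards [ae_sphere_yCoord_ne n] with θ hθ
  simp only [ne_eq, ENNReal.ofReal_eq_zero, not_le]
  positivity

theorem surfaceMeasure_ac (n : ℕ) (a : ℝ) : surfaceMeasure n ≪ sphereMeasure n a :=
  withDensity_absolutelyContinuous' (measurable_sphere_weight n a).aemeasurable
    (sphere_weight_ne n a)

theorem sphereMeasure_ac (n : ℕ) (a : ℝ) : sphereMeasure n a ≪ surfaceMeasure n :=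
  withDensity_absolutelyContinuous _ _

theorem ae_sphereMeasure_iff {n : ℕ} (a : ℝ) {P : Sph n → Prop} :
    (∀ᵐ θ ∂(sphereMeasure n a), P θ) ↔ ∀ᵐ θ ∂(surfaceMeasure n), P θ :=
  ⟨fun h => (surfaceMeasure_ac n a).ae_le h, fun h => (sphereMeasure_ac n a).ae_le h⟩

theorem integral_sphereMeasure {n : ℕ} (a : ℝ) {E : Type*} [NormedAddCommGroup E]
    [NormedSpace ℝ E] (g : Sph n → E) :
    ∫ θ, g θ ∂(sphereMeasure n a) = ∫ θ : Sph n, |yCoord (θ : Amb n)| ^ a • g θ ∂(surfaceMeasure n) := by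
  unfold sphereMeasure
  rw [integral_withDensity_eq_integral_toReal_smul (measurable_sphere_weight n a)
    (ae_of_all _ fun _ => ENNReal.ofReal_lt_top)]
  congr 1; ext θ
  rw [ENNReal.toReal_ofReal (by positivity)]

theorem integrable_sphereMeasure_iff {n : ℕ} (a : ℝ) {E : Type*} [NormedAddCommGroup E]
    [NormedSpace ℝ E] {g : Sph n → E} :
    Integrable g (sphereMeasure n a) ↔
      Integrable (fun θ : Sph n => |yCoord (θ : Amb n)| ^ a • g θ) (surfaceMeasure n) := by
  unfold sphereMeasure
  rw [integrable_withDensity_iff_integrable_smul' (measurable_sphere_weight n a)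
    (ae_of_all _ fun _ => ENNReal.ofReal_lt_top)]
  have : ∀ θ : Sph n, (ENNReal.ofReal (|yCoord (θ : Amb n)| ^ a)).toReal = |yCoord (θ : Amb n)| ^ a :=
    fun θ => ENNReal.toReal_ofReal (by positivity)
  simp only [this]

theorem integrable_abs_yCoord_rpow (n : ℕ) {b : ℝ} (hb : -1 < b) :
    Integrable (fun θ : Sph n => |yCoord (θ : Amb n)| ^ b) (surfaceMeasure n) := by
  have := isFiniteMeasure_sphereMeasure n hb
  have h := (integrable_sphereMeasure_iff (n := n) b).1 (integrable_const (1 : ℝ))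
  simpa using h

/-- The square |y|^(-2a) against the weight |y|^a leaves |y|^(-a), which is integrable because a <
1. By Cauchy–Schwarz this embeds the weighted L² into the unweighted L¹, so that the distributional
identities make sense. -/
theorem memLp_inv_weight (n : ℕ) {a : ℝ} (ha : a < 1) :
    MemLp (fun θ : Sph n => |yCoord (θ : Amb n)| ^ (-a)) 2 (sphereMeasure n a) := by
  have hm : Measurable fun θ : Sph n => |yCoord (θ : Amb n)| ^ (-a) := by
    have : Measurable fun θ : Sph n => yCoord (θ : Amb n) :=
      measurable_yCoord.comp measurable_subtype_coe
    fun_prop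
  rw [memLp_two_iff_integrable_sq hm.aestronglyMeasurable, integrable_sphereMeasure_iff]
  refine (integrable_abs_yCoord_rpow n (b := -a) (by linarith)).congr ?_
  filter_upwards [ae_sphere_yCoord_ne n] with θ hθ
  have : 0 < |yCoord (θ : Amb n)| := abs_pos.2 hθ
  rw [smul_eq_mul, ← Real.rpow_natCast, ← Real.rpow_mul this.le, ← Real.rpow_add this]
  congr 1; push_cast; ring

/-- Weighted square integrability on the sphere implies integrability. -/
theorem MemLp.integrable_surface {n : ℕ} {a : ℝ} (ha : a < 1) {E : Type*} [NormedAddCommGroup E]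
    [NormedSpace ℝ E] {g : Sph n → E} (hg : MemLp g 2 (sphereMeasure n a)) :
    Integrable g (surfaceMeasure n) := by
  have h : Integrable (fun θ : Sph n => |yCoord (θ : Amb n)| ^ (-a) • g θ) (sphereMeasure n a) :=
    memLp_one_iff_integrable.1 (hg.smul (memLp_inv_weight n ha))
  rw [integrable_sphereMeasure_iff] at h
  refine h.congr ?_
  filter_upwards [ae_sphere_yCoord_ne n] with θ hθ
  have : 0 < |yCoord (θ : Amb n)| := abs_pos.2 hθ
  rw [smul_smul, ← Real.rpow_add this]
  simp

/-! ### Directions and transfer between the sphere and the ball -/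

open Classical in
/-- The direction `X / |X|` of a point, with an arbitrary value at the origin. -/
noncomputable def dirMap {n : ℕ} (X : Amb n) : Sph n :=
  if h : X = 0 then ⟨EuclideanSpace.single (Fin.last n) 1, by simp⟩
  else ⟨‖X‖⁻¹ • X, by
    rw [mem_sphere_zero_iff_norm, norm_smul, norm_inv, norm_norm,
      inv_mul_cancel₀ (norm_ne_zero_iff.mpr h)]⟩

theorem coe_dirMap {n : ℕ} {X : Amb n} (h : X ≠ 0) : (dirMap X : Amb n) = ‖X‖⁻¹ • X := by
  simp [dirMap, h]

theorem radialExt_eq {n : ℕ} (c : Sph n → ℝ) {X : Amb n} (h : X ≠ 0) :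
    radialExt c X = c (dirMap X) := by
  simp [radialExt, dirMap, h]

theorem dirMap_smul {n : ℕ} (θ : Sph n) {r : ℝ} (hr : 0 < r) :
    dirMap (r • (θ : Amb n)) = θ := by
  have h : r • (θ : Amb n) ≠ 0 := smul_ne_zero hr.ne' (ne_zero_of_mem_unit_sphere θ)
  apply Subtype.ext
  rw [coe_dirMap h, norm_smul, norm_sph, mul_one, Real.norm_eq_abs, abs_of_pos hr, smul_smul,
    inv_mul_cancel₀ hr.ne', one_smul]

theorem measurable_dirMap {n : ℕ} : Measurable (dirMap : Amb n → Sph n) := by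
  refine measurable_of_measurable_on_compl_singleton 0 ?_
  have : ({x | x ≠ 0}.domRestrict dirMap : {x : Amb n | x ≠ 0} → Sph n) =
      fun x : {x : Amb n | x ≠ 0} => (⟨‖(x : Amb n)‖⁻¹ • (x : Amb n), by
        rw [mem_sphere_zero_iff_norm, norm_smul, norm_inv, norm_norm,
          inv_mul_cancel₀ (norm_ne_zero_iff.mpr x.2)]⟩ : Sph n) := by
    ext1 x
    apply Subtype.ext
    exact coe_dirMap x.2
  rw [this]
  apply Measurable.subtype_mk
  fun_prop

theorem ae_radialMeasure_mem (b : ℝ) : ∀ᵐ r ∂(radialMeasure b), r ∈ Set.Ioo (0 : ℝ) 1 :=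
  (withDensity_absolutelyContinuous _ _).ae_le (ae_restrict_mem measurableSet_Ioo)

theorem ae_prod_radial_mem {n : ℕ} (μ : Measure (Sph n)) (b : ℝ) :
    ∀ᵐ p ∂(μ.prod (radialMeasure b)), p.2 ∈ Set.Ioo (0 : ℝ) 1 :=
  Measure.quasiMeasurePreserving_snd.ae (ae_radialMeasure_mem b)

theorem quasiMeasurePreserving_dirMap (n : ℕ) (a : ℝ) :
    Measure.QuasiMeasurePreserving dirMap (ballMeasure n a) (sphereMeasure n a) := by
  refine ⟨measurable_dirMap, Measure.AbsolutelyContinuous.mk fun s hs h0 => ?_⟩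
  rw [Measure.map_apply measurable_dirMap hs, ← (measurePreserving_polarMap n a).map_eq,
    Measure.map_apply measurable_polarMap (measurable_dirMap hs)]
  have h1 : ∀ᵐ p ∂((sphereMeasure n a).prod (radialMeasure (n + a))), p.1 ∉ s :=
    Measure.quasiMeasurePreserving_fst.ae (measure_eq_zero_iff_ae_notMem.1 h0)
  rw [measure_eq_zero_iff_ae_notMem]
  filter_upwards [h1, ae_prod_radial_mem _ _] with p hp hr hmem
  apply hp
  simpa [polarMap, dirMap_smul _ hr.1] using hmem

theorem ae_ball_ne_zero (n : ℕ) (a : ℝ) : ∀ᵐ X ∂(ballMeasure n a), X ≠ 0 := by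
  rw [← (measurePreserving_polarMap n a).map_eq]
  refine (ae_map_iff measurable_polarMap.aemeasurable (measurableSet_singleton _).compl).2 ?_
  filter_upwards [ae_prod_radial_mem _ _] with p hr
  exact smul_ne_zero hr.1.ne' (ne_zero_of_mem_unit_sphere p.1)

theorem ballMeasure_ac (n : ℕ) (a : ℝ) :
    ballMeasure n a ≪ volume.restrict (Metric.ball (0 : Amb n) 1) :=
  withDensity_absolutelyContinuous _ _

theorem ae_ball_yCoord_ne (n : ℕ) (a : ℝ) : ∀ᵐ X ∂(ballMeasure n a), yCoord X ≠ 0 := by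
  have h := (ae_sphereMeasure_iff a).2 (ae_sphere_yCoord_ne n)
  filter_upwards [(quasiMeasurePreserving_dirMap n a).ae h, ae_ball_ne_zero n a] with X hX h0
  intro hy
  rw [coe_dirMap h0, yCoord_smul, hy] at hX
  simp at hX

theorem restrict_ball_ac (n : ℕ) (a : ℝ) :
    volume.restrict (Metric.ball (0 : Amb n) 1) ≪ ballMeasure n a := by
  refine withDensity_absolutelyContinuous' (measurable_weight n a).aemeasurable ?_
  have := ae_ball_yCoord_ne n 0
  rw [ballMeasure_zero] at this
  filter_upwards [this] with X hX
  simp only [ne_eq, ENNReal.ofReal_eq_zero, not_le]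
  positivity

theorem ae_ballMeasure_iff {n : ℕ} (a : ℝ) {P : Amb n → Prop} :
    (∀ᵐ X ∂(ballMeasure n a), P X) ↔
      ∀ᵐ X ∂(volume.restrict (Metric.ball (0 : Amb n) 1)), P X :=
  ⟨fun h => (restrict_ball_ac n a).ae_le h, fun h => (ballMeasure_ac n a).ae_le h⟩

theorem integral_ballMeasure_polar {n : ℕ} {a : ℝ} {E : Type*} [NormedAddCommGroup E]
    [NormedSpace ℝ E] {f : Amb n → E} (hf : AEStronglyMeasurable f (ballMeasure n a)) :
    ∫ X, f X ∂(ballMeasure n a) =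
      ∫ p, f (polarMap p) ∂((sphereMeasure n a).prod (radialMeasure (n + a))) := by
  rw [← (measurePreserving_polarMap n a).map_eq] at hf ⊢
  rw [integral_map measurable_polarMap.aemeasurable hf]

theorem integrable_ballMeasure_polar {n : ℕ} {a : ℝ} {E : Type*} [NormedAddCommGroup E]
    [NormedSpace ℝ E] {f : Amb n → E} (hf : AEStronglyMeasurable f (ballMeasure n a)) :
    Integrable f (ballMeasure n a) ↔
      Integrable (f ∘ polarMap) ((sphereMeasure n a).prod (radialMeasure (n + a))) := by
  rw [← (measurePreserving_polarMap n a).map_eq] at hf ⊢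
  rw [integrable_map_measure hf measurable_polarMap.aemeasurable]

/-! ### One-dimensional integrals against r^b -/

theorem integral_radialMeasure (b : ℝ) (g : ℝ → ℝ) :
    ∫ r, g r ∂(radialMeasure b) = ∫ r in (0 : ℝ)..1, r ^ b * g r := by
  unfold radialMeasure
  rw [integral_withDensity_eq_integral_toReal_smul (by fun_prop)
    (ae_of_all _ fun _ => ENNReal.ofReal_lt_top), intervalIntegral.integral_of_le zero_le_one,
    ← integral_Ioc_eq_integral_Ioo]
  refine setIntegral_congr_fun measurableSet_Ioc fun r hr => ?_
  rw [ENNReal.toReal_ofReal (Real.rpow_nonneg hr.1.le _), smul_eq_mul]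

theorem integrable_radialMeasure_iff (b : ℝ) (g : ℝ → ℝ) :
    Integrable g (radialMeasure b) ↔ IntervalIntegrable (fun r => r ^ b * g r) volume 0 1 := by
  unfold radialMeasure
  rw [integrable_withDensity_iff_integrable_smul' (by fun_prop)
    (ae_of_all _ fun _ => ENNReal.ofReal_lt_top), intervalIntegrable_iff_integrableOn_Ioc_of_le
    zero_le_one, integrableOn_Ioc_iff_integrableOn_Ioo]
  refine integrable_congr ?_
  filter_upwards [ae_restrict_mem measurableSet_Ioo] with r hr
  rw [ENNReal.toReal_ofReal (Real.rpow_nonneg hr.1.le _), smul_eq_mul]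

theorem integral_rpow_radialMeasure {b t : ℝ} (h : -1 < b + t) :
    ∫ r, r ^ t ∂(radialMeasure b) = 1 / (b + t + 1) := by
  rw [integral_radialMeasure]
  have : ∫ r in (0 : ℝ)..1, r ^ b * r ^ t = ∫ r in (0 : ℝ)..1, r ^ (b + t) := by
    rw [intervalIntegral.integral_of_le zero_le_one, intervalIntegral.integral_of_le zero_le_one]
    refine setIntegral_congr_fun measurableSet_Ioc fun r hr => ?_
    exact (Real.rpow_add hr.1 _ _).symm
  rw [this, integral_rpow (Or.inl h), Real.one_rpow, Real.zero_rpow (by linarith), sub_zero]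

theorem integrable_rpow_radialMeasure {b t : ℝ} (h : -1 < b + t) :
    Integrable (fun r : ℝ => r ^ t) (radialMeasure b) := by
  rw [integrable_radialMeasure_iff]
  refine (intervalIntegral.intervalIntegrable_rpow' h).congr ?_
  intro r hr
  rw [Set.uIoc_of_le zero_le_one] at hr
  exact Real.rpow_add hr.1 _ _

/-- Integration by parts against `r^b` on `(0, 1)`. -/
theorem integral_rpow_mul_deriv {b : ℝ} (hb : 0 < b) {g g' : ℝ → ℝ}
    (hg : ∀ r, HasDerivAt g (g' r) r) (hg' : Continuous g') (h1 : g 1 = 0) :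
    ∫ r in (0 : ℝ)..1, r ^ b * g' r = -(b * ∫ r in (0 : ℝ)..1, r ^ (b - 1) * g r) := by
  have hcont : Continuous g := continuous_iff_continuousAt.2 fun r => (hg r).continuousAt
  have := intervalIntegral.integral_mul_deriv_eq_deriv_mul_of_hasDeriv_right
    (a := 0) (b := 1) (u := fun r : ℝ => r ^ b) (u' := fun r => b * r ^ (b - 1)) (v := g) (v' := g')
    (Real.continuous_rpow_const hb.le).continuousOn hcont.continuousOn
    (fun r hr => by
      rw [min_eq_left zero_le_one] at hr
      exact (Real.hasDerivAt_rpow_const (Or.inl hr.1.ne')).hasDerivWithinAt)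
    (fun r _ => (hg r).hasDerivWithinAt)
    ((intervalIntegral.intervalIntegrable_rpow' (by linarith)).const_mul b)
    (hg'.intervalIntegrable _ _)
  rw [this, h1, Real.zero_rpow hb.ne', ← intervalIntegral.integral_const_mul]
  simp [mul_assoc]

/-! ### The divergence theorem on the sphere -/

theorem integral_fderiv_eq_zero {n : ℕ} {Φ : Amb n → ℝ} (h : ContDiff ℝ ∞ Φ)
    (hc : HasCompactSupport Φ) (e : Amb n) : ∫ X, fderiv ℝ Φ X e = 0 := by
  have h1 : Integrable Φ := h.continuous.integrable_of_hasCompactSupport hc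
  have h2 : Integrable fun X => fderiv ℝ Φ X e :=
    ((h.continuous_fderiv (by simp)).clm_apply continuous_const).integrable_of_hasCompactSupport
      (hc.fderiv_apply ℝ e)
  have := integral_mul_fderiv_eq_neg_fderiv_mul_of_integrable (μ := (volume : Measure (Amb n)))
    (f := fun _ => (1 : ℝ)) (g := Φ) (v := e) (by simp) (by simpa using h2)
    (by simpa using h1) (fun _ _ => differentiableAt_const _)
    (fun _ _ => h.differentiable (by simp) _)
  simpa using this

theorem hasDerivAt_norm_line {n : ℕ} {X : Amb n} (hX : X ≠ 0) (e : Amb n) :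
    HasDerivAt (fun t : ℝ => ‖X + t • e‖) (inner ℝ X e / ‖X‖) 0 := by
  have h1 : HasDerivAt (fun t : ℝ => X + t • e) e 0 := by
    simpa using ((hasDerivAt_id (0 : ℝ)).smul_const e).const_add X
  have h2 := h1.norm_sq.sqrt (by simpa using hX)
  simp only [zero_smul, add_zero, Real.sqrt_sq (norm_nonneg _)] at h2
  convert h2 using 1
  field_simp

/-- Differentiation along the line t ↦ rθ + te: the cutoff contributes a radial term with χ', and
the 0-homogeneous factor contributes the tangential derivative of `F`, scaled by 1/r. -/
theorem fderiv_cutoff_dir {n : ℕ} {F : Amb n → ℝ} (hF : ContDiff ℝ ∞ F) {χ : ℝ → ℝ}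
    (hχ : ContDiff ℝ ∞ χ) (θ : Sph n) {r : ℝ} (hr : 0 < r) (e : Amb n)
    (hd : DifferentiableAt ℝ (fun X : Amb n => χ ‖X‖ * F (‖X‖⁻¹ • X)) (r • (θ : Amb n))) :
    fderiv ℝ (fun X : Amb n => χ ‖X‖ * F (‖X‖⁻¹ • X)) (r • (θ : Amb n)) e =
      inner ℝ (θ : Amb n) e * F θ * deriv χ r +
        (fderiv ℝ F θ e - inner ℝ (θ : Amb n) e * fderiv ℝ F θ (θ : Amb n)) * (χ r * r⁻¹) := by
  have hX : r • (θ : Amb n) ≠ 0 := smul_ne_zero hr.ne' (ne_zero_of_mem_unit_sphere θ)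
  have hn : ‖r • (θ : Amb n)‖ = r := by
    rw [norm_smul, norm_sph, Real.norm_eq_abs, abs_of_pos hr, mul_one]
  have hline : HasDerivAt (fun t : ℝ => r • (θ : Amb n) + t • e) e 0 := by
    simpa using ((hasDerivAt_id (0 : ℝ)).smul_const e).const_add (r • (θ : Amb n))
  have hN := hasDerivAt_norm_line hX e
  have hin : inner ℝ (r • (θ : Amb n)) e / ‖r • (θ : Amb n)‖ = inner ℝ (θ : Amb n) e := by
    rw [hn, real_inner_smul_left]; field_simp
  rw [hin] at hN
  have h1 : HasDerivAt (fun t : ℝ => χ ‖r • (θ : Amb n) + t • e‖)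
      (deriv χ r * inner ℝ (θ : Amb n) e) 0 := by
    have := (hχ.differentiable (by simp) r).hasDerivAt
    rw [← hn] at this
    have h0 : ‖r • (θ : Amb n)‖ = ‖r • (θ : Amb n) + (0 : ℝ) • e‖ := by simp
    rw [h0] at this
    have := this.comp 0 hN
    simpa [hn, Function.comp_def] using this
  have h2 : HasDerivAt (fun t : ℝ => ‖r • (θ : Amb n) + t • e‖⁻¹ • (r • (θ : Amb n) + t • e))
      (r⁻¹ • e + (-(inner ℝ (θ : Amb n) e) / r ^ 2) • (r • (θ : Amb n))) 0 := by
    have hinv := hN.inv (by simpa using hX)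
    have := hinv.smul hline
    simp only [zero_smul, add_zero, hn, Pi.inv_apply] at this
    exact this
  have h3 : HasDerivAt (fun t : ℝ => F (‖r • (θ : Amb n) + t • e‖⁻¹ • (r • (θ : Amb n) + t • e)))
      (fderiv ℝ F θ (r⁻¹ • e + (-(inner ℝ (θ : Amb n) e) / r ^ 2) • (r • (θ : Amb n)))) 0 := by
    have hθ : (θ : Amb n) = ‖r • (θ : Amb n) + (0 : ℝ) • e‖⁻¹ • (r • (θ : Amb n) + (0 : ℝ) • e) := by
      simp [hn, smul_smul, inv_mul_cancel₀ hr.ne']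
    have hFd := (hF.differentiable (by simp) (θ : Amb n)).hasFDerivAt
    have := HasFDerivAt.comp_hasDerivAt (f := fun t : ℝ =>
      ‖r • (θ : Amb n) + t • e‖⁻¹ • (r • (θ : Amb n) + t • e)) (0 : ℝ) (l := F)
      (l' := fderiv ℝ F θ) (by rw [← hθ]; exact hFd) h2
    exact this
  have h4 := h1.mul h3
  have h5 : HasDerivAt (fun t : ℝ => (fun X : Amb n => χ ‖X‖ * F (‖X‖⁻¹ • X))
      (r • (θ : Amb n) + t • e)) (fderiv ℝ (fun X : Amb n => χ ‖X‖ * F (‖X‖⁻¹ • X))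
        (r • (θ : Amb n)) e) 0 := by
    have := HasFDerivAt.comp_hasDerivAt (f := fun t : ℝ => r • (θ : Amb n) + t • e) (0 : ℝ)
      (l := fun X : Amb n => χ ‖X‖ * F (‖X‖⁻¹ • X))
      (l' := fderiv ℝ (fun X : Amb n => χ ‖X‖ * F (‖X‖⁻¹ • X)) (r • (θ : Amb n)))
      (by simpa using hd.hasFDerivAt) hline
    exact this
  rw [h5.unique h4]
  simp only [zero_smul, add_zero, hn, smul_smul, map_add, map_smul, smul_eq_mul,
    inv_mul_cancel₀ hr.ne', one_smul]
  field_simp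
  ring

/-- Deduced from ∫ ∂_e Φ = 0 in the ambient space for Φ = χ(|X|) F(X/|X|). In polar coordinates this
separates into (∫χ' r^n)(∫A) + (∫χ r^(n-1))(∫B) = 0; integration by parts in r gives ∫χ' r^n = -n ∫χ
r^(n-1), and the positive factor ∫χ r^(n-1) is divided out. -/
theorem integral_sphere_div {n : ℕ} (hn : 1 ≤ n) {F : Amb n → ℝ} (hF : ContDiff ℝ ∞ F)
    (e : Amb n) :
    ∫ θ : Sph n, (fderiv ℝ F θ e - inner ℝ (θ : Amb n) e * fderiv ℝ F θ (θ : Amb n)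
      - n * F θ * inner ℝ (θ : Amb n) e) ∂(surfaceMeasure n) = 0 := by
  -- The bump lives in [1/4, 3/4]: away from the origin, where X/|X| is singular, and inside the
  -- unit ball.
  let χ : ContDiffBump (1 / 2 : ℝ) := ⟨1 / 8, 1 / 4, by norm_num, by norm_num⟩
  have hχ : ContDiff ℝ ∞ χ := χ.contDiff
  have hχ0 : ∀ r : ℝ, |r - 1 / 2| ≥ 1 / 4 → χ r = 0 := fun r hr => χ.zero_of_le_dist hr
  let Φ : Amb n → ℝ := fun X => χ ‖X‖ * F (‖X‖⁻¹ • X)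
  have hΦ : ContDiff ℝ ∞ Φ := by
    rw [contDiff_iff_contDiffAt]
    intro X
    by_cases hX : X = 0
    · subst hX
      have : Φ =ᶠ[𝓝 0] fun _ => 0 := by
        filter_upwards [Metric.ball_mem_nhds (0 : Amb n) (show (0 : ℝ) < 1 / 4 by norm_num)]
          with X hX
        rw [mem_ball_zero_iff] at hX
        simp only [Φ]
        rw [hχ0, zero_mul]
        rw [abs_of_neg (by linarith)]; linarith
      exact contDiffAt_const.congr_of_eventuallyEq this
    · have h1 : ContDiffAt ℝ ∞ (fun X : Amb n => ‖X‖) X := contDiffAt_norm ℝ hX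
      exact (hχ.contDiffAt.comp X h1).mul (hF.contDiffAt.comp X
        ((h1.inv (by simpa using hX)).smul contDiffAt_id))
  have hsupp : Function.support Φ ⊆ Metric.closedBall 0 (3 / 4) := by
    intro X hX
    rw [mem_closedBall_zero_iff]
    by_contra hc
    apply hX
    simp only [Φ]
    rw [hχ0, zero_mul]
    rw [abs_of_pos (by linarith)]; linarith
  have hcs : HasCompactSupport Φ :=
    HasCompactSupport.of_support_subset_isCompact (isCompact_closedBall _ _) hsupp
  have h0 := integral_fderiv_eq_zero hΦ hcs e
  have hts : tsupport Φ ⊆ Metric.closedBall 0 (3 / 4) :=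
    closure_minimal hsupp Metric.isClosed_closedBall
  have hball : ∫ X, fderiv ℝ Φ X e = ∫ X in Metric.ball 0 1, fderiv ℝ Φ X e := by
    symm
    apply setIntegral_eq_integral_of_forall_compl_eq_zero
    intro X hX
    have : X ∉ tsupport Φ := fun h => hX (by
      have := hts h
      rw [mem_closedBall_zero_iff] at this
      rw [mem_ball_zero_iff]; linarith)
    have : X ∉ tsupport (fderiv ℝ Φ) := fun h => this (tsupport_fderiv_subset ℝ h)
    rw [image_eq_zero_of_notMem_tsupport this]; rfl
  have hcont : Continuous fun X => fderiv ℝ Φ X e :=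
    (hΦ.continuous_fderiv (by simp)).clm_apply continuous_const
  rw [hball, ← ballMeasure_zero, integral_ballMeasure_polar hcont.aestronglyMeasurable,
    sphereMeasure_zero] at h0
  set A : Sph n → ℝ := fun θ => inner ℝ (θ : Amb n) e * F θ with hA
  set B : Sph n → ℝ := fun θ => fderiv ℝ F θ e - inner ℝ (θ : Amb n) e * fderiv ℝ F θ (θ : Amb n)
    with hB
  have hcoe : Continuous fun θ : Sph n => (θ : Amb n) := continuous_subtype_val
  have hFc : Continuous fun θ : Sph n => F θ := hF.continuous.comp hcoe
  have hAc : Continuous A := (hcoe.inner continuous_const).mul hFc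
  have hfd : Continuous fun θ : Sph n => fderiv ℝ F (θ : Amb n) :=
    (hF.continuous_fderiv (by simp)).comp hcoe
  have hBc : Continuous B := (hfd.clm_apply continuous_const).sub
    ((hcoe.inner continuous_const).mul (hfd.clm_apply hcoe))
  have hAi : Integrable A (surfaceMeasure n) :=
    hAc.integrable_of_hasCompactSupport (HasCompactSupport.of_compactSpace _)
  have hBi : Integrable B (surfaceMeasure n) :=
    hBc.integrable_of_hasCompactSupport (HasCompactSupport.of_compactSpace _)
  have hχd : Continuous (deriv χ) := hχ.continuous_deriv (by simp)
  have hn0 : (0 : ℝ) < n := by exact_mod_cast hn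
  have hg1 : Integrable (deriv χ) (radialMeasure (n + 0)) := by
    rw [integrable_radialMeasure_iff]
    exact ((Real.continuous_rpow_const (by positivity)).mul hχd).intervalIntegrable _ _
  have hrinv : Continuous fun r : ℝ => χ r * r⁻¹ := by
    rw [continuous_iff_continuousAt]
    intro r
    by_cases hr : r = 0
    · subst hr
      have : (fun r : ℝ => χ r * r⁻¹) =ᶠ[𝓝 0] fun _ => 0 := by
        filter_upwards [Metric.ball_mem_nhds (0 : ℝ) (show (0 : ℝ) < 1 / 4 by norm_num)] with r hr
        rw [mem_ball_zero_iff, Real.norm_eq_abs, abs_lt] at hr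
        rw [hχ0, zero_mul]
        rw [abs_of_neg (by linarith)]; linarith
      exact continuousAt_const.congr this.symm
    · exact hχ.continuous.continuousAt.mul (continuousAt_inv₀ hr)
  have hg2 : Integrable (fun r => χ r * r⁻¹) (radialMeasure (n + 0)) := by
    rw [integrable_radialMeasure_iff]
    exact ((Real.continuous_rpow_const (by positivity)).mul hrinv).intervalIntegrable _ _
  have heq : ∫ p, fderiv ℝ Φ (polarMap p) e ∂((surfaceMeasure n).prod (radialMeasure (n + 0))) =
      (∫ θ, A θ ∂(surfaceMeasure n)) * (∫ r, deriv χ r ∂(radialMeasure (n + 0))) +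
      (∫ θ, B θ ∂(surfaceMeasure n)) * (∫ r, χ r * r⁻¹ ∂(radialMeasure (n + 0))) := by
    rw [← integral_prod_mul, ← integral_prod_mul, ← integral_add (hAi.mul_prod hg1)
      (hBi.mul_prod hg2)]
    apply integral_congr_ae
    filter_upwards [ae_prod_radial_mem _ _] with p hp
    exact fderiv_cutoff_dir hF hχ p.1 hp.1 e (hΦ.differentiable (by simp) _)
  have hI : ∫ r, deriv χ r ∂(radialMeasure ((n : ℝ) + 0)) =
      -(n * ∫ r, χ r * r⁻¹ ∂(radialMeasure (n + 0))) := by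
    rw [integral_radialMeasure, integral_radialMeasure, add_zero,
      integral_rpow_mul_deriv hn0 (fun r => (hχ.differentiable (by simp) r).hasDerivAt) hχd
        (hχ0 1 (by norm_num))]
    congr 2
    rw [intervalIntegral.integral_of_le zero_le_one, intervalIntegral.integral_of_le zero_le_one]
    refine setIntegral_congr_fun measurableSet_Ioc fun r hr => ?_
    rw [Real.rpow_sub_one hr.1.ne']
    field_simp
  have hpos : 0 < ∫ r, χ r * r⁻¹ ∂(radialMeasure ((n : ℝ) + 0)) := by
    rw [integral_radialMeasure]
    apply intervalIntegral.integral_pos zero_lt_one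
      (((Real.continuous_rpow_const (by positivity)).mul hrinv).continuousOn)
    · intro r hr
      have := χ.nonneg (x := r)
      have := hr.1
      simp only [Pi.mul_apply]
      positivity
    · refine ⟨1 / 2, by norm_num, ?_⟩
      have : χ (1 / 2) = 1 := χ.one_of_mem_closedBall (by simp [χ])
      simp only [Pi.mul_apply]
      rw [this]; positivity
  rw [heq, hI] at h0
  have hfin : (∫ θ, B θ ∂(surfaceMeasure n)) - n * ∫ θ, A θ ∂(surfaceMeasure n) = 0 := by
    have : ((∫ θ, B θ ∂(surfaceMeasure n)) - n * ∫ θ, A θ ∂(surfaceMeasure n)) *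
        ∫ r, χ r * r⁻¹ ∂(radialMeasure ((n : ℝ) + 0)) = 0 := by linarith
    exact (mul_eq_zero.1 this).resolve_right hpos.ne'
  rw [← hfin, ← integral_const_mul, ← integral_sub hBi (hAi.const_mul _)]
  congr 1; ext θ
  simp only [hA, hB]; ring

/-! ### Weak gradients on the sphere -/

/-- The component of `V` tangent to the unit sphere at `θ`. -/
noncomputable def tangentPart {n : ℕ} (V : Amb n) (θ : Sph n) : Amb n :=
  V - (inner ℝ V (θ : Amb n)) • (θ : Amb n)

theorem norm_tangentPart_le {n : ℕ} (V : Amb n) (θ : Sph n) : ‖tangentPart V θ‖ ≤ 2 * ‖V‖ := by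
  have h1 : ‖(inner ℝ V (θ : Amb n)) • (θ : Amb n)‖ ≤ ‖V‖ := by
    rw [norm_smul, norm_sph, mul_one]
    simpa [norm_sph] using norm_inner_le_norm (𝕜 := ℝ) V (θ : Amb n)
  calc ‖tangentPart V θ‖ ≤ ‖V‖ + ‖(inner ℝ V (θ : Amb n)) • (θ : Amb n)‖ := norm_sub_le _ _
    _ ≤ _ := by linarith

/-- The integrand of the distributional tangential derivative of a test function. -/
noncomputable def testDiv {n : ℕ} (φ : Amb n → ℝ) (e : Amb n) (θ : Sph n) : ℝ :=
  fderiv ℝ φ θ e - inner ℝ (θ : Amb n) e * fderiv ℝ φ θ (θ : Amb n)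
    - n * φ θ * inner ℝ (θ : Amb n) e

theorem continuous_testDiv {n : ℕ} {φ : Amb n → ℝ} (hφ : ContDiff ℝ ∞ φ) (e : Amb n) :
    Continuous (testDiv φ e) := by
  have hcoe : Continuous fun θ : Sph n => (θ : Amb n) := continuous_subtype_val
  have hfd : Continuous fun θ : Sph n => fderiv ℝ φ (θ : Amb n) :=
    (hφ.continuous_fderiv (by simp)).comp hcoe
  have := hφ.continuous
  unfold testDiv
  fun_prop

theorem exists_bound_of_continuous {n : ℕ} {E : Type*} [NormedAddCommGroup E] {f : Sph n → E}
    (hf : Continuous f) : ∃ M, 0 ≤ M ∧ ∀ θ, ‖f θ‖ ≤ M := by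
  obtain ⟨M, hM⟩ := isCompact_univ.exists_bound_of_continuousOn (f := f) hf.continuousOn
  exact ⟨max M 0, le_max_right _ _, fun θ => (hM θ trivial).trans (le_max_left _ _)⟩

theorem Continuous.integrable_sphere {n : ℕ} {E : Type*} [NormedAddCommGroup E] {f : Sph n → E}
    (hf : Continuous f) : Integrable f (surfaceMeasure n) :=
  hf.integrable_of_hasCompactSupport (HasCompactSupport.of_compactSpace _)

/-- The divergence identity for the product of `f` and `φ`, expanded by the Leibniz rule: a
classical tangential gradient is a weak one. -/
theorem integral_mul_testDiv_of_contDiff {n : ℕ} (hn : 1 ≤ n) {f : Amb n → ℝ}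
    (hf : ContDiff ℝ ∞ f) {V : Amb n → Amb n} (hV : ∀ X e, fderiv ℝ f X e = inner ℝ (V X) e)
    {φ : Amb n → ℝ} (hφ : ContDiff ℝ ∞ φ) (e : Amb n) :
    ∫ θ : Sph n, f θ * testDiv φ e θ ∂(surfaceMeasure n) =
      -∫ θ : Sph n, inner ℝ (tangentPart (V θ) θ) e * φ θ ∂(surfaceMeasure n) := by
  have h := integral_sphere_div hn (hf.mul hφ) e
  have hd : ∀ X v, fderiv ℝ (fun x => f x * φ x) X v =
      f X * fderiv ℝ φ X v + φ X * fderiv ℝ f X v := by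
    intro X v
    rw [fderiv_fun_mul (hf.differentiable (by simp) X) (hφ.differentiable (by simp) X)]
    simp
  have hcoe : Continuous fun θ : Sph n => (θ : Amb n) := continuous_subtype_val
  have hfc := hf.continuous
  have hφc := hφ.continuous
  have hfd : Continuous fun θ : Sph n => fderiv ℝ f (θ : Amb n) :=
    (hf.continuous_fderiv (by simp)).comp hcoe
  have hT : ∀ θ : Sph n, inner ℝ (tangentPart (V θ) θ) e =
      fderiv ℝ f θ e - inner ℝ (θ : Amb n) e * fderiv ℝ f θ (θ : Amb n) := by
    intro θ
    rw [hV, hV, tangentPart, inner_sub_left, real_inner_smul_left]; ring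
  have hc1 := continuous_testDiv hφ e
  have hi1 : Integrable (fun θ : Sph n => f θ * testDiv φ e θ) (surfaceMeasure n) :=
    Continuous.integrable_sphere (by fun_prop)
  have hi2 : Integrable (fun θ : Sph n => inner ℝ (tangentPart (V θ) θ) e * φ θ)
      (surfaceMeasure n) := by
    simp only [hT]
    exact Continuous.integrable_sphere (by fun_prop)
  rw [eq_neg_iff_add_eq_zero, ← integral_add hi1 hi2, ← h]
  congr 1; ext θ
  rw [hT, hd, hd, testDiv]
  ring

/-- A dominated limit of restrictions of smooth functions has the limit of the tangential
gradients as its weak tangential gradient. -/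
theorem isWeakSphereGrad_of_tendsto {n : ℕ} (hn : 1 ≤ n) {a : ℝ} {f : ℕ → Amb n → ℝ}
    {V : ℕ → Amb n → Amb n} (hf : ∀ k, ContDiff ℝ ∞ (f k))
    (hV : ∀ k X e, fderiv ℝ (f k) X e = inner ℝ (V k X) e) {c : Sph n → ℝ} {U : Sph n → Amb n}
    {M : ℝ} {B : Sph n → ℝ} (hfM : ∀ k, ∀ θ : Sph n, |f k θ| ≤ M)
    (hB : Integrable B (surfaceMeasure n))
    (hVB : ∀ k, ∀ᵐ θ : Sph n ∂(surfaceMeasure n), ‖V k θ‖ ≤ B θ)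
    (hfc : ∀ᵐ θ : Sph n ∂(surfaceMeasure n), Tendsto (fun k => f k θ) atTop (𝓝 (c θ)))
    (hVU : ∀ᵐ θ : Sph n ∂(surfaceMeasure n), Tendsto (fun k => V k θ) atTop (𝓝 (U θ)))
    (hL2 : MemLp (fun θ => tangentPart (U θ) θ) 2 (sphereMeasure n a)) :
    IsWeakSphereGrad a c fun θ => tangentPart (U θ) θ := by
  refine ⟨hL2, fun φ hφ e => ?_⟩
  have hcoe : Continuous fun θ : Sph n => (θ : Amb n) := continuous_subtype_val
  have hφc := hφ.continuous
  have hc1 := continuous_testDiv hφ e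
  obtain ⟨K, hK0, hK⟩ := exists_bound_of_continuous hc1
  obtain ⟨L, hL0, hL⟩ := exists_bound_of_continuous (hφc.comp hcoe)
  -- By Riesz representation the field `V k` is the gradient of the smooth function `f k`, hence
  -- continuous.
  have hVf : ∀ k, Continuous (V k) := by
    intro k
    have h1 : V k = fun X => (InnerProductSpace.toDual ℝ (Amb n)).symm (fderiv ℝ (f k) X) := by
      ext1 X
      apply (InnerProductSpace.toDual ℝ (Amb n)).injective
      rw [LinearIsometryEquiv.apply_symm_apply]
      ext1 e
      rw [hV, InnerProductSpace.toDual_apply_apply]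
    rw [h1]
    exact (InnerProductSpace.toDual ℝ (Amb n)).symm.continuous.comp
      ((hf k).continuous_fderiv (by simp))
  have hM0 : ∀ θ : Sph n, 0 ≤ M := fun θ => (abs_nonneg _).trans (hfM 0 θ)
  have t1 : Tendsto (fun k => ∫ θ : Sph n, f k θ * testDiv φ e θ ∂(surfaceMeasure n)) atTop
      (𝓝 (∫ θ : Sph n, c θ * testDiv φ e θ ∂(surfaceMeasure n))) := by
    refine tendsto_integral_of_dominated_convergence (fun _ => M * K) (fun k => ?_)
      (integrable_const _) (fun k => ae_of_all _ fun θ => ?_) ?_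
    · have := (hf k).continuous
      exact Continuous.aestronglyMeasurable (by fun_prop)
    · rw [norm_mul]
      exact mul_le_mul (hfM k θ) (hK θ) (norm_nonneg _) (hM0 θ)
    · filter_upwards [hfc] with θ hθ
      exact hθ.mul_const _
  have t2 : Tendsto (fun k => ∫ θ : Sph n, inner ℝ (tangentPart (V k θ) θ) e * φ θ
      ∂(surfaceMeasure n)) atTop
      (𝓝 (∫ θ : Sph n, inner ℝ (tangentPart (U θ) θ) e * φ θ ∂(surfaceMeasure n))) := by
    refine tendsto_integral_of_dominated_convergence (fun θ => 2 * B θ * (‖e‖ * L)) (fun k => ?_)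
      ((hB.const_mul 2).mul_const _) (fun k => ?_) ?_
    · have := hVf k
      unfold tangentPart
      exact Continuous.aestronglyMeasurable (by fun_prop)
    · filter_upwards [hVB k] with θ hθ
      rw [norm_mul]
      have h1 := norm_inner_le_norm (𝕜 := ℝ) (tangentPart (V k θ) θ) e
      have h2 := norm_tangentPart_le (V k θ) θ
      have h3 := hL θ
      simp only [Function.comp] at h3
      calc _ ≤ (‖tangentPart (V k θ) θ‖ * ‖e‖) * L :=
            mul_le_mul h1 h3 (norm_nonneg _) (by positivity)
        _ ≤ (2 * B θ * ‖e‖) * L := by gcongr; linarith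
        _ = _ := by ring
    · filter_upwards [hVU] with θ hθ
      refine Tendsto.mul_const _ (Tendsto.inner ?_ tendsto_const_nhds)
      exact hθ.sub ((hθ.inner tendsto_const_nhds).smul_const _)
  have h3 : ∀ k, ∫ θ : Sph n, f k θ * testDiv φ e θ ∂(surfaceMeasure n) =
      -∫ θ : Sph n, inner ℝ (tangentPart (V k θ) θ) e * φ θ ∂(surfaceMeasure n) :=
    fun k => integral_mul_testDiv_of_contDiff hn (hf k) (hV k) hφ e
  exact tendsto_nhds_unique t1 (by simpa only [h3] using t2.neg)

theorem isWeakSphereGrad_of_contDiff {n : ℕ} (hn : 1 ≤ n) {a : ℝ} (ha : -1 < a) {f : Amb n → ℝ}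
    (hf : ContDiff ℝ ∞ f) {V : Amb n → Amb n} (hVc : Continuous V)
    (hV : ∀ X e, fderiv ℝ f X e = inner ℝ (V X) e) :
    IsWeakSphereGrad a (fun θ : Sph n => f θ) fun θ => tangentPart (V θ) θ := by
  refine ⟨?_, fun φ hφ e => integral_mul_testDiv_of_contDiff hn hf hV hφ e⟩
  have := isFiniteMeasure_sphereMeasure n ha
  have hcoe : Continuous fun θ : Sph n => (θ : Amb n) := continuous_subtype_val
  have hc : Continuous fun θ : Sph n => tangentPart (V θ) θ := by
    unfold tangentPart; fun_prop
  obtain ⟨M, _, hM⟩ := exists_bound_of_continuous hc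
  exact MemLp.of_bound hc.aestronglyMeasurable M (ae_of_all _ hM)

/-- The 0-homogeneous extension of `g` reduces the claim to the fundamental lemma of the calculus of
variations in the open ball. -/
theorem ae_eq_zero_of_integral_mul_contDiff {n : ℕ} {g : Sph n → ℝ} (hg : Integrable g (surfaceMeasure n))
    (h : ∀ φ : Amb n → ℝ, ContDiff ℝ ∞ φ → ∫ θ : Sph n, g θ * φ θ ∂(surfaceMeasure n) = 0) :
    ∀ᵐ θ ∂(surfaceMeasure n), g θ = 0 := by
  set f : Amb n → ℝ := fun X => g (dirMap X) with hf
  have hfm : AEStronglyMeasurable f (ballMeasure n 0) := by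
    have := hg.aestronglyMeasurable
    rw [← sphereMeasure_zero] at this
    exact this.comp_quasiMeasurePreserving (quasiMeasurePreserving_dirMap n 0)
  have hpol : ∀ᵐ p ∂((sphereMeasure n 0).prod (radialMeasure ((n : ℝ) + 0))),
      f (polarMap p) = g p.1 := by
    filter_upwards [ae_prod_radial_mem _ _] with p hp
    simp only [hf, polarMap, dirMap_smul _ hp.1]
  have h1int : Integrable (fun _ : ℝ => (1 : ℝ)) (radialMeasure ((n : ℝ) + 0)) := by
    have := integrable_rpow_radialMeasure (b := (n : ℝ) + 0) (t := 0)
      (by have : (0 : ℝ) ≤ n := n.cast_nonneg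
          linarith)
    simpa using this
  have hfi : Integrable f (ballMeasure n 0) := by
    rw [integrable_ballMeasure_polar hfm]
    have h2 : Integrable (fun p : Sph n × ℝ => g p.1 * (1 : ℝ))
        ((sphereMeasure n 0).prod (radialMeasure ((n : ℝ) + 0))) := by
      rw [sphereMeasure_zero]
      exact hg.mul_prod h1int
    refine h2.congr ?_
    filter_upwards [hpol] with p hp
    rw [Function.comp_apply, hp, mul_one]
  have hU : IntegrableOn f (Metric.ball 0 1) := by
    rw [IntegrableOn, ← ballMeasure_zero]; exact hfi
  have hae := IsOpen.ae_eq_zero_of_integral_contDiff_smul_eq_zero (μ := volume)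
    (Metric.isOpen_ball (x := (0 : Amb n)) (ε := 1)) hU.locallyIntegrableOn (fun φ hφ hcs hts => by
      have h1 : ∫ X, φ X • f X = ∫ X in Metric.ball 0 1, φ X • f X := by
        symm
        apply setIntegral_eq_integral_of_forall_compl_eq_zero
        intro X hX
        rw [image_eq_zero_of_notMem_tsupport (fun h => hX (hts h)), zero_smul]
      rw [h1, ← ballMeasure_zero, integral_ballMeasure_polar
        (f := fun X => φ X • f X) (hφ.continuous.aestronglyMeasurable.smul hfm), sphereMeasure_zero]
      have h2 : ∫ p, φ (polarMap p) • f (polarMap p)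
          ∂((surfaceMeasure n).prod (radialMeasure ((n : ℝ) + 0))) =
          ∫ p, g p.1 * φ (p.2 • (p.1 : Amb n))
          ∂((surfaceMeasure n).prod (radialMeasure ((n : ℝ) + 0))) := by
        rw [sphereMeasure_zero] at hpol
        apply integral_congr_ae
        filter_upwards [hpol] with p hp
        rw [hp, smul_eq_mul, mul_comm]; rfl
      rw [h2, integral_prod_symm]
      · refine (integral_congr_ae (ae_of_all _ fun r => ?_)).trans (integral_zero _ _)
        -- At fixed radius the integral over θ is the hypothesis for the dilated test function.
        exact h (fun X => φ (r • X)) (hφ.comp (contDiff_const_smul r))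
      · have h3 : Integrable (fun p : Sph n × ℝ => g p.1 * (1 : ℝ))
          ((surfaceMeasure n).prod (radialMeasure ((n : ℝ) + 0))) := hg.mul_prod h1int
        obtain ⟨C, hC⟩ := hcs.exists_bound_of_continuous hφ.continuous
        refine (h3.norm.const_mul C).mono' ?_ (ae_of_all _ fun p => ?_)
        · refine AEStronglyMeasurable.mul hg.aestronglyMeasurable.comp_fst ?_
          exact (hφ.continuous.comp (by fun_prop :
            Continuous fun p : Sph n × ℝ => p.2 • (p.1 : Amb n))).aestronglyMeasurable
        · rw [norm_mul, mul_one, mul_comm]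
          exact mul_le_mul_of_nonneg_right (hC _) (norm_nonneg _))
  have hae2 : ∀ᵐ X ∂(ballMeasure n 0), f X = 0 := by
    rw [ballMeasure_zero]
    exact (ae_restrict_iff' measurableSet_ball).2 hae
  rw [← (measurePreserving_polarMap n 0).map_eq] at hae2
  have hae3 := ae_of_ae_map measurable_polarMap.aemeasurable hae2
  have hae4 : ∀ᵐ p ∂((surfaceMeasure n).prod (radialMeasure ((n : ℝ) + 0))), g p.1 = 0 := by
    rw [sphereMeasure_zero] at hae3 hpol
    filter_upwards [hae3, hpol] with p h1 h2
    rw [← h2, h1]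
  filter_upwards [Measure.ae_ae_of_ae_prod hae4] with θ hθ
  by_contra hc
  have : ∀ᵐ r ∂(radialMeasure ((n : ℝ) + 0)), False := by
    filter_upwards [hθ] with r hr using hc hr
  simp only [ae_iff, not_false_eq_true, Set.ofPred_true] at this
  exact radialMeasure_univ_ne_zero _ this

/-- The weak gradient on the sphere is tangential. -/
theorem IsWeakSphereGrad.tangential {n : ℕ} {a : ℝ} (ha : a < 1) {c : Sph n → ℝ}
    {G : Sph n → Amb n} (hc : MemLp c 2 (sphereMeasure n a)) (h : IsWeakSphereGrad a c G) :
    ∀ᵐ θ ∂(surfaceMeasure n), inner ℝ (G θ) (θ : Amb n) = 0 := by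
  have hcoe : Continuous fun θ : Sph n => (θ : Amb n) := continuous_subtype_val
  have hGi := MemLp.integrable_surface ha h.1
  have hci := MemLp.integrable_surface ha hc
  have hbdd : ∀ {ψ : Sph n → ℝ} {g : Sph n → ℝ}, Integrable g (surfaceMeasure n) →
      Continuous ψ → Integrable (fun θ => g θ * ψ θ) (surfaceMeasure n) := by
    intro ψ g hg hψ
    obtain ⟨M, _, hM⟩ := exists_bound_of_continuous hψ
    exact hg.mul_bdd hψ.aestronglyMeasurable (ae_of_all _ hM)
  have hsum : ∀ θ : Sph n, inner ℝ (G θ) (θ : Amb n) =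
      ∑ i, inner ℝ (G θ) (EuclideanSpace.single i (1 : ℝ)) * (θ : Amb n) i := by
    intro θ
    rw [PiLp.inner_apply]
    refine Finset.sum_congr rfl fun i _ => ?_
    rw [EuclideanSpace.inner_single_right]
    simp [mul_comm]
  apply ae_eq_zero_of_integral_mul_contDiff
  · simp only [hsum]
    refine integrable_finsetSum _ fun i _ => ?_
    exact hbdd (hGi.inner_const _) (by fun_prop)
  · intro φ hφ
    -- The components of the normal field φ(X) X serve as test functions: paired with the coordinate
    -- directions and summed, they produce φ times the normal component of `G`.
    have hφi : ∀ i : Fin (n + 1), ContDiff ℝ ∞ fun X : Amb n => φ X * X i := by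
      intro i; fun_prop
    have hφc := hφ.continuous
    calc ∫ θ : Sph n, inner ℝ (G θ) (θ : Amb n) * φ θ ∂(surfaceMeasure n)
        = ∑ i, ∫ θ : Sph n, inner ℝ (G θ) (EuclideanSpace.single i (1 : ℝ)) *
            (φ θ * (θ : Amb n) i) ∂(surfaceMeasure n) := by
          rw [← integral_finsetSum _ fun i _ => hbdd (hGi.inner_const _) (by fun_prop)]
          congr 1; ext θ
          rw [hsum, Finset.sum_mul]
          exact Finset.sum_congr rfl fun i _ => by ring
      _ = ∑ i, -∫ θ : Sph n, c θ * testDiv (fun X : Amb n => φ X * X i)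
            (EuclideanSpace.single i (1 : ℝ)) θ ∂(surfaceMeasure n) := by
          refine Finset.sum_congr rfl fun i _ => ?_
          have := h.2 _ (hφi i) (EuclideanSpace.single i (1 : ℝ))
          simp only [testDiv]
          rw [this, neg_neg]
      _ = -∫ θ : Sph n, c θ * ∑ i, testDiv (fun X : Amb n => φ X * X i)
            (EuclideanSpace.single i (1 : ℝ)) θ ∂(surfaceMeasure n) := by
          rw [Finset.sum_neg_distrib, ← integral_finsetSum _ fun i _ =>
            hbdd hci (continuous_testDiv (hφi i) _)]
          congr 2; ext θ
          rw [Finset.mul_sum]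
      _ = 0 := by
          -- The tangential divergence of the normal field φ(θ)θ is nφ, and the curvature term
          -- subtracts exactly nφ.
          have hz : ∀ θ : Sph n, ∑ i, testDiv (fun X : Amb n => φ X * X i)
            (EuclideanSpace.single i (1 : ℝ)) θ = 0 := by
            intro θ
            have hd : ∀ i : Fin (n + 1), ∀ v : Amb n, fderiv ℝ (fun X : Amb n => φ X * X i) θ v =
                φ θ * v i + (θ : Amb n) i * fderiv ℝ φ θ v := by
              intro i v
              have h1 : HasFDerivAt (fun X : Amb n => X i)
                (EuclideanSpace.proj i : Amb n →L[ℝ] ℝ) (θ : Amb n) :=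
                (EuclideanSpace.proj i : Amb n →L[ℝ] ℝ).hasFDerivAt
              have h2 := (hφ.differentiable (by simp) (θ : Amb n)).hasFDerivAt.mul h1
              have h3 : fderiv ℝ (fun X : Amb n => φ X * X i) θ = _ := h2.fderiv
              rw [h3]
              simp
            have hsq : ∑ i, (θ : Amb n) i * (θ : Amb n) i = 1 := by
              have := EuclideanSpace.real_norm_sq_eq (θ : Amb n)
              rw [norm_sph, one_pow] at this
              exact (Finset.sum_congr rfl fun i _ => by ring).trans this.symm
            have hdd : ∑ i, (θ : Amb n) i * fderiv ℝ φ θ (EuclideanSpace.single i (1 : ℝ)) =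
                fderiv ℝ φ θ (θ : Amb n) := by
              have hθ : (θ : Amb n) = ∑ i, (θ : Amb n) i • EuclideanSpace.single i (1 : ℝ) := by
                ext j
                simp [Finset.sum_apply, Pi.single_apply]
              have h2 := congrArg (fderiv ℝ φ (θ : Amb n)) hθ
              rw [map_sum] at h2
              simpa only [map_smul, smul_eq_mul] using h2.symm
            simp only [testDiv, hd, EuclideanSpace.inner_single_right]
            simp only [PiLp.single_apply, if_true, conj_trivial, one_mul, mul_one]
            have : ∀ i : Fin (n + 1), φ θ + (θ : Amb n) i * fderiv ℝ φ θ (EuclideanSpace.single i 1) -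
              (θ : Amb n) i * (φ θ * (θ : Amb n) i + (θ : Amb n) i * fderiv ℝ φ θ (θ : Amb n)) -
              n * (φ θ * (θ : Amb n) i) * (θ : Amb n) i = φ θ +
              (θ : Amb n) i * fderiv ℝ φ θ (EuclideanSpace.single i 1) -
              ((θ : Amb n) i * (θ : Amb n) i) * (φ θ + fderiv ℝ φ θ (θ : Amb n) + n * φ θ) := by
              intro i; ring
            simp only [this]
            rw [Finset.sum_sub_distrib, Finset.sum_add_distrib, ← Finset.sum_mul, hsq, hdd]
            simp
            ring
          simp [hz]

/-! ### Reflections -/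

/-- The action of a linear isometry on the unit sphere. -/
noncomputable def sphMap {n : ℕ} (R : Amb n ≃ₗᵢ[ℝ] Amb n) (θ : Sph n) : Sph n :=
  ⟨R θ, by rw [mem_sphere_zero_iff_norm, R.norm_map, norm_sph]⟩

theorem continuous_sphMap {n : ℕ} (R : Amb n ≃ₗᵢ[ℝ] Amb n) : Continuous (sphMap R) :=
  (R.continuous.comp continuous_subtype_val).subtype_mk _

-- Surface measure is defined through the volume of cones over subsets of the sphere, and a linear
-- isometry maps cones to cones and preserves volume.
open scoped Pointwise in
theorem measurePreserving_sphMap {n : ℕ} (R : Amb n ≃ₗᵢ[ℝ] Amb n) :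
    MeasurePreserving (sphMap R) (surfaceMeasure n) (surfaceMeasure n) := by
  have hm := (continuous_sphMap R).measurable
  refine ⟨hm, ?_⟩
  ext s hs
  rw [Measure.map_apply hm hs, surfaceMeasure, Measure.toSphere_apply' _ hs,
    Measure.toSphere_apply' _ (hm hs)]
  congr 1
  have hset : Set.Ioo (0 : ℝ) 1 • (Subtype.val '' (sphMap R ⁻¹' s)) =
      R ⁻¹' (Set.Ioo (0 : ℝ) 1 • (Subtype.val '' s)) := by
    ext X
    simp only [Set.mem_smul, Set.mem_image, Set.mem_preimage]
    constructor
    · rintro ⟨r, hr, _, ⟨θ, hθ, rfl⟩, rfl⟩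
      exact ⟨r, hr, _, ⟨_, hθ, rfl⟩, by simp [sphMap]⟩
    · rintro ⟨r, hr, _, ⟨θ, hθ, rfl⟩, h⟩
      refine ⟨r, hr, R.symm θ, ⟨sphMap R.symm θ, ?_, rfl⟩, ?_⟩
      · have : sphMap R (sphMap R.symm θ) = θ := by
          apply Subtype.ext; simp [sphMap]
        rwa [this]
      · rw [← map_smul, h, R.symm_apply_apply]
  rw [hset]
  exact R.measurePreserving.measure_preimage_equiv (f := R.toMeasurableEquiv) _

theorem measurePreserving_sphMap_weighted {n : ℕ} (a : ℝ) (R : Amb n ≃ₗᵢ[ℝ] Amb n)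
    (hR : ∀ X, |yCoord (R X)| = |yCoord X|) :
    MeasurePreserving (sphMap R) (sphereMeasure n a) (sphereMeasure n a) := by
  have hm := (continuous_sphMap R).measurable
  refine ⟨hm, ?_⟩
  ext s hs
  rw [Measure.map_apply hm hs, sphereMeasure, withDensity_apply _ hs, withDensity_apply _ (hm hs),
    ← (measurePreserving_sphMap R).setLIntegral_comp_preimage hs (measurable_sphere_weight n a)]
  simp only [sphMap, hR]

/-! ### Weighted integration by parts on the sphere -/

/-- The unit vector in the direction of the coordinate `y`. -/
noncomputable def yDir (n : ℕ) : Amb n := EuclideanSpace.single (Fin.last n) 1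

theorem yCoord_yDir (n : ℕ) : yCoord (yDir n) = 1 := by simp [yCoord, yDir]

theorem inner_yDir {n : ℕ} (X : Amb n) : inner ℝ X (yDir n) = yCoord X := by
  simp [yCoord, yDir, EuclideanSpace.inner_single_right]

theorem norm_yDir (n : ℕ) : ‖yDir n‖ = 1 := by simp [yDir]

theorem hasFDerivAt_yCoord {n : ℕ} (X : Amb n) :
    HasFDerivAt (yCoord : Amb n → ℝ) (EuclideanSpace.proj (Fin.last n) : Amb n →L[ℝ] ℝ) X :=
  (EuclideanSpace.proj (Fin.last n) : Amb n →L[ℝ] ℝ).hasFDerivAt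

theorem contDiff_yCoord {n : ℕ} : ContDiff ℝ ∞ (yCoord : Amb n → ℝ) :=
  (EuclideanSpace.proj (Fin.last n) : Amb n →L[ℝ] ℝ).contDiff

/-! ### Cutting the weight off near the thin space -/

/-- A smooth cutoff vanishing near the origin and equal to one outside `(-1, 1)`. -/
noncomputable def nearCutoff (t : ℝ) : ℝ :=
  1 - (⟨1 / 2, 1, by norm_num, by norm_num⟩ : ContDiffBump (0 : ℝ)) t

theorem contDiff_nearCutoff : ContDiff ℝ ∞ nearCutoff :=
  contDiff_const.sub (ContDiffBump.contDiff _)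

theorem nearCutoff_eq_zero {t : ℝ} (h : |t| ≤ 1 / 2) : nearCutoff t = 0 := by
  unfold nearCutoff
  rw [ContDiffBump.one_of_mem_closedBall, sub_self]
  simpa using h

theorem nearCutoff_eq_one {t : ℝ} (h : 1 ≤ |t|) : nearCutoff t = 1 := by
  unfold nearCutoff
  rw [ContDiffBump.zero_of_le_dist, sub_zero]
  simpa using h

theorem abs_nearCutoff_le (t : ℝ) : |nearCutoff t| ≤ 1 := by
  unfold nearCutoff
  rw [abs_le]
  constructor
  · linarith [ContDiffBump.le_one (f := (⟨1 / 2, 1, by norm_num, by norm_num⟩ :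
      ContDiffBump (0 : ℝ))) (x := t)]
  · linarith [ContDiffBump.nonneg (f := (⟨1 / 2, 1, by norm_num, by norm_num⟩ :
      ContDiffBump (0 : ℝ))) (x := t)]

theorem deriv_nearCutoff_eq_zero {t : ℝ} (h : 1 < |t|) : deriv nearCutoff t = 0 := by
  have : nearCutoff =ᶠ[𝓝 t] fun _ => 1 := by
    filter_upwards [(isOpen_lt continuous_const continuous_abs).mem_nhds h] with u hu
    exact nearCutoff_eq_one (le_of_lt hu)
  rw [this.deriv_eq, deriv_const]

theorem exists_deriv_nearCutoff_bound : ∃ K, 0 ≤ K ∧ ∀ t, |deriv nearCutoff t| ≤ K := by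
  have hc : Continuous (deriv nearCutoff) := contDiff_nearCutoff.continuous_deriv (by simp)
  obtain ⟨K, hK⟩ := (isCompact_Icc (a := (-1 : ℝ)) (b := 1)).exists_bound_of_continuousOn
    hc.continuousOn
  refine ⟨max K 0, le_max_right _ _, fun t => ?_⟩
  by_cases ht : |t| ≤ 1
  · exact (hK t (abs_le.1 ht)).trans (le_max_left _ _)
  · rw [deriv_nearCutoff_eq_zero (not_le.1 ht), abs_zero]; exact le_max_right _ _

/-- The weight `|y|^a`, cut off near `y = 0`. -/
noncomputable def cutWeight (a δ y : ℝ) : ℝ := nearCutoff (y / δ) * |y| ^ a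

theorem hasDerivAt_abs_rpow_of_ne (a : ℝ) {y : ℝ} (hy : y ≠ 0) :
    HasDerivAt (fun y : ℝ => |y| ^ a) (a * |y| ^ a / y) y := by
  have h := (hasDerivAt_abs hy).rpow_const (p := a) (Or.inl (abs_pos.2 hy).ne')
  convert h using 1
  rw [Real.rpow_sub_one (abs_pos.2 hy).ne']
  rcases lt_or_gt_of_ne hy with h | h
  · simp [h, abs_of_neg h]; field_simp
  · simp [h, abs_of_pos h]; field_simp

theorem contDiffAt_abs_rpow (a : ℝ) {y : ℝ} (hy : y ≠ 0) :
    ContDiffAt ℝ ∞ (fun y : ℝ => |y| ^ a) y :=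
  (contDiffAt_abs hy).rpow_const_of_ne (abs_pos.2 hy).ne'

theorem cutWeight_eventually_zero (a : ℝ) {δ : ℝ} (hδ : 0 < δ) :
    ∀ᶠ y in 𝓝 (0 : ℝ), cutWeight a δ y = 0 := by
  filter_upwards [Metric.ball_mem_nhds (0 : ℝ) (half_pos hδ)] with y hy
  rw [cutWeight, nearCutoff_eq_zero, zero_mul]
  rw [mem_ball_zero_iff, Real.norm_eq_abs] at hy
  rw [abs_div, abs_of_pos hδ, div_le_iff₀ hδ]; linarith

theorem hasDerivAt_cutWeight (a δ : ℝ) {y : ℝ} (hy : y ≠ 0) :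
    HasDerivAt (cutWeight a δ)
      (deriv nearCutoff (y / δ) / δ * |y| ^ a + a * cutWeight a δ y / y) y := by
  have h1 : HasDerivAt (fun y => nearCutoff (y / δ)) (deriv nearCutoff (y / δ) * (1 / δ)) y :=
    ((contDiff_nearCutoff.differentiable (by simp) _).hasDerivAt).comp y
      ((hasDerivAt_id y).div_const δ)
  refine (h1.mul (hasDerivAt_abs_rpow_of_ne a hy)).congr_deriv ?_
  rw [cutWeight]; ring

/-- Near y = 0 the product vanishes identically, so smoothness of `p` off the thin space is enough.
This turns the derivatives of the singular profiles into legitimate test functions. -/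
theorem contDiff_cutWeight_mul {n : ℕ} (a : ℝ) {δ : ℝ} (hδ : 0 < δ) {p : Amb n → ℝ}
    (hp : ∀ X, yCoord X ≠ 0 → ContDiffAt ℝ ∞ p X) :
    ContDiff ℝ ∞ fun X : Amb n => cutWeight a δ (yCoord X) * p X := by
  rw [contDiff_iff_contDiffAt]
  intro X
  by_cases hX : yCoord X = 0
  · have h := (continuous_yCoord (n := n)).tendsto X |>.eventually
      (p := fun y => cutWeight a δ y = 0) (by rw [hX]; exact cutWeight_eventually_zero a hδ)
    refine (contDiffAt_const (c := (0 : ℝ))).congr_of_eventuallyEq ?_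
    filter_upwards [h] with Y hY
    rw [hY, zero_mul]
  · have h1 : ContDiffAt ℝ ∞ (cutWeight a δ) (yCoord X) :=
      ((contDiff_nearCutoff.comp (contDiff_id.div_const δ)).contDiffAt).mul
        (contDiffAt_abs_rpow a hX)
    exact (h1.comp X contDiff_yCoord.contDiffAt).mul (hp X hX)

theorem fderiv_cutWeight_mul {n : ℕ} (a δ : ℝ) {p : Amb n → ℝ} {X : Amb n}
    (hX : yCoord X ≠ 0) (hp : DifferentiableAt ℝ p X) (v : Amb n) :
    fderiv ℝ (fun X : Amb n => cutWeight a δ (yCoord X) * p X) X v =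
      cutWeight a δ (yCoord X) * fderiv ℝ p X v + p X * ((deriv nearCutoff (yCoord X / δ) / δ *
        |yCoord X| ^ a + a * cutWeight a δ (yCoord X) / yCoord X) * yCoord v) := by
  have h1 := (hasDerivAt_cutWeight a δ hX).comp_hasFDerivAt X (hasFDerivAt_yCoord X)
  have h2 : fderiv ℝ (fun X : Amb n => cutWeight a δ (yCoord X) * p X) X = _ :=
    (h1.mul hp.hasFDerivAt).fderiv
  rw [h2]
  simp [yCoord]

/-- A function `p`, homogeneous of degree `d` and smooth off `{y = 0}`, depending only on `y` and
on the linear coordinate `⟨X, e⟩`, with its derivatives `pt` along that coordinate and `py`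
along `y`. The function `q` is the weighted spherical Laplacian `-|y|^(-a) div (|y|^a ∇ p)`. -/
structure IsRidge {n : ℕ} (a : ℝ) (e : Amb n) (d : ℝ) (p pt py q : Amb n → ℝ) : Prop where
  yCoord_dir : yCoord e = 0
  smooth_pt : ∀ X, yCoord X ≠ 0 → ContDiffAt ℝ ∞ pt X
  smooth_py : ∀ X, yCoord X ≠ 0 → ContDiffAt ℝ ∞ py X
  euler : ∀ X, yCoord X ≠ 0 → inner ℝ X e * pt X + yCoord X * py X = d * p X
  euler_pt : ∀ X, yCoord X ≠ 0 → fderiv ℝ pt X X = (d - 1) * pt X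
  euler_py : ∀ X, yCoord X ≠ 0 → fderiv ℝ py X X = (d - 1) * py X
  laplace : ∀ X, yCoord X ≠ 0 → q X = d * (d + n + a - 1) * p X -
    (fderiv ℝ pt X e + fderiv ℝ py X (yDir n) + a * py X / yCoord X)

/-- Testing with the two components of the cut-off field |y|^a ∇p produces the spherical Laplacian
of `p`, plus an error from the derivative of the cutoff. That error multiplies py - y·d·p, the
y-component of the tangential gradient of `p`. -/
theorem IsRidge.testDiv_add {n : ℕ} {a : ℝ} {e : Amb n} {d : ℝ} {p pt py q : Amb n → ℝ}
    (h : IsRidge a e d p pt py q) (δ : ℝ) {θ : Sph n} (hθ : yCoord (θ : Amb n) ≠ 0) :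
    testDiv (fun X => cutWeight a δ (yCoord X) * pt X) e θ +
      testDiv (fun X => cutWeight a δ (yCoord X) * py X) (yDir n) θ =
      -(cutWeight a δ (yCoord (θ : Amb n)) * q θ) +
        deriv nearCutoff (yCoord (θ : Amb n) / δ) / δ * |yCoord (θ : Amb n)| ^ a *
          (py θ - yCoord (θ : Amb n) * (d * p θ)) := by
  have h1 := (h.smooth_pt θ hθ).differentiableAt (by simp)
  have h2 := (h.smooth_py θ hθ).differentiableAt (by simp)
  unfold testDiv
  rw [fderiv_cutWeight_mul a δ hθ h1, fderiv_cutWeight_mul a δ hθ h1,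
    fderiv_cutWeight_mul a δ hθ h2, fderiv_cutWeight_mul a δ hθ h2, h.yCoord_dir, yCoord_yDir,
    h.euler_pt θ hθ, h.euler_py θ hθ, inner_yDir, h.laplace θ hθ]
  -- The radial derivatives of the test fields and the curvature terms all multiply ⟨θ,e⟩ pt + y py,
  -- which Euler's relation replaces by d p.
  linear_combination (norm := (field_simp; ring)) (-(cutWeight a δ (yCoord (θ : Amb n)) *
    (d + n + a - 1) + deriv nearCutoff (yCoord (θ : Amb n) / δ) / δ * |yCoord (θ : Amb n)| ^ a *
      yCoord (θ : Amb n))) * h.euler θ hθ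

/-- Integration by parts of a ridge function against a function in the weighted Sobolev space. -/
theorem IsRidge.integral_inner {n : ℕ} {a : ℝ} {e : Amb n} {d : ℝ} {p pt py q : Amb n → ℝ}
    (h : IsRidge a e d p pt py q) {g : Sph n → ℝ} {G : Sph n → Amb n}
    (ha : a < 1) (hg : MemLp g 2 (sphereMeasure n a)) (hG : IsWeakSphereGrad a g G)
    (hi1 : Integrable (fun θ => inner ℝ (G θ) (pt θ • e + py θ • yDir n)) (sphereMeasure n a))
    (hi2 : Integrable (fun θ => g θ * q θ) (sphereMeasure n a))
    (hi3 : Integrable (fun θ => g θ * p θ) (sphereMeasure n a))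
    {w : Sph n → ℝ} (hw : Integrable w (surfaceMeasure n))
    (hgw : ∀ᵐ θ : Sph n ∂(surfaceMeasure n),
      |g θ| * |yCoord (θ : Amb n)| ^ a * |py θ| ≤ |yCoord (θ : Amb n)| * w θ) :
    ∫ θ, inner ℝ (G θ) (pt θ • e + py θ • yDir n) ∂(sphereMeasure n a) =
      ∫ θ, g θ * q θ ∂(sphereMeasure n a) := by
  rw [integral_sphereMeasure, integral_sphereMeasure]
  rw [integrable_sphereMeasure_iff] at hi1 hi2 hi3
  obtain ⟨K, hK0, hK⟩ := exists_deriv_nearCutoff_bound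
  have hgi := MemLp.integrable_surface ha hg
  have hGi := MemLp.integrable_surface ha hG.1
  have hcoe : Continuous fun θ : Sph n => (θ : Amb n) := continuous_subtype_val
  let δ : ℕ → ℝ := fun k => 1 / ((k : ℝ) + 1)
  have hδ : ∀ k, 0 < δ k := fun k => by positivity
  have hδ0 : Tendsto δ atTop (𝓝 0) := tendsto_one_div_add_atTop_nhds_zero_nat
  let φ1 : ℕ → Amb n → ℝ := fun k X => cutWeight a (δ k) (yCoord X) * pt X
  let φ2 : ℕ → Amb n → ℝ := fun k X => cutWeight a (δ k) (yCoord X) * py X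
  have hφ1 : ∀ k, ContDiff ℝ ∞ (φ1 k) := fun k => contDiff_cutWeight_mul a (hδ k) h.smooth_pt
  have hφ2 : ∀ k, ContDiff ℝ ∞ (φ2 k) := fun k => contDiff_cutWeight_mul a (hδ k) h.smooth_py
  have hbdd : ∀ {ψ : Sph n → ℝ} {g : Sph n → ℝ}, Integrable g (surfaceMeasure n) →
      Continuous ψ → Integrable (fun θ => g θ * ψ θ) (surfaceMeasure n) := by
    intro ψ g hg hψ
    obtain ⟨M, _, hM⟩ := exists_bound_of_continuous hψ
    exact hg.mul_bdd hψ.aestronglyMeasurable (ae_of_all _ hM)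
  have hid : ∀ k, ∫ θ : Sph n, g θ * (testDiv (φ1 k) e θ + testDiv (φ2 k) (yDir n) θ)
      ∂(surfaceMeasure n) =
      -∫ θ : Sph n, (inner ℝ (G θ) e * φ1 k θ + inner ℝ (G θ) (yDir n) * φ2 k θ)
        ∂(surfaceMeasure n) := by
    intro k
    have e1 := hG.2 _ (hφ1 k) e
    have e2 := hG.2 _ (hφ2 k) (yDir n)
    have c1 := (hφ1 k).continuous
    have c2 := (hφ2 k).continuous
    have i1 : Integrable (fun θ : Sph n => inner ℝ (G θ) e * φ1 k θ) (surfaceMeasure n) :=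
      hbdd (hGi.inner_const e) (c1.comp hcoe)
    have i2 : Integrable (fun θ : Sph n => inner ℝ (G θ) (yDir n) * φ2 k θ) (surfaceMeasure n) :=
      hbdd (hGi.inner_const (yDir n)) (c2.comp hcoe)
    rw [integral_add i1 i2, neg_add]
    simp only [mul_add]
    rw [integral_add (hbdd hgi (continuous_testDiv (hφ1 k) e))
      (hbdd hgi (continuous_testDiv (hφ2 k) (yDir n)))]
    rw [← e1, ← e2]
    rfl
  have hy0 := ae_sphere_yCoord_ne n
  have hev : ∀ y : ℝ, y ≠ 0 → ∀ᶠ k in atTop, δ k < |y| := fun y hy =>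
    hδ0.eventually_lt_const (abs_pos.2 hy)
  have t1 : Tendsto (fun k => ∫ θ : Sph n, g θ * (testDiv (φ1 k) e θ + testDiv (φ2 k) (yDir n) θ)
      ∂(surfaceMeasure n)) atTop (𝓝 (∫ θ : Sph n, -(|yCoord (θ : Amb n)| ^ a • (g θ * q θ))
      ∂(surfaceMeasure n))) := by
    refine tendsto_integral_of_dominated_convergence (fun θ => ‖|yCoord (θ : Amb n)| ^ a •
      (g θ * q θ)‖ + K * (w θ + |d| * ‖|yCoord (θ : Amb n)| ^ a • (g θ * p θ)‖)) (fun k => ?_)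
      (hi2.norm.add ((hw.add (hi3.norm.const_mul _)).const_mul _)) (fun k => ?_) ?_
    · exact hgi.aestronglyMeasurable.mul (((continuous_testDiv (hφ1 k) e).add
        (continuous_testDiv (hφ2 k) (yDir n))).aestronglyMeasurable)
    · filter_upwards [hy0, hgw] with θ hθ hw
      rw [h.testDiv_add (δ k) hθ]
      set y := yCoord (θ : Amb n) with hy
      have hypos : 0 < |y| := abs_pos.2 hθ
      have hw0 : 0 ≤ w θ := by
        by_contra hc
        have : |y| * w θ < 0 := mul_neg_of_pos_of_neg hypos (not_le.1 hc)
        have h2 : 0 ≤ |g θ| * |y| ^ a * |py θ| := by positivity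
        linarith
      rw [mul_add]
      refine (norm_add_le _ _).trans (add_le_add ?_ ?_)
      · rw [cutWeight]
        simp only [norm_mul, norm_neg, smul_eq_mul, Real.norm_eq_abs]
        have := abs_nearCutoff_le (y / δ k)
        calc |g θ| * (|nearCutoff (y / δ k)| * |(|y| ^ a)| * |q θ|)
            ≤ |g θ| * (1 * |(|y| ^ a)| * |q θ|) := by gcongr
          _ = _ := by ring
      · by_cases hbig : δ k < |y|
        · rw [deriv_nearCutoff_eq_zero (t := y / δ k)]
          · simp only [zero_div, zero_mul, mul_zero, norm_zero]
            positivity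
          · rw [abs_div, abs_of_pos (hδ k), one_lt_div (hδ k)]; exact hbig
        -- Where the derivative of the cutoff may be nonzero, |y| ≤ δ. The factor |y|, provided by
        -- `hgw` for the term in `py` and explicit in the other term, absorbs the 1/δ.
        · have h1 : |y| / δ k ≤ 1 := (div_le_one (hδ k)).2 (not_lt.1 hbig)
          simp only [norm_mul, norm_div, smul_eq_mul, Real.norm_eq_abs]
          have habs : |(|y| ^ a)| = |y| ^ a := abs_of_nonneg (by positivity)
          rw [habs, abs_of_pos (hδ k)]
          have h3 : |py θ - y * (d * p θ)| ≤ |py θ| + |y| * (|d| * |p θ|) := by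
            refine (abs_sub _ _).trans ?_
            rw [abs_mul, abs_mul]
          have hsm : |y| ≤ 1 := (abs_yCoord_le _).trans (norm_sph θ).le
          calc |g θ| * (|deriv nearCutoff (y / δ k)| / δ k * |y| ^ a * |py θ - y * (d * p θ)|)
              ≤ |g θ| * (K / δ k * |y| ^ a * (|py θ| + |y| * (|d| * |p θ|))) := by
                have := hK (y / δ k)
                have := (hδ k).le
                gcongr
            _ = K / δ k * (|g θ| * |y| ^ a * |py θ| + |y| * (|d| * (|y| ^ a * (|g θ| * |p θ|)))) := by
                ring
            _ ≤ K / δ k * (|y| * w θ + |y| * (|d| * (|y| ^ a * (|g θ| * |p θ|)))) := by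
                have := (hδ k).le
                gcongr
            _ = K * (|y| / δ k) * (w θ + |d| * (|y| ^ a * (|g θ| * |p θ|))) := by ring
            _ ≤ K * 1 * (w θ + |d| * (|y| ^ a * (|g θ| * |p θ|))) := by gcongr
            _ = _ := by ring
    · filter_upwards [hy0] with θ hθ
      -- At a point with y ≠ 0 the cutoff is equal to 1 as soon as δ < |y|, so the sequence is
      -- eventually constant.
      refine tendsto_const_nhds.congr' ?_
      filter_upwards [hev _ hθ] with k hk
      rw [h.testDiv_add (δ k) hθ]
      have h1 : 1 < |yCoord (θ : Amb n) / δ k| := by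
        rw [abs_div, abs_of_pos (hδ k), one_lt_div (hδ k)]; exact hk
      rw [deriv_nearCutoff_eq_zero h1, cutWeight, nearCutoff_eq_one h1.le, smul_eq_mul]
      ring
  have t2 : Tendsto (fun k => ∫ θ : Sph n, (inner ℝ (G θ) e * φ1 k θ +
      inner ℝ (G θ) (yDir n) * φ2 k θ) ∂(surfaceMeasure n)) atTop
      (𝓝 (∫ θ : Sph n, |yCoord (θ : Amb n)| ^ a • inner ℝ (G θ) (pt θ • e + py θ • yDir n)
      ∂(surfaceMeasure n))) := by
    have hform : ∀ k, ∀ θ : Sph n, inner ℝ (G θ) e * φ1 k θ + inner ℝ (G θ) (yDir n) * φ2 k θ =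
        nearCutoff (yCoord (θ : Amb n) / δ k) *
          (|yCoord (θ : Amb n)| ^ a • inner ℝ (G θ) (pt θ • e + py θ • yDir n)) := by
      intro k θ
      simp only [φ1, φ2, cutWeight, inner_add_right, real_inner_smul_right, smul_eq_mul]
      ring
    refine tendsto_integral_of_dominated_convergence (fun θ => ‖|yCoord (θ : Amb n)| ^ a •
      inner ℝ (G θ) (pt θ • e + py θ • yDir n)‖) (fun k => ?_) hi1.norm (fun k => ?_) ?_
    · have c1 := (hφ1 k).continuous
      have c2 := (hφ2 k).continuous
      exact ((hbdd (hGi.inner_const e) (c1.comp hcoe)).add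
        (hbdd (hGi.inner_const (yDir n)) (c2.comp hcoe))).aestronglyMeasurable
    · refine ae_of_all _ fun θ => ?_
      rw [hform, norm_mul]
      exact mul_le_of_le_one_left (norm_nonneg _) (abs_nearCutoff_le _)
    · filter_upwards [hy0] with θ hθ
      refine tendsto_const_nhds.congr' ?_
      filter_upwards [hev _ hθ] with k hk
      have h1 : 1 < |yCoord (θ : Amb n) / δ k| := by
        rw [abs_div, abs_of_pos (hδ k), one_lt_div (hδ k)]; exact hk
      rw [hform, nearCutoff_eq_one h1.le, one_mul]
  have h3 := tendsto_nhds_unique t1 (by simpa only [hid] using t2.neg)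
  rw [integral_neg] at h3
  linarith

/-! ### Ridge polynomials -/

theorem proj_last_apply {n : ℕ} (v : Amb n) :
    (EuclideanSpace.proj (Fin.last n) : Amb n →L[ℝ] ℝ) v = yCoord v := rfl

theorem tendsto_add_one_div (b : ℝ) :
    Tendsto (fun k : ℕ => b + 1 / ((k : ℝ) + 1)) atTop (𝓝 b) := by
  have h : Tendsto (fun k : ℕ => 1 / ((k : ℝ) + 1)) atTop (𝓝 0) :=
    tendsto_one_div_add_atTop_nhds_zero_nat
  simpa using h.const_add b

theorem hasFDerivAt_innerRight {n : ℕ} (e X : Amb n) :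
    HasFDerivAt (fun X : Amb n => inner ℝ X e) (innerSL ℝ e) X := by
  have h := (innerSL ℝ e).hasFDerivAt (x := X)
  refine h.congr_of_eventuallyEq (Eventually.of_forall fun Y => ?_)
  simp [real_inner_comm]

theorem contDiff_innerRight {n : ℕ} (e : Amb n) : ContDiff ℝ ∞ fun X : Amb n => inner ℝ X e :=
  contDiff_id.inner ℝ contDiff_const

/-- The ridge monomial `⟨X, e⟩^j y^l`. -/
noncomputable def ridgeMon {n : ℕ} (e : Amb n) (j l : ℕ) (X : Amb n) : ℝ :=
  inner ℝ X e ^ j * yCoord X ^ l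

theorem contDiff_ridgeMon {n : ℕ} (e : Amb n) (j l : ℕ) : ContDiff ℝ ∞ (ridgeMon e j l) :=
  ((contDiff_innerRight e).pow j).mul (contDiff_yCoord.pow l)

theorem fderiv_ridgeMon {n : ℕ} (e : Amb n) (j l : ℕ) (X v : Amb n) :
    fderiv ℝ (ridgeMon e j l) X v = j * ridgeMon e (j - 1) l X * inner ℝ v e +
      l * ridgeMon e j (l - 1) X * yCoord v := by
  have h1 := (hasFDerivAt_innerRight e X).pow j
  have h2 := (hasFDerivAt_yCoord X).pow l
  have h3 : fderiv ℝ (ridgeMon e j l) X = _ := (h1.mul h2).fderiv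
  rw [h3]
  simp only [ridgeMon, add_apply, smul_apply,
    innerSL_apply_apply, smul_eq_mul, proj_last_apply, nsmul_eq_mul,
    real_inner_comm]
  ring

theorem fderiv_const_mul_ridgeMon {n : ℕ} (b : ℝ) (e : Amb n) (j l : ℕ) (X v : Amb n) :
    fderiv ℝ (fun X => b * ridgeMon e j l X) X v = b * (j * ridgeMon e (j - 1) l X * inner ℝ v e +
      l * ridgeMon e j (l - 1) X * yCoord v) := by
  rw [fderiv_const_mul ((contDiff_ridgeMon e j l).differentiable (by simp) X),
    smul_apply, smul_eq_mul, fderiv_ridgeMon]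

theorem inner_dir_yDir {n : ℕ} {e : Amb n} (he : yCoord e = 0) : inner ℝ (yDir n) e = 0 := by
  rw [real_inner_comm, inner_yDir, he]

/-- Only even powers of y occur, so the singular term a py / y is again a polynomial. The
second-order part lowers the degree by two, which makes the spherical Laplacian triangular on these
monomials. -/
theorem isRidge_ridgeMon {n : ℕ} (a : ℝ) {e : Amb n} (he : yCoord e = 0) (j k : ℕ) :
    IsRidge a e (j + 2 * k) (ridgeMon e j (2 * k)) (fun X => j * ridgeMon e (j - 1) (2 * k) X)
      (fun X => (2 * k : ℕ) * ridgeMon e j (2 * k - 1) X)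
      (fun X => ((j : ℝ) + 2 * k) * (j + 2 * k + n + a - 1) * ridgeMon e j (2 * k) X -
        (‖e‖ ^ 2 * j * (j - 1) * ridgeMon e (j - 2) (2 * k) X +
          2 * k * (2 * k - 1 + a) * ridgeMon e j (2 * k - 2) X)) where
  yCoord_dir := he
  smooth_pt X _ := (contDiff_const.mul (contDiff_ridgeMon _ _ _)).contDiffAt
  smooth_py X _ := (contDiff_const.mul (contDiff_ridgeMon _ _ _)).contDiffAt
  euler X _ := by
    -- The case splits deal with truncated subtraction in the exponents: whenever an exponent
    -- truncates, its coefficient is zero.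
    rcases j with _ | j <;> rcases k with _ | k
    · simp
    · simp only [ridgeMon, show 2 * (k + 1) - 1 = 2 * k + 1 by omega]; push_cast; ring
    · simp only [ridgeMon, Nat.add_sub_cancel]; push_cast; ring
    · simp only [ridgeMon, Nat.add_sub_cancel, show 2 * (k + 1) - 1 = 2 * k + 1 by omega]
      push_cast; ring
  euler_pt X _ := by
    rw [fderiv_const_mul_ridgeMon]
    rcases j with _ | _ | j <;> rcases k with _ | k
    · simp
    · simp
    · simp
    · simp only [ridgeMon, show 2 * (k + 1) - 1 = 2 * k + 1 by omega, zero_add, Nat.sub_self]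
      push_cast; ring
    · simp only [ridgeMon, show j + 1 + 1 - 1 = j + 1 by omega, show j + 1 - 1 = j by omega]
      push_cast; ring
    · simp only [ridgeMon, show 2 * (k + 1) - 1 = 2 * k + 1 by omega,
        show j + 1 + 1 - 1 = j + 1 by omega, show j + 1 - 1 = j by omega]
      push_cast; ring
  euler_py X _ := by
    rw [fderiv_const_mul_ridgeMon]
    rcases j with _ | j <;> rcases k with _ | k
    · simp
    · simp only [ridgeMon, show 2 * (k + 1) - 1 = 2 * k + 1 by omega,
        show 2 * k + 1 - 1 = 2 * k by omega]
      push_cast; ring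
    · simp
    · simp only [ridgeMon, Nat.add_sub_cancel, show 2 * (k + 1) - 1 = 2 * k + 1 by omega,
        show 2 * k + 1 - 1 = 2 * k by omega]
      push_cast; ring
  laplace X hX := by
    have hee : inner ℝ e e = ‖e‖ ^ 2 := real_inner_self_eq_norm_sq e
    rw [fderiv_const_mul_ridgeMon, fderiv_const_mul_ridgeMon, he, inner_dir_yDir he, yCoord_yDir,
      hee]
    have h1 : ((j - 1 : ℕ) : ℝ) * j = j * (j - 1) := by
      rcases j with _ | j
      · simp
      · push_cast [Nat.add_sub_cancel]; ring
    have h2 : (((2 * k - 1 : ℕ) : ℝ)) * (2 * k : ℕ) = (2 * k : ℕ) * (2 * k - 1) := by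
      rcases k with _ | k
      · simp
      · simp only [show 2 * (k + 1) - 1 = 2 * k + 1 by omega]; push_cast; ring
    have h3 : ((2 * k : ℕ) : ℝ) * ridgeMon e j (2 * k - 1) X / yCoord X =
        2 * k * ridgeMon e j (2 * k - 2) X := by
      rcases k with _ | k
      · simp
      · simp only [ridgeMon, show 2 * (k + 1) - 1 = 2 * k + 1 by omega,
          show 2 * (k + 1) - 2 = 2 * k by omega]
        push_cast; field_simp; ring
    rw [mul_div_assoc, h3, show j - 1 - 1 = j - 2 by omega, show 2 * k - 1 - 1 = 2 * k - 2 by omega]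
    push_cast at h2 ⊢
    linear_combination (‖e‖ ^ 2 * ridgeMon e (j - 2) (2 * k) X) * h1 +
      ridgeMon e j (2 * k - 2) X * h2

/-- The ambient gradient of a ridge function. -/
noncomputable def ridgeGrad {n : ℕ} (e : Amb n) (pt py : Amb n → ℝ) (X : Amb n) : Amb n :=
  pt X • e + py X • yDir n

theorem inner_ridgeGrad {n : ℕ} (e : Amb n) (pt py : Amb n → ℝ) (X v : Amb n) :
    inner ℝ (ridgeGrad e pt py X) v = pt X * inner ℝ v e + py X * yCoord v := by
  rw [ridgeGrad, inner_add_left, real_inner_smul_left, real_inner_smul_left, real_inner_comm,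
    real_inner_comm v (yDir n), inner_yDir]

theorem norm_ridgeGrad_le {n : ℕ} {e : Amb n} (he : ‖e‖ ≤ 1) (pt py : Amb n → ℝ) (X : Amb n) :
    ‖ridgeGrad e pt py X‖ ≤ |pt X| + |py X| := by
  refine (norm_add_le _ _).trans ?_
  rw [norm_smul, norm_smul, norm_yDir, mul_one, Real.norm_eq_abs, Real.norm_eq_abs]
  exact add_le_add (mul_le_of_le_one_right (abs_nonneg _) he) le_rfl

/-! ### The profile vanishing on the thin space -/

/-- The function `|y|^(2 s)`. -/
noncomputable def thinProfile {n : ℕ} (s : ℝ) (X : Amb n) : ℝ := |yCoord X| ^ (2 * s)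

theorem abs_rpow_two_mul (y s : ℝ) : |y| ^ (2 * s) = (y ^ 2) ^ s := by
  rw [Real.rpow_mul (abs_nonneg y)]
  norm_num

/-- Off the thin space |y|^a ∂_y |y|^(2s) is 2s times the sign of y, because a + 2s - 1 = 0. So
|y|^(2s) solves div(|y|^a ∇v) = 0 there, and the spherical Laplacian only returns the eigenvalue
term. -/
theorem isRidge_thinProfile {n : ℕ} {s a : ℝ} (ha : a = 1 - 2 * s) {e : Amb n}
    (he : yCoord e = 0) :
    IsRidge a e (2 * s) (thinProfile s) (fun _ => 0)
      (fun X => 2 * s * thinProfile s X / yCoord X)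
      (fun X => 2 * s * (2 * s + n + a - 1) * thinProfile s X) := by
  have hd : ∀ X v : Amb n, yCoord X ≠ 0 →
      fderiv ℝ (fun X => 2 * s * thinProfile s X / yCoord X) X v =
        2 * s * (2 * s - 1) * thinProfile s X / yCoord X ^ 2 * yCoord v := by
    intro X v hX
    have h1 : HasDerivAt (fun y : ℝ => 2 * s * |y| ^ (2 * s) / y) _ (yCoord X) :=
      ((hasDerivAt_abs_rpow_of_ne (2 * s) hX).const_mul (2 * s)).div (hasDerivAt_id _) hX
    have h2 : fderiv ℝ (fun X : Amb n => 2 * s * thinProfile s X / yCoord X) X = _ :=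
      (h1.comp_hasFDerivAt X (hasFDerivAt_yCoord X)).fderiv
    rw [h2]
    simp only [smul_apply, proj_last_apply, smul_eq_mul]
    unfold thinProfile
    field_simp
  refine ⟨he, fun X _ => contDiffAt_const, fun X hX => ?_, fun X hX => ?_, fun X hX => ?_,
    fun X hX => ?_, fun X hX => ?_⟩
  · exact (contDiffAt_const.mul ((contDiffAt_abs_rpow _ hX).comp X contDiff_yCoord.contDiffAt)).div
      contDiff_yCoord.contDiffAt hX
  · simp; field_simp
  · simp
  · rw [hd X X hX]; field_simp
  · rw [hd X _ hX, yCoord_yDir, ha]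
    simp; field_simp; ring

/-- Smooth approximations of `|y|^(2 s)`. -/
noncomputable def thinProfileReg {n : ℕ} (s ε : ℝ) (X : Amb n) : ℝ := (yCoord X ^ 2 + ε) ^ s

theorem fderiv_thinProfileReg {n : ℕ} (s : ℝ) {ε : ℝ} (hε : 0 < ε) (X v : Amb n) :
    fderiv ℝ (thinProfileReg s ε) X v =
      2 * s * yCoord X * (yCoord X ^ 2 + ε) ^ (s - 1) * yCoord v := by
  have hpos : 0 < yCoord X ^ 2 + ε := by positivity
  have h1 := (((hasFDerivAt_yCoord X).pow 2).add_const ε).rpow_const (p := s) (Or.inl hpos.ne')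
  have h2 : fderiv ℝ (thinProfileReg s ε) X = _ := h1.fderiv
  rw [h2]
  simp [yCoord]
  ring

/-- The weak tangential gradient of `|y|^(2 s)`. -/
noncomputable def thinProfileGrad {n : ℕ} (s : ℝ) (θ : Sph n) : Amb n :=
  tangentPart (ridgeGrad 0 (fun _ => 0) (fun X => 2 * s * thinProfile s X / yCoord X) (θ : Amb n)) θ

theorem measurable_thinProfile {n : ℕ} (s : ℝ) : Measurable (thinProfile s : Amb n → ℝ) := by
  have := measurable_yCoord (n := n)
  unfold thinProfile
  fun_prop

theorem abs_thinProfile_div {n : ℕ} {s a : ℝ} (ha : a = 1 - 2 * s) {X : Amb n}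
    (hX : yCoord X ≠ 0) : |thinProfile s X / yCoord X| = |yCoord X| ^ (-a) := by
  have h0 := abs_pos.2 hX
  rw [abs_div, thinProfile, abs_of_pos (Real.rpow_pos_of_pos h0 _), ← Real.rpow_sub_one h0.ne', ha]
  congr 1; ring

theorem measurable_tangentPart {n : ℕ} {V : Sph n → Amb n} (hV : Measurable V) :
    Measurable fun θ => tangentPart (V θ) θ := by
  unfold tangentPart
  have : Measurable fun θ : Sph n => (θ : Amb n) := measurable_subtype_coe
  fun_prop

theorem memLp_tangentPart {n : ℕ} {a : ℝ} (ha : -1 < a) (ha1 : a < 1) {V : Sph n → Amb n}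
    (hV : Measurable V) {K L : ℝ}
    (hb : ∀ θ : Sph n, yCoord (θ : Amb n) ≠ 0 → ‖V θ‖ ≤ K + L * |yCoord (θ : Amb n)| ^ (-a)) :
    MemLp (fun θ => tangentPart (V θ) θ) 2 (sphereMeasure n a) := by
  have := isFiniteMeasure_sphereMeasure n ha
  have h1 : MemLp (fun θ : Sph n => 2 * (K + L * |yCoord (θ : Amb n)| ^ (-a))) 2
      (sphereMeasure n a) :=
    ((memLp_const K).add ((memLp_inv_weight n ha1).const_mul L)).const_mul 2
  refine h1.mono' (measurable_tangentPart hV).aestronglyMeasurable ?_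
  rw [ae_sphereMeasure_iff]
  filter_upwards [ae_sphere_yCoord_ne n] with θ hθ
  exact (norm_tangentPart_le _ _).trans (by linarith [hb θ hθ])

theorem measurable_ridgeGrad {n : ℕ} (e : Amb n) {pt py : Amb n → ℝ} (h1 : Measurable pt)
    (h2 : Measurable py) : Measurable (ridgeGrad e pt py) := by
  unfold ridgeGrad; fun_prop

theorem sq_yCoord_le_one {n : ℕ} (θ : Sph n) : yCoord (θ : Amb n) ^ 2 ≤ 1 := by
  have h := (abs_yCoord_le (θ : Amb n)).trans (norm_sph θ).le
  rw [← sq_abs]; exact pow_le_one₀ (abs_nonneg _) h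

/-- The approximations (y²+ε)^s have gradients dominated by 2s |y|^(2s-1) = 2s |y|^(-a), since the
exponent s - 1 is negative. This majorant is integrable for a < 1, and its square is integrable
against |y|^a. -/
theorem isWeakSphereGrad_thinProfile {n : ℕ} (hn : 1 ≤ n) {s a : ℝ} (hs0 : 0 < s) (hs1 : s < 1)
    (ha : a = 1 - 2 * s) :
    IsWeakSphereGrad a (fun θ : Sph n => thinProfile s (θ : Amb n)) (thinProfileGrad s) := by
  have hεpos : ∀ k : ℕ, (0 : ℝ) < 1 / ((k : ℝ) + 1) := fun k => by positivity
  have hε1 : ∀ k : ℕ, 1 / ((k : ℝ) + 1) ≤ 1 := fun k => by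
    rw [div_le_one (by positivity)]; linarith [(Nat.cast_nonneg k : (0 : ℝ) ≤ k)]
  refine isWeakSphereGrad_of_tendsto hn (f := fun k => thinProfileReg s (1 / ((k : ℝ) + 1)))
    (V := fun k => ridgeGrad 0 (fun _ => 0) fun X =>
      2 * s * yCoord X * (yCoord X ^ 2 + 1 / ((k : ℝ) + 1)) ^ (s - 1))
    (M := (2 : ℝ) ^ s) (B := fun θ => 2 * s * |yCoord (θ : Amb n)| ^ (-a)) ?_ ?_ ?_ ?_ ?_ ?_ ?_ ?_
  · intro k
    rw [contDiff_iff_contDiffAt]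
    intro X
    have := hεpos k
    exact ((contDiff_yCoord.pow 2).add contDiff_const).contDiffAt.rpow_const_of_ne
      (by positivity)
  · intro k X v
    rw [fderiv_thinProfileReg s (hεpos k), inner_ridgeGrad]
    ring
  · intro k θ
    have h1 := sq_yCoord_le_one θ
    have := hεpos k
    have := hε1 k
    rw [thinProfileReg, abs_of_nonneg (by positivity)]
    exact Real.rpow_le_rpow (by positivity) (by linarith) hs0.le
  · exact (integrable_abs_yCoord_rpow n (by linarith)).const_mul _
  · intro k
    filter_upwards [ae_sphere_yCoord_ne n] with θ hθ
    refine (norm_ridgeGrad_le (by simp) _ _ _).trans ?_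
    have hpos := hεpos k
    rw [abs_zero, zero_add, abs_mul, abs_mul, abs_of_pos (by positivity : (0:ℝ) < 2 * s),
      abs_of_pos (Real.rpow_pos_of_pos (by positivity) _), mul_assoc]
    refine mul_le_mul_of_nonneg_left ?_ (by positivity)
    have h0 := abs_pos.2 hθ
    calc |yCoord (θ : Amb n)| * (yCoord (θ : Amb n) ^ 2 + 1 / ((k : ℝ) + 1)) ^ (s - 1)
        ≤ |yCoord (θ : Amb n)| * (yCoord (θ : Amb n) ^ 2) ^ (s - 1) := by
          refine mul_le_mul_of_nonneg_left ?_ h0.le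
          exact Real.rpow_le_rpow_of_nonpos (by positivity) (by linarith) (by linarith)
      _ = |yCoord (θ : Amb n)| ^ (-a) := by
          rw [← abs_rpow_two_mul]
          conv_lhs => rw [← Real.rpow_one |yCoord (θ : Amb n)|, Real.rpow_one
            |yCoord (θ : Amb n)|]
          nth_rewrite 1 [← Real.rpow_one |yCoord (θ : Amb n)|]
          rw [← Real.rpow_add h0, ha]
          congr 1; ring
  · refine ae_of_all _ fun θ => ?_
    rw [thinProfile, abs_rpow_two_mul]
    have h1 := tendsto_add_one_div (yCoord (θ : Amb n) ^ 2)
    exact h1.rpow_const (Or.inr hs0.le)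
  · filter_upwards [ae_sphere_yCoord_ne n] with θ hθ
    have h1 := tendsto_add_one_div (yCoord (θ : Amb n) ^ 2)
    have h2 := h1.rpow_const (p := s - 1) (Or.inl (by positivity))
    have h3 : 2 * s * thinProfile s (θ : Amb n) / yCoord (θ : Amb n) =
        2 * s * yCoord (θ : Amb n) * (yCoord (θ : Amb n) ^ 2) ^ (s - 1) := by
      rw [thinProfile, abs_rpow_two_mul, Real.rpow_sub_one (by positivity)]
      field_simp
    simp only [ridgeGrad, h3]
    exact tendsto_const_nhds.add ((h2.const_mul _).smul_const _)
  · have hm : Measurable fun X : Amb n => 2 * s * thinProfile s X / yCoord X := by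
      have := measurable_thinProfile (n := n) s
      have := measurable_yCoord (n := n)
      fun_prop
    refine memLp_tangentPart (V := fun θ : Sph n => ridgeGrad 0 (fun _ => 0)
      (fun X => 2 * s * thinProfile s X / yCoord X) (θ : Amb n)) (by linarith) (by linarith)
      ((measurable_ridgeGrad 0 measurable_const hm).comp measurable_subtype_coe)
      (K := 0) (L := 2 * s) ?_
    intro θ hθ
    refine (norm_ridgeGrad_le (by simp) _ _ _).trans ?_
    rw [abs_zero, mul_div_assoc, abs_mul, abs_thinProfile_div ha hθ,
      abs_of_pos (by positivity : (0:ℝ) < 2 * s)]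

/-! ### The homogeneous solution of the thin obstacle problem -/

/-- The regularized distance `√(⟨X, e⟩² + y² + ε)`. -/
noncomputable def slitRho {n : ℕ} (e : Amb n) (ε : ℝ) (X : Amb n) : ℝ :=
  √(inner ℝ X e ^ 2 + yCoord X ^ 2 + ε)

/-- The function `ρ + ⟨X, e⟩`, vanishing on the half of the thin space where `⟨X, e⟩ ≤ 0`. -/
noncomputable def slitBase {n : ℕ} (e : Amb n) (ε : ℝ) (X : Amb n) : ℝ :=
  slitRho e ε X + inner ℝ X e

/-- The `(1 + s)`-homogeneous solution `(⟨X, e⟩ / s - ρ) (ρ + ⟨X, e⟩)^s` (for `ε = 0`). -/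
noncomputable def slit {n : ℕ} (s : ℝ) (e : Amb n) (ε : ℝ) (X : Amb n) : ℝ :=
  (inner ℝ X e / s - slitRho e ε X) * slitBase e ε X ^ s

/-- The derivative of `slit` in the direction `e`. -/
noncomputable def slitT {n : ℕ} (s : ℝ) (e : Amb n) (ε : ℝ) (X : Amb n) : ℝ :=
  (1 / s - s) * slitBase e ε X ^ s

/-- The derivative of `slit` in the direction `y`. -/
noncomputable def slitY {n : ℕ} (s : ℝ) (e : Amb n) (ε : ℝ) (X : Amb n) : ℝ :=
  -(1 + s) * (yCoord X * slitBase e ε X ^ (s - 1))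

section
variable {n : ℕ} {e : Amb n} {ε : ℝ} {X : Amb n}

theorem slitRho_sq (hε : 0 ≤ ε) : slitRho e ε X ^ 2 = inner ℝ X e ^ 2 + yCoord X ^ 2 + ε :=
  Real.sq_sqrt (by positivity)

theorem slitRho_nonneg : 0 ≤ slitRho e ε X := Real.sqrt_nonneg _

theorem abs_inner_lt_slitRho (h : 0 < yCoord X ^ 2 + ε) : |inner ℝ X e| < slitRho e ε X := by
  rw [slitRho, ← Real.sqrt_sq_eq_abs]
  exact Real.sqrt_lt_sqrt (sq_nonneg _) (by linarith)

theorem abs_inner_le_slitRho (hε : 0 ≤ ε) : |inner ℝ X e| ≤ slitRho e ε X := by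
  rw [slitRho, ← Real.sqrt_sq_eq_abs]
  exact Real.sqrt_le_sqrt (by nlinarith [sq_nonneg (yCoord X)])

theorem slitBase_pos (h : 0 < yCoord X ^ 2 + ε) : 0 < slitBase e ε X := by
  have := abs_lt.1 (abs_inner_lt_slitRho (e := e) h)
  unfold slitBase; linarith

theorem slitBase_nonneg (hε : 0 ≤ ε) : 0 ≤ slitBase e ε X := by
  have := abs_le.1 (abs_inner_le_slitRho (X := X) (e := e) hε)
  unfold slitBase; linarith

theorem hasFDerivAt_slitRho (h : 0 < yCoord X ^ 2 + ε) :
    HasFDerivAt (slitRho e ε) ((slitRho e ε X)⁻¹ • (inner ℝ X e • innerSL ℝ e +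
      yCoord X • (EuclideanSpace.proj (Fin.last n) : Amb n →L[ℝ] ℝ))) X := by
  have hρ : 0 < slitRho e ε X := (abs_nonneg _).trans_lt (abs_inner_lt_slitRho (e := e) h)
  have h1 := ((((hasFDerivAt_innerRight e X).pow 2).add ((hasFDerivAt_yCoord X).pow 2)).add_const
    ε).sqrt (by
      have := sq_nonneg (inner ℝ X e)
      simp only [Pi.add_apply]
      linarith)
  refine h1.congr_fderiv ?_
  ext v
  simp only [smul_apply, add_apply, nsmul_eq_mul, smul_eq_mul, Pi.add_apply]
  rw [show √(inner ℝ X e ^ 2 + yCoord X ^ 2 + ε) = slitRho e ε X from rfl]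
  field_simp
  push_cast
  ring

theorem hasFDerivAt_slitBase (h : 0 < yCoord X ^ 2 + ε) :
    HasFDerivAt (slitBase e ε) ((slitRho e ε X)⁻¹ • (inner ℝ X e • innerSL ℝ e +
      yCoord X • (EuclideanSpace.proj (Fin.last n) : Amb n →L[ℝ] ℝ)) + innerSL ℝ e) X :=
  (hasFDerivAt_slitRho h).add (hasFDerivAt_innerRight e X)

theorem fderiv_slitBase_rpow (hε : 0 ≤ ε) (h : 0 < yCoord X ^ 2 + ε) (κ : ℝ) (v : Amb n) :
    fderiv ℝ (fun X => slitBase e ε X ^ κ) X v = κ * (slitBase e ε X ^ κ / slitBase e ε X) *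
      ((inner ℝ X e * inner ℝ v e + yCoord X * yCoord v) / slitRho e ε X + inner ℝ v e) := by
  have hm := slitBase_pos (e := e) h
  have h1 : fderiv ℝ (fun X => slitBase e ε X ^ κ) X = _ :=
    ((hasFDerivAt_slitBase h).rpow_const (p := κ) (Or.inl hm.ne')).fderiv
  rw [h1, Real.rpow_sub_one hm.ne']
  simp only [smul_apply, add_apply, smul_eq_mul, innerSL_apply_apply, proj_last_apply,
    real_inner_comm]
  ring

theorem contDiffAt_slitRho (h : 0 < yCoord X ^ 2 + ε) : ContDiffAt ℝ ∞ (slitRho e ε) X := by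
  have h1 : ContDiff ℝ ∞ fun X : Amb n => inner ℝ X e ^ 2 + yCoord X ^ 2 + ε :=
    (((contDiff_innerRight e).pow 2).add (contDiff_yCoord.pow 2)).add contDiff_const
  exact h1.contDiffAt.sqrt (by nlinarith [sq_nonneg (inner ℝ X e)])

theorem contDiffAt_slitBase_rpow (h : 0 < yCoord X ^ 2 + ε) (κ : ℝ) :
    ContDiffAt ℝ ∞ (fun X => slitBase e ε X ^ κ) X :=
  ((contDiffAt_slitRho h).add (contDiff_innerRight e).contDiffAt).rpow_const_of_ne
    (slitBase_pos h).ne'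

theorem contDiffAt_slit (h : 0 < yCoord X ^ 2 + ε) (s : ℝ) : ContDiffAt ℝ ∞ (slit s e ε) X :=
  ((((contDiff_innerRight e).div_const s).contDiffAt).sub (contDiffAt_slitRho h)).mul
    (contDiffAt_slitBase_rpow h s)

/-- The factorization (ρ+t)(ρ-t) = y² + ε, with t = ⟨X,e⟩. It trades y² for a multiple of the base ρ
+ t in the differential identities, and bounds the base from below in terms of y². -/
theorem slitBase_mul (hε : 0 ≤ ε) :
    slitBase e ε X * (slitRho e ε X - inner ℝ X e) = yCoord X ^ 2 + ε := by
  have := slitRho_sq (e := e) (X := X) hε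
  unfold slitBase; linarith

/-- Only the relation ∇ρ = (t, y)/ρ enters, and it holds for every ε. The closed forms of the
derivatives therefore survive regularization. -/
theorem fderiv_slit (hε : 0 ≤ ε) (h : 0 < yCoord X ^ 2 + ε) {s : ℝ} (hs : 0 < s) (v : Amb n) :
    fderiv ℝ (slit s e ε) X v = slitT s e ε X * inner ℝ v e + slitY s e ε X * yCoord v := by
  have hm := slitBase_pos (e := e) h
  have hρ : 0 < slitRho e ε X := (abs_nonneg _).trans_lt (abs_inner_lt_slitRho (e := e) h)
  have h1 := ((contDiffAt_slitBase_rpow (e := e) h s).differentiableAt (by simp)).hasFDerivAt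
  have h2 : fderiv ℝ (slit s e ε) X = _ :=
    ((((hasFDerivAt_innerRight e X).mul_const s⁻¹).sub (hasFDerivAt_slitRho h)).mul h1).fderiv
  rw [h2]
  simp only [smul_apply, add_apply, sub_apply, smul_eq_mul, innerSL_apply_apply, proj_last_apply,
    fderiv_slitBase_rpow hε h]
  rw [slitT, slitY, Real.rpow_sub_one hm.ne', real_inner_comm v e, Pi.sub_apply]
  have hb : slitBase e ε X = slitRho e ε X + inner ℝ X e := rfl
  rw [hb] at hm ⊢
  field_simp
  ring

/-- Each identity is checked in the variables t = ⟨X,e⟩, y, ρ and m = ρ + t. Since ρ and m have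
degree one, homogeneity is Euler's relation for them, and off the thin space `slit` solves div(|y|^a
∇v) = 0, so its spherical Laplacian is a multiple of itself. -/
theorem isRidge_slit {s a : ℝ} (hs : 0 < s) (ha : a = 1 - 2 * s) (he : yCoord e = 0)
    (hne : ‖e‖ = 1) :
    IsRidge a e (1 + s) (slit s e 0) (slitT s e 0) (slitY s e 0)
      (fun X => (1 + s) * (1 + s + n + a - 1) * slit s e 0 X) := by
  have hy : ∀ {X : Amb n}, yCoord X ≠ 0 → 0 < yCoord X ^ 2 + 0 := fun hX => by positivity
  have hee : inner ℝ e e = (1 : ℝ) := by rw [real_inner_self_eq_norm_sq, hne, one_pow]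
  have hT : ∀ {X : Amb n}, yCoord X ≠ 0 → ∀ v : Amb n, fderiv ℝ (slitT s e 0) X v =
      (1 / s - s) * (s * (slitBase e 0 X ^ s / slitBase e 0 X) *
      ((inner ℝ X e * inner ℝ v e + yCoord X * yCoord v) / slitRho e 0 X + inner ℝ v e)) := by
    intro X hX v
    have h1 : fderiv ℝ (slitT s e 0) X = _ :=
      fderiv_const_mul ((contDiffAt_slitBase_rpow (e := e) (hy hX) s).differentiableAt (by simp))
        (1 / s - s)
    rw [h1, smul_apply, fderiv_slitBase_rpow le_rfl (hy hX), smul_eq_mul]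
  have hY : ∀ {X : Amb n}, yCoord X ≠ 0 → ∀ v : Amb n, fderiv ℝ (slitY s e 0) X v =
      -(1 + s) * (slitBase e 0 X ^ (s - 1) * yCoord v +
        yCoord X * ((s - 1) * (slitBase e 0 X ^ (s - 1) / slitBase e 0 X) *
      ((inner ℝ X e * inner ℝ v e + yCoord X * yCoord v) / slitRho e 0 X + inner ℝ v e))) := by
    intro X hX v
    have h0 := ((contDiffAt_slitBase_rpow (e := e) (hy hX) (s - 1)).differentiableAt
      (by simp)).hasFDerivAt
    have h1 : fderiv ℝ (slitY s e 0) X = _ :=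
      (((hasFDerivAt_yCoord X).mul h0).const_mul (-(1 + s))).fderiv
    rw [h1]
    simp only [smul_apply, add_apply, fderiv_slitBase_rpow le_rfl (hy hX), smul_eq_mul,
      proj_last_apply]
    ring
  refine ⟨he, fun X hX => contDiffAt_const.mul (contDiffAt_slitBase_rpow (hy hX) s),
    fun X hX => contDiffAt_const.mul (contDiff_yCoord.contDiffAt.mul
      (contDiffAt_slitBase_rpow (hy hX) (s - 1))), fun X hX => ?_, fun X hX => ?_, fun X hX => ?_,
    fun X hX => ?_⟩
  all_goals
    have hm := slitBase_pos (e := e) (hy hX)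
    have hρ : 0 < slitRho e 0 X := (abs_nonneg _).trans_lt (abs_inner_lt_slitRho (e := e) (hy hX))
    have hsq := slitRho_sq (e := e) (X := X) le_rfl
    have hmul := slitBase_mul (e := e) (X := X) le_rfl
    have hb : slitBase e 0 X = slitRho e 0 X + inner ℝ X e := rfl
    rw [add_zero] at hsq hmul
  · rw [slitT, slitY, slit, Real.rpow_sub_one hm.ne']
    have h2 : yCoord X * (-(1 + s) * (yCoord X * (slitBase e 0 X ^ s / slitBase e 0 X))) =
        -(1 + s) * (slitRho e 0 X - inner ℝ X e) * slitBase e 0 X ^ s := by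
      rw [show yCoord X * (-(1 + s) * (yCoord X * (slitBase e 0 X ^ s / slitBase e 0 X))) =
        -(1 + s) * (yCoord X ^ 2 * (slitBase e 0 X ^ s / slitBase e 0 X)) by ring, ← hmul]
      field_simp
    rw [h2]
    field_simp
    ring
  · rw [hT hX, slitT]
    have h2 : (inner ℝ X e * inner ℝ X e + yCoord X * yCoord X) / slitRho e 0 X + inner ℝ X e =
        slitBase e 0 X := by
      rw [hb, div_add' _ _ _ hρ.ne', div_eq_iff hρ.ne']; linarith
    rw [h2]
    field_simp
    ring
  · rw [hY hX, slitY]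
    have h2 : (inner ℝ X e * inner ℝ X e + yCoord X * yCoord X) / slitRho e 0 X + inner ℝ X e =
        slitBase e 0 X := by
      rw [hb, div_add' _ _ _ hρ.ne', div_eq_iff hρ.ne']; linarith
    rw [h2]
    field_simp
    ring
  · rw [hT hX, hY hX, slitY, he, yCoord_yDir, inner_dir_yDir he, hee, ha]
    simp only [mul_zero, mul_one, add_zero, zero_add]
    rw [Real.rpow_sub_one hm.ne']
    set P := slitBase e 0 X ^ s
    set m := slitBase e 0 X with hm'
    set ρ := slitRho e 0 X
    set t : ℝ := inner ℝ X e
    set y := yCoord X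
    -- This is the equation ∂_tt v + ∂_yy v + (a/y) ∂_y v = 0; y² is eliminated through y² = m(ρ-t).
    have hz : (1 / s - s) * (s * (P / m) * (t / ρ + 1)) +
      -(1 + s) * (P / m + y * ((s - 1) * (P / m / m) * (y / ρ))) +
      (1 - 2 * s) * (-(1 + s) * (y * (P / m))) / y = 0 := by
      have e1 : y * ((s - 1) * (P / m / m) * (y / ρ)) = (s - 1) * (P / m) * ((ρ - t) / ρ) := by
        rw [show y * ((s - 1) * (P / m / m) * (y / ρ)) = (s - 1) * (P / m / m) * (y ^ 2 / ρ) by ring,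
          ← hmul]
        field_simp
      rw [e1]
      field_simp
      ring
    rw [hz]; ring

/-! #### Bounds on the sphere -/

theorem abs_inner_sph_le (hne : ‖e‖ = 1) (θ : Sph n) : |inner ℝ (θ : Amb n) e| ≤ 1 := by
  simpa [norm_sph, hne] using abs_real_inner_le_norm (θ : Amb n) e

theorem slitRho_le_two (hne : ‖e‖ = 1) (hε1 : ε ≤ 1) (θ : Sph n) :
    slitRho e ε (θ : Amb n) ≤ 2 := by
  have h1 := sq_yCoord_le_one θ
  have h2 : inner ℝ (θ : Amb n) e ^ 2 ≤ 1 := by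
    rw [← sq_abs]; exact pow_le_one₀ (abs_nonneg _) (abs_inner_sph_le hne θ)
  rw [slitRho, Real.sqrt_le_left (by norm_num)]
  linarith

theorem slitBase_le_three (hne : ‖e‖ = 1) (hε1 : ε ≤ 1) (θ : Sph n) :
    slitBase e ε (θ : Amb n) ≤ 3 := by
  have h1 := slitRho_le_two hne hε1 θ
  have h2 := (abs_le.1 (abs_inner_sph_le hne θ)).2
  unfold slitBase; linarith

/-- On the sphere ρ - t ≤ 2 + 1, and the product of the base with ρ - t is y² + ε. -/
theorem sq_div_three_le_slitBase (hne : ‖e‖ = 1) (hε0 : 0 ≤ ε) (hε1 : ε ≤ 1) (θ : Sph n) :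
    yCoord (θ : Amb n) ^ 2 / 3 ≤ slitBase e ε (θ : Amb n) := by
  have h1 := slitRho_le_two hne hε1 θ
  have h2 := (abs_le.1 (abs_inner_sph_le hne θ)).1
  have h3 := slitBase_mul (e := e) (X := (θ : Amb n)) hε0
  have h4 := slitBase_nonneg (e := e) (X := (θ : Amb n)) hε0
  nlinarith

theorem slitBase_rpow_le_of_nonpos (hne : ‖e‖ = 1) (hε0 : 0 ≤ ε) (hε1 : ε ≤ 1) {θ : Sph n}
    (hθ : yCoord (θ : Amb n) ≠ 0) {κ : ℝ} (hκ0 : κ ≤ 0) (hκ1 : -1 ≤ κ) :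
    slitBase e ε (θ : Amb n) ^ κ ≤ 3 * |yCoord (θ : Amb n)| ^ (2 * κ) := by
  have h0 : 0 < yCoord (θ : Amb n) ^ 2 / 3 := by positivity
  calc slitBase e ε (θ : Amb n) ^ κ ≤ (yCoord (θ : Amb n) ^ 2 / 3) ^ κ :=
        Real.rpow_le_rpow_of_nonpos h0 (sq_div_three_le_slitBase hne hε0 hε1 θ) hκ0
    _ = 3 ^ (-κ) * |yCoord (θ : Amb n)| ^ (2 * κ) := by
        rw [abs_rpow_two_mul, Real.div_rpow (by positivity) (by norm_num),
          Real.rpow_neg (by norm_num)]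
        ring
    _ ≤ 3 ^ (1 : ℝ) * |yCoord (θ : Amb n)| ^ (2 * κ) := by
        gcongr
        · norm_num
        · linarith
    _ = _ := by rw [Real.rpow_one]

theorem slitBase_rpow_le_three (hne : ‖e‖ = 1) (hε0 : 0 ≤ ε) (hε1 : ε ≤ 1) (θ : Sph n)
    {κ : ℝ} (hκ0 : 0 ≤ κ) (hκ1 : κ ≤ 1) : slitBase e ε (θ : Amb n) ^ κ ≤ 3 := by
  calc slitBase e ε (θ : Amb n) ^ κ ≤ 3 ^ κ :=
        Real.rpow_le_rpow (slitBase_nonneg hε0) (slitBase_le_three hne hε1 θ) hκ0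
    _ ≤ 3 ^ (1 : ℝ) := Real.rpow_le_rpow_of_exponent_le (by norm_num) hκ1
    _ = 3 := Real.rpow_one _

theorem abs_slit_le {s : ℝ} (hs0 : 0 < s) (hne : ‖e‖ = 1) (hε0 : 0 ≤ ε)
    (hε1 : ε ≤ 1) (θ : Sph n) :
    |slit s e ε (θ : Amb n)| ≤ (1 / s + 2) * slitBase e ε (θ : Amb n) ^ s := by
  have h1 := slitRho_le_two hne hε1 θ
  have h2 := abs_inner_sph_le hne θ
  have h3 : 0 ≤ slitBase e ε (θ : Amb n) ^ s := Real.rpow_nonneg (slitBase_nonneg hε0) _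
  rw [slit, abs_mul, abs_of_nonneg h3]
  refine mul_le_mul_of_nonneg_right ?_ h3
  refine (abs_sub _ _).trans (add_le_add ?_ ?_)
  · rw [abs_div, abs_of_pos hs0]; gcongr
  · rw [abs_of_nonneg slitRho_nonneg]; exact h1

theorem abs_slitY_le {s a : ℝ} (hs0 : 0 < s) (hs1 : s < 1) (ha : a = 1 - 2 * s) (hne : ‖e‖ = 1)
    (hε0 : 0 ≤ ε) (hε1 : ε ≤ 1) {θ : Sph n} (hθ : yCoord (θ : Amb n) ≠ 0) :
    |slitY s e ε (θ : Amb n)| ≤ 6 * |yCoord (θ : Amb n)| ^ (-a) := by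
  have h0 := abs_pos.2 hθ
  have h1 := slitBase_rpow_le_of_nonpos hne hε0 hε1 hθ (κ := s - 1) (by linarith) (by linarith)
  have h3 : 0 ≤ slitBase e ε (θ : Amb n) ^ (s - 1) := Real.rpow_nonneg (slitBase_nonneg hε0) _
  rw [slitY, abs_mul, abs_mul, abs_neg, abs_of_pos (by linarith : 0 < 1 + s), abs_of_nonneg h3]
  calc (1 + s) * (|yCoord (θ : Amb n)| * slitBase e ε (θ : Amb n) ^ (s - 1))
      ≤ 2 * (|yCoord (θ : Amb n)| * (3 * |yCoord (θ : Amb n)| ^ (2 * (s - 1)))) := by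
        gcongr; linarith
    _ = 6 * (|yCoord (θ : Amb n)| ^ (1 : ℝ) * |yCoord (θ : Amb n)| ^ (2 * (s - 1))) := by
        rw [Real.rpow_one]; ring
    _ = _ := by
        rw [← Real.rpow_add h0, ha]; congr 2; ring

theorem abs_slitT_le {s : ℝ} (hs0 : 0 < s) (hs1 : s < 1) (hne : ‖e‖ = 1)
    (hε0 : 0 ≤ ε) (hε1 : ε ≤ 1) (θ : Sph n) : |slitT s e ε (θ : Amb n)| ≤ 1 / s * 3 := by
  have h1 := slitBase_rpow_le_three hne hε0 hε1 θ hs0.le hs1.le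
  have h3 : 0 ≤ slitBase e ε (θ : Amb n) ^ s := Real.rpow_nonneg (slitBase_nonneg hε0) _
  have h4 : 1 ≤ 1 / s := by rw [le_div_iff₀ hs0]; linarith
  rw [slitT, abs_mul, abs_of_nonneg h3, abs_of_nonneg (by linarith)]
  exact mul_le_mul (by linarith) h1 h3 (by linarith)

theorem continuous_slitRho (e : Amb n) (ε : ℝ) : Continuous (slitRho e ε) := by
  have := continuous_yCoord (n := n)
  unfold slitRho; fun_prop

theorem continuous_slitBase_rpow (e : Amb n) (ε : ℝ) {s : ℝ} (hs : 0 ≤ s) :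
    Continuous fun X => slitBase e ε X ^ s := by
  have := continuous_slitRho e ε
  refine Continuous.rpow_const ?_ fun _ => Or.inr hs
  unfold slitBase; fun_prop

theorem continuous_slit (e : Amb n) (ε : ℝ) {s : ℝ} (hs : 0 ≤ s) : Continuous (slit s e ε) := by
  have := continuous_slitRho e ε
  have := continuous_slitBase_rpow e ε hs
  unfold slit; fun_prop

/-- The weak tangential gradient of `slit`. -/
noncomputable def slitGrad (s : ℝ) (e : Amb n) (θ : Sph n) : Amb n :=
  tangentPart (ridgeGrad e (slitT s e 0) (slitY s e 0) (θ : Amb n)) θ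

theorem tendsto_slitBase (e X : Amb n) :
    Tendsto (fun k : ℕ => slitBase e (1 / ((k : ℝ) + 1)) X) atTop (𝓝 (slitBase e 0 X)) := by
  have h := (tendsto_add_one_div (inner ℝ X e ^ 2 + yCoord X ^ 2)).sqrt.add_const (inner ℝ X e)
  simpa only [slitBase, slitRho, add_zero] using h

/-- The regularizations with ε = 1/(k+1) are smooth and uniformly bounded. Their gradients are
dominated by a constant plus 6|y|^(-a), because |y| (ρ+t)^(s-1) ≤ 3|y|^(2s-1): the same integrable
singularity as for |y|^(2s). -/
theorem isWeakSphereGrad_slit (hn : 1 ≤ n) {s a : ℝ} (hs0 : 0 < s) (hs1 : s < 1)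
    (ha : a = 1 - 2 * s) (hne : ‖e‖ = 1) :
    IsWeakSphereGrad a (fun θ : Sph n => slit s e 0 (θ : Amb n)) (slitGrad s e) := by
  have hεpos : ∀ k : ℕ, (0 : ℝ) < 1 / ((k : ℝ) + 1) := fun k => by positivity
  have hε1 : ∀ k : ℕ, 1 / ((k : ℝ) + 1) ≤ 1 := fun k => by
    rw [div_le_one (by positivity)]; linarith [(Nat.cast_nonneg k : (0 : ℝ) ≤ k)]
  have hpos : ∀ (k : ℕ) (X : Amb n), 0 < yCoord X ^ 2 + 1 / ((k : ℝ) + 1) := fun k X =>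
    add_pos_of_nonneg_of_pos (sq_nonneg _) (hεpos k)
  have hi : Integrable (fun θ : Sph n => 1 / s * 3 + 6 * |yCoord (θ : Amb n)| ^ (-a))
      (surfaceMeasure n) :=
    (integrable_const _).add ((integrable_abs_yCoord_rpow n (by linarith)).const_mul _)
  refine isWeakSphereGrad_of_tendsto hn (f := fun k => slit s e (1 / ((k : ℝ) + 1)))
    (V := fun k => ridgeGrad e (slitT s e (1 / ((k : ℝ) + 1))) (slitY s e (1 / ((k : ℝ) + 1))))
    (M := (1 / s + 2) * 3) ?_ ?_ ?_ hi ?_ ?_ ?_ ?_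
  · intro k
    rw [contDiff_iff_contDiffAt]
    exact fun X => contDiffAt_slit (hpos k X) s
  · intro k X v
    rw [fderiv_slit (hεpos k).le (hpos k X) hs0, inner_ridgeGrad]
  · intro k θ
    refine (abs_slit_le hs0 hne (hεpos k).le (hε1 k) θ).trans ?_
    have := slitBase_rpow_le_three hne (hεpos k).le (hε1 k) θ hs0.le hs1.le
    gcongr
  · intro k
    filter_upwards [ae_sphere_yCoord_ne n] with θ hθ
    exact (norm_ridgeGrad_le hne.le _ _ _).trans (add_le_add
      (abs_slitT_le hs0 hs1 hne (hεpos k).le (hε1 k) θ)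
      (abs_slitY_le hs0 hs1 ha hne (hεpos k).le (hε1 k) hθ))
  · refine ae_of_all _ fun θ => ?_
    have h1 := tendsto_slitBase e (θ : Amb n)
    have h2 := (tendsto_add_one_div (inner ℝ (θ : Amb n) e ^ 2 + yCoord (θ : Amb n) ^ 2)).sqrt
    have h3 := (h2.const_sub (inner ℝ (θ : Amb n) e / s)).mul
      (h1.rpow_const (p := s) (Or.inr hs0.le))
    simpa only [slit, slitRho, add_zero] using h3
  · filter_upwards [ae_sphere_yCoord_ne n] with θ hθ
    have h1 := tendsto_slitBase e (θ : Amb n)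
    have hm : slitBase e 0 (θ : Amb n) ≠ 0 := (slitBase_pos (by positivity)).ne'
    exact (((h1.rpow_const (Or.inl hm)).const_mul _).smul_const _).add
      ((((h1.rpow_const (Or.inl hm)).const_mul _).const_mul _).smul_const _)
  · have hm : Measurable (slitBase e 0) :=
      ((continuous_slitRho e 0).add (contDiff_innerRight e).continuous).measurable
    have hmy := measurable_yCoord (n := n)
    refine memLp_tangentPart (V := fun θ : Sph n => ridgeGrad e (slitT s e 0) (slitY s e 0)
      (θ : Amb n)) (by linarith) (by linarith)
      ((measurable_ridgeGrad e (by unfold slitT; fun_prop) (by unfold slitY; fun_prop)).comp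
        measurable_subtype_coe) (K := 1 / s * 3) (L := 6) ?_
    intro θ hθ
    exact (norm_ridgeGrad_le hne.le _ _ _).trans (add_le_add
      (abs_slitT_le hs0 hs1 hne le_rfl zero_le_one θ)
      (abs_slitY_le hs0 hs1 ha hne le_rfl zero_le_one hθ))

/-- The bound which makes the boundary term vanish in the integration by parts for `slit`. -/
theorem slit_boundary_bound {s a : ℝ} (hs0 : 0 < s) (hs1 : s < 1) (ha : a = 1 - 2 * s)
    (hne : ‖e‖ = 1) {θ : Sph n} (hθ : yCoord (θ : Amb n) ≠ 0) {K g : ℝ} (hK : 0 ≤ K)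
    (hg : |g| ≤ K * (slitBase e 0 (θ : Amb n) ^ s + |yCoord (θ : Amb n)| ^ (2 * s))) :
    |g| * |yCoord (θ : Amb n)| ^ a * |slitY s e 0 (θ : Amb n)| ≤ |yCoord (θ : Amb n)| *
      (2 * K * (3 * |yCoord (θ : Amb n)| ^ a + 6 * |yCoord (θ : Amb n)| ^ (-a))) := by
  have h0 := abs_pos.2 hθ
  have hm : 0 < slitBase e 0 (θ : Amb n) := slitBase_pos (by positivity)
  have h1 := slitBase_rpow_le_of_nonpos hne le_rfl zero_le_one hθ (κ := s - 1)
    (by linarith) (by linarith)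
  -- The product m^s m^(s-1) = m^(2s-1) is bounded if 2s ≥ 1 and otherwise at most 3|y|^(2(2s-1)) =
  -- 3|y|^(-2a). After multiplication by |y|^a both cases are integrable, as |a| < 1.
  have h2 : slitBase e 0 (θ : Amb n) ^ (2 * s - 1) ≤ 3 + 3 * |yCoord (θ : Amb n)| ^ (-(2 * a)) := by
    rcases le_total 0 (2 * s - 1) with h | h
    · have := slitBase_rpow_le_three hne le_rfl zero_le_one θ h (by linarith)
      have h3 : 0 ≤ |yCoord (θ : Amb n)| ^ (-(2 * a)) := by positivity
      linarith
    · have := slitBase_rpow_le_of_nonpos hne le_rfl zero_le_one hθ h (by linarith)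
      rw [show 2 * (2 * s - 1) = -(2 * a) by rw [ha]; ring] at this
      linarith
  rw [slitY, abs_mul, abs_mul, abs_neg, abs_of_pos (by linarith : 0 < 1 + s),
    abs_of_pos (Real.rpow_pos_of_pos hm (s - 1))]
  set y := |yCoord (θ : Amb n)|
  set m := slitBase e 0 (θ : Amb n)
  have e1 : m ^ s * m ^ (s - 1) = m ^ (2 * s - 1) := by
    rw [← Real.rpow_add hm]; congr 1; ring
  have e2 : y ^ a * y ^ (-(2 * a)) = y ^ (-a) := by
    rw [← Real.rpow_add h0]; congr 1; ring
  have e3 : y ^ a * (y ^ (2 * s) * y ^ (2 * (s - 1))) = y ^ (-a) := by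
    rw [← Real.rpow_add h0, ← Real.rpow_add h0]; congr 1; rw [ha]; ring
  have p1 : 0 ≤ m ^ (s - 1) := (Real.rpow_pos_of_pos hm _).le
  calc |g| * y ^ a * ((1 + s) * (y * m ^ (s - 1)))
      ≤ (K * (m ^ s + y ^ (2 * s))) * y ^ a * (2 * (y * m ^ (s - 1))) := by
        gcongr; linarith
    _ = y * (2 * K * (y ^ a * (m ^ s * m ^ (s - 1)) + y ^ a * (y ^ (2 * s) * m ^ (s - 1)))) := by
        ring
    _ ≤ y * (2 * K * (y ^ a * (3 + 3 * y ^ (-(2 * a))) +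
          y ^ a * (y ^ (2 * s) * (3 * y ^ (2 * (s - 1)))))) := by
        rw [e1]; gcongr
    _ = y * (2 * K * (3 * y ^ a + 3 * (y ^ a * y ^ (-(2 * a))) +
          3 * (y ^ a * (y ^ (2 * s) * y ^ (2 * (s - 1)))))) := by ring
    _ = _ := by rw [e2, e3]; ring

end

/-! ### Square integrable functions and fields on the sphere -/

/-- The weighted space `L²(∂B₁, |y|^a)`. -/
noncomputable abbrev SphL2 (n : ℕ) (a : ℝ) := Lp ℝ 2 (sphereMeasure n a)

/-- The weighted space of square integrable vector fields along `∂B₁`. -/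
noncomputable abbrev SphField (n : ℕ) (a : ℝ) := Lp (Amb n) 2 (sphereMeasure n a)

theorem integrable_mul_of_memLp {α : Type*} {m : MeasurableSpace α} {μ : Measure α} {f g : α → ℝ}
    (hf : MemLp f 2 μ) (hg : MemLp g 2 μ) : Integrable (fun x => f x * g x) μ :=
  hf.integrable_mul hg

theorem integrable_inner_of_memLp {α : Type*} {m : MeasurableSpace α} {μ : Measure α} {n : ℕ}
    {f g : α → Amb n} (hf : MemLp f 2 μ) (hg : MemLp g 2 μ) :
    Integrable (fun x => inner ℝ (f x) (g x)) μ := by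
  refine (L2.integrable_inner (𝕜 := ℝ) (hf.toLp f) (hg.toLp g)).congr ?_
  filter_upwards [hf.coeFn_toLp, hg.coeFn_toLp] with x h1 h2
  rw [h1, h2]

theorem inner_toLp_real {α : Type*} {m : MeasurableSpace α} {μ : Measure α} {f g : α → ℝ}
    (hf : MemLp f 2 μ) (hg : MemLp g 2 μ) :
    inner ℝ (hf.toLp f) (hg.toLp g) = ∫ x, f x * g x ∂μ := by
  rw [L2.inner_def]
  apply integral_congr_ae
  filter_upwards [hf.coeFn_toLp, hg.coeFn_toLp] with x h1 h2
  rw [h1, h2, real_inner_eq_re_inner, RCLike.inner_apply]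
  simp [mul_comm]

theorem inner_toLp_field {α : Type*} {m : MeasurableSpace α} {μ : Measure α} {n : ℕ}
    {f g : α → Amb n} (hf : MemLp f 2 μ) (hg : MemLp g 2 μ) :
    inner ℝ (hf.toLp f) (hg.toLp g) = ∫ x, inner ℝ (f x) (g x) ∂μ := by
  rw [L2.inner_def]
  apply integral_congr_ae
  filter_upwards [hf.coeFn_toLp, hg.coeFn_toLp] with x h1 h2
  rw [h1, h2]

theorem IsWeakSphereGrad.congr {n : ℕ} {a : ℝ} {c c' : Sph n → ℝ} {G G' : Sph n → Amb n}
    (h : IsWeakSphereGrad a c G) (hc : c =ᵐ[sphereMeasure n a] c')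
    (hG : G =ᵐ[sphereMeasure n a] G') : IsWeakSphereGrad a c' G' := by
  refine ⟨h.1.ae_eq hG, fun φ hφ e => ?_⟩
  have hc' := (surfaceMeasure_ac n a).ae_eq hc
  have hG' := (surfaceMeasure_ac n a).ae_eq hG
  have e1 : ∫ θ : Sph n, c θ * (fderiv ℝ φ θ e - inner ℝ (θ : Amb n) e *
      fderiv ℝ φ θ (θ : Amb n) - n * φ θ * inner ℝ (θ : Amb n) e) ∂(surfaceMeasure n) =
      ∫ θ : Sph n, c' θ * (fderiv ℝ φ θ e - inner ℝ (θ : Amb n) e *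
      fderiv ℝ φ θ (θ : Amb n) - n * φ θ * inner ℝ (θ : Amb n) e) ∂(surfaceMeasure n) :=
    integral_congr_ae (by filter_upwards [hc'] with θ hθ; rw [hθ])
  have e2 : ∫ θ : Sph n, inner ℝ (G θ) e * φ θ ∂(surfaceMeasure n) =
      ∫ θ : Sph n, inner ℝ (G' θ) e * φ θ ∂(surfaceMeasure n) :=
    integral_congr_ae (by filter_upwards [hG'] with θ hθ; rw [hθ])
  rw [← e1, ← e2]
  exact h.2 φ hφ e

theorem integrable_mul_continuous {n : ℕ} {ψ : Sph n → ℝ} {g : Sph n → ℝ}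
    (hg : Integrable g (surfaceMeasure n)) (hψ : Continuous ψ) :
    Integrable (fun θ => g θ * ψ θ) (surfaceMeasure n) := by
  obtain ⟨M, _, hM⟩ := exists_bound_of_continuous hψ
  exact hg.mul_bdd hψ.aestronglyMeasurable (ae_of_all _ hM)

theorem IsWeakSphereGrad.lin {n : ℕ} {a : ℝ} (ha : a < 1) {c c' : Sph n → ℝ} {G G' : Sph n → Amb n}
    (h : IsWeakSphereGrad a c G) (h' : IsWeakSphereGrad a c' G')
    (hc : MemLp c 2 (sphereMeasure n a)) (hc' : MemLp c' 2 (sphereMeasure n a)) (k k' : ℝ) :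
    IsWeakSphereGrad a (fun θ => k * c θ + k' * c' θ) (fun θ => k • G θ + k' • G' θ) := by
  refine ⟨(h.1.const_smul k).add (h'.1.const_smul k'), fun φ hφ e => ?_⟩
  have i1 := MemLp.integrable_surface ha hc
  have i2 := MemLp.integrable_surface ha hc'
  have i3 : Integrable (fun θ => inner ℝ (G θ) e) (surfaceMeasure n) :=
    (MemLp.integrable_surface ha h.1).inner_const e
  have i4 : Integrable (fun θ => inner ℝ (G' θ) e) (surfaceMeasure n) :=
    (MemLp.integrable_surface ha h'.1).inner_const e
  have hT := continuous_testDiv hφ e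
  have hφc : Continuous fun θ : Sph n => φ θ := hφ.continuous.comp continuous_subtype_val
  have e1 := h.2 φ hφ e
  have e2 := h'.2 φ hφ e
  have j1 := (integrable_mul_continuous i1 hT).const_mul k
  have j2 := (integrable_mul_continuous i2 hT).const_mul k'
  have j3 := (integrable_mul_continuous i3 hφc).const_mul k
  have j4 := (integrable_mul_continuous i4 hφc).const_mul k'
  calc _ = ∫ θ : Sph n, (k * (c θ * testDiv φ e θ) + k' * (c' θ * testDiv φ e θ))
        ∂(surfaceMeasure n) := by
        congr 1; ext θ; rw [testDiv]; ring
    _ = -∫ θ : Sph n, (k * (inner ℝ (G θ) e * φ θ) + k' * (inner ℝ (G' θ) e * φ θ))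
        ∂(surfaceMeasure n) := by
        rw [integral_add j1 j2, integral_add j3 j4, integral_const_mul, integral_const_mul,
          integral_const_mul, integral_const_mul]
        unfold testDiv
        rw [e1, e2]; ring
    _ = _ := by
        congr 2; ext θ
        rw [inner_add_left, real_inner_smul_left, real_inner_smul_left]; ring

/-- The graph of the weak tangential gradient. -/
noncomputable def sphH1 (n : ℕ) {a : ℝ} (ha : a < 1) : Submodule ℝ (SphL2 n a × SphField n a) where
  carrier := {p | IsWeakSphereGrad a p.1 p.2}
  zero_mem' := by
    have h0 : IsWeakSphereGrad (n := n) a (fun _ => 0) fun _ => 0 := by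
      refine ⟨MemLp.zero', fun φ _ e => ?_⟩
      simp
    exact h0.congr (Lp.coeFn_zero ℝ 2 (sphereMeasure n a)).symm
      (Lp.coeFn_zero (Amb n) 2 (sphereMeasure n a)).symm
  add_mem' := by
    intro p q hp hq
    refine (hp.lin ha hq (Lp.memLp _) (Lp.memLp _) 1 1).congr ?_ ?_
    · filter_upwards [Lp.coeFn_add p.1 q.1] with θ hθ
      rw [Prod.fst_add, hθ]; simp
    · filter_upwards [Lp.coeFn_add p.2 q.2] with θ hθ
      rw [Prod.snd_add, hθ]; simp
  smul_mem' := by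
    intro k p hp
    refine (hp.lin ha hp (Lp.memLp _) (Lp.memLp _) k 0).congr ?_ ?_
    · filter_upwards [Lp.coeFn_smul k p.1] with θ hθ
      rw [Prod.smul_fst, hθ]; simp
    · filter_upwards [Lp.coeFn_smul k p.2] with θ hθ
      rw [Prod.smul_snd, hθ]; simp

theorem toLp_mem_sphH1 {n : ℕ} {a : ℝ} (ha : a < 1) {c : Sph n → ℝ} {G : Sph n → Amb n}
    (hc : MemLp c 2 (sphereMeasure n a)) (h : IsWeakSphereGrad a c G) :
    (hc.toLp c, h.1.toLp G) ∈ sphH1 n ha :=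
  h.congr hc.coeFn_toLp.symm h.1.coeFn_toLp.symm

/-- Integration by parts of a ridge function, tangential form. -/
theorem IsRidge.integral_inner_tangentPart {n : ℕ} {a : ℝ} {e : Amb n} {d : ℝ}
    {p pt py q : Amb n → ℝ} (h : IsRidge a e d p pt py q) {g : Sph n → ℝ} {G : Sph n → Amb n}
    (ha : a < 1) (hg : MemLp g 2 (sphereMeasure n a)) (hG : IsWeakSphereGrad a g G)
    (hp : MemLp (fun θ : Sph n => p θ) 2 (sphereMeasure n a))
    (hq : MemLp (fun θ : Sph n => q θ) 2 (sphereMeasure n a))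
    (hV : MemLp (fun θ : Sph n => tangentPart (ridgeGrad e pt py (θ : Amb n)) θ) 2
      (sphereMeasure n a))
    {w : Sph n → ℝ} (hw : Integrable w (surfaceMeasure n))
    (hgw : ∀ᵐ θ : Sph n ∂(surfaceMeasure n),
      |g θ| * |yCoord (θ : Amb n)| ^ a * |py θ| ≤ |yCoord (θ : Amb n)| * w θ) :
    ∫ θ, inner ℝ (tangentPart (ridgeGrad e pt py (θ : Amb n)) θ) (G θ) ∂(sphereMeasure n a) =
      ∫ θ, q θ * g θ ∂(sphereMeasure n a) := by
  have htan : ∀ᵐ θ : Sph n ∂(sphereMeasure n a),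
      inner ℝ (tangentPart (ridgeGrad e pt py (θ : Amb n)) θ) (G θ) =
        inner ℝ (G θ) (pt θ • e + py θ • yDir n) := by
    rw [ae_sphereMeasure_iff]
    filter_upwards [hG.tangential ha hg] with θ hθ
    rw [tangentPart, inner_sub_left, real_inner_smul_left, real_inner_comm (G θ) (θ : Amb n), hθ,
      mul_zero, sub_zero, real_inner_comm]
    rfl
  rw [integral_congr_ae htan, h.integral_inner ha hg hG
    ((integrable_inner_of_memLp hV hG.1).congr htan) (integrable_mul_of_memLp hg hq)
    (integrable_mul_of_memLp hg hp) hw hgw]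
  congr 1; ext θ; ring

/-! ### Ridge monomials in the weighted space -/

theorem memLp_of_continuous {n : ℕ} {a : ℝ} (ha : -1 < a) {E : Type*} [NormedAddCommGroup E]
    [SecondCountableTopology E] {f : Sph n → E} (hf : Continuous f) :
    MemLp f 2 (sphereMeasure n a) := by
  have := isFiniteMeasure_sphereMeasure n ha
  obtain ⟨M, _, hM⟩ := exists_bound_of_continuous hf
  exact MemLp.of_bound hf.aestronglyMeasurable M (ae_of_all _ hM)

theorem memLp_ridgeMon {n : ℕ} {a : ℝ} (ha : -1 < a) (e : Amb n) (j l : ℕ) :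
    MemLp (fun θ : Sph n => ridgeMon e j l (θ : Amb n)) 2 (sphereMeasure n a) :=
  memLp_of_continuous ha ((contDiff_ridgeMon e j l).continuous.comp continuous_subtype_val)

/-- The ridge monomial `⟨X, e⟩^j y^(2 k)` as an element of the weighted `L²` space. -/
noncomputable def monL2 {n : ℕ} {a : ℝ} (ha : -1 < a) (e : Amb n) (j k : ℕ) : SphL2 n a :=
  (memLp_ridgeMon ha e j (2 * k)).toLp _

/-- Integration by parts without boundary term: the y-derivative of y^(2k) carries a factor y, or
vanishes if k = 0. The truncated indices j - 2 and k - 1 are harmless because their coefficients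
vanish when truncation occurs. -/
theorem exists_monL2_grad {n : ℕ} (hn : 1 ≤ n) {a : ℝ} (ha0 : -1 < a) (ha1 : a < 1) {e : Amb n}
    (he : yCoord e = 0) (j k : ℕ) :
    ∃ G : SphField n a, (monL2 ha0 e j k, G) ∈ sphH1 n ha1 ∧
      ∀ p ∈ sphH1 n ha1, inner ℝ G p.2 =
        inner ℝ ((((j : ℝ) + 2 * k) * (j + 2 * k + n + a - 1)) • monL2 ha0 e j k -
        ((‖e‖ ^ 2 * j * (j - 1)) • monL2 ha0 e (j - 2) k +
          (2 * k * (2 * k - 1 + a)) • monL2 ha0 e j (k - 1))) p.1 := by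
  have hr := isRidge_ridgeMon a he j k
  have hgrad : ∀ X v, fderiv ℝ (ridgeMon e j (2 * k)) X v =
      inner ℝ (ridgeGrad e (fun X => j * ridgeMon e (j - 1) (2 * k) X)
        (fun X => (2 * k : ℕ) * ridgeMon e j (2 * k - 1) X) X) v := by
    intro X v
    rw [fderiv_ridgeMon, inner_ridgeGrad]
  have hVc : Continuous (ridgeGrad e (fun X => j * ridgeMon e (j - 1) (2 * k) X)
        (fun X => (2 * k : ℕ) * ridgeMon e j (2 * k - 1) X)) := by
    have h1 := (contDiff_ridgeMon e (j - 1) (2 * k)).continuous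
    have h2 := (contDiff_ridgeMon e j (2 * k - 1)).continuous
    unfold ridgeGrad; fun_prop
  have hw := isWeakSphereGrad_of_contDiff hn ha0 (contDiff_ridgeMon e j (2 * k)) hVc hgrad
  refine ⟨hw.1.toLp _, toLp_mem_sphH1 ha1 (memLp_ridgeMon ha0 e j (2 * k)) hw, ?_⟩
  rintro ⟨g, G⟩ hp
  have hp' : IsWeakSphereGrad a g G := hp
  have hqc : Continuous fun X => ((j : ℝ) + 2 * k) * (j + 2 * k + n + a - 1) *
      ridgeMon e j (2 * k) X - (‖e‖ ^ 2 * j * (j - 1) * ridgeMon e (j - 2) (2 * k) X +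
          2 * k * (2 * k - 1 + a) * ridgeMon e j (2 * k - 2) X) := by
    have h1 := (contDiff_ridgeMon e j (2 * k)).continuous
    have h2 := (contDiff_ridgeMon e (j - 2) (2 * k)).continuous
    have h3 := (contDiff_ridgeMon e j (2 * k - 2)).continuous
    fun_prop
  have hqm := memLp_of_continuous ha0 (hqc.comp (continuous_subtype_val (p := (· ∈ Metric.sphere
    (0 : Amb n) 1))))
  have hfin := isFiniteMeasure_sphereMeasure n ha0
  have hgi : Integrable (fun θ : Sph n => |yCoord (θ : Amb n)| ^ a * |g θ|) (surfaceMeasure n) := by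
    have := ((Lp.memLp g).integrable (by norm_num)).norm
    rw [integrable_sphereMeasure_iff] at this
    exact this
  have key := hr.integral_inner_tangentPart ha1 (Lp.memLp g) hp' (memLp_ridgeMon ha0 e j (2 * k))
    hqm hw.1 (w := fun θ => 2 * k * ‖e‖ ^ j * (|yCoord (θ : Amb n)| ^ a * |g θ|))
    (hgi.const_mul _) (by
      refine ae_of_all _ fun θ => ?_
      rcases k with _ | k
      · simp
      · simp only [ridgeMon, show 2 * (k + 1) - 1 = 2 * k + 1 by omega]
        have h1 : |inner ℝ (θ : Amb n) e| ≤ ‖e‖ := by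
          simpa [norm_sph] using abs_real_inner_le_norm (θ : Amb n) e
        have h2 := (abs_yCoord_le (θ : Amb n)).trans (norm_sph θ).le
        rw [abs_mul, abs_mul, abs_pow, abs_pow, pow_succ]
        have h3 : |yCoord (θ : Amb n)| ^ (2 * k) ≤ 1 := pow_le_one₀ (abs_nonneg _) h2
        have h4 : |((2 * (k + 1) : ℕ) : ℝ)| = 2 * ((k + 1 : ℕ) : ℝ) := by
          rw [abs_of_nonneg (by positivity)]; push_cast; ring
        rw [h4]
        calc |g θ| * |yCoord (θ : Amb n)| ^ a * (2 * ((k + 1 : ℕ) : ℝ) *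
              (|inner ℝ (θ : Amb n) e| ^ j * (|yCoord (θ : Amb n)| ^ (2 * k) * |yCoord (θ : Amb n)|)))
            ≤ |g θ| * |yCoord (θ : Amb n)| ^ a * (2 * ((k + 1 : ℕ) : ℝ) *
              (‖e‖ ^ j * (1 * |yCoord (θ : Amb n)|))) := by gcongr
          _ = _ := by ring)
  have hk : ∀ X : Amb n, 2 * (k : ℝ) * (2 * k - 1 + a) * ridgeMon e j (2 * k - 2) X =
      2 * k * (2 * k - 1 + a) * ridgeMon e j (2 * (k - 1)) X := by
    intro X
    rw [show 2 * k - 2 = 2 * (k - 1) by omega]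
  have hL : inner ℝ (hw.1.toLp _) G = ∫ θ, inner ℝ (tangentPart (ridgeGrad e
      (fun X => j * ridgeMon e (j - 1) (2 * k) X)
      (fun X => (2 * k : ℕ) * ridgeMon e j (2 * k - 1) X) (θ : Amb n)) θ) (G θ)
      ∂(sphereMeasure n a) := by
    rw [L2.inner_def]
    apply integral_congr_ae
    filter_upwards [hw.1.coeFn_toLp] with θ hθ
    rw [hθ]
  simp only
  rw [hL, key, L2.inner_def]
  apply integral_congr_ae
  filter_upwards [Lp.coeFn_sub ((((j : ℝ) + 2 * k) * (j + 2 * k + n + a - 1)) • monL2 ha0 e j k)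
    ((‖e‖ ^ 2 * j * (j - 1)) • monL2 ha0 e (j - 2) k +
          (2 * k * (2 * k - 1 + a)) • monL2 ha0 e j (k - 1)),
    Lp.coeFn_add ((‖e‖ ^ 2 * j * (j - 1)) • monL2 ha0 e (j - 2) k)
          ((2 * k * (2 * k - 1 + a)) • monL2 ha0 e j (k - 1)),
    Lp.coeFn_smul (((j : ℝ) + 2 * k) * (j + 2 * k + n + a - 1)) (monL2 ha0 e j k),
    Lp.coeFn_smul (‖e‖ ^ 2 * j * (j - 1)) (monL2 ha0 e (j - 2) k),
    Lp.coeFn_smul (2 * k * (2 * k - 1 + a)) (monL2 ha0 e j (k - 1)),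
    (memLp_ridgeMon ha0 e j (2 * k)).coeFn_toLp, (memLp_ridgeMon ha0 e (j - 2) (2 * k)).coeFn_toLp,
    (memLp_ridgeMon ha0 e j (2 * (k - 1))).coeFn_toLp] with θ h1 h2 h3 h4 h5 h6 h7 h8
  have h6' : (monL2 ha0 e j k) θ = ridgeMon e j (2 * k) (θ : Amb n) := h6
  have h7' : (monL2 ha0 e (j - 2) k) θ = ridgeMon e (j - 2) (2 * k) (θ : Amb n) := h7
  have h8' : (monL2 ha0 e j (k - 1)) θ = ridgeMon e j (2 * (k - 1)) (θ : Amb n) := h8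
  rw [h1, Pi.sub_apply, h2, Pi.add_apply, h3, h4, h5, Pi.smul_apply, Pi.smul_apply, Pi.smul_apply,
    h6', h7', h8', hk]
  simp only [smul_eq_mul, RCLike.inner_apply, conj_trivial]
  ring

/-! ### A filtered spectral gap -/

section Abstract

variable {H F : Type*} [NormedAddCommGroup H] [InnerProductSpace ℝ H] [NormedAddCommGroup F]
  [InnerProductSpace ℝ F] {S : Submodule ℝ (H × F)}

/-- `q` represents the form `r ↦ ⟨G, r.2⟩` on the graph `S`, at the point `(p, G)` of `S`. -/
def IsRepr (S : Submodule ℝ (H × F)) (p : H) (G : F) (q : H) : Prop :=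
  (p, G) ∈ S ∧ ∀ g K, (g, K) ∈ S → inner ℝ G K = inner ℝ q g

theorem IsRepr.zero : IsRepr S 0 0 0 := ⟨S.zero_mem, fun g K _ => by simp⟩

theorem IsRepr.add {p p' q q' : H} {G G' : F} (h : IsRepr S p G q) (h' : IsRepr S p' G' q') :
    IsRepr S (p + p') (G + G') (q + q') :=
  ⟨S.add_mem h.1 h'.1, fun g K hr => by
    rw [inner_add_left, inner_add_left, h.2 g K hr, h'.2 g K hr]⟩

theorem IsRepr.smul {p q : H} {G : F} (h : IsRepr S p G q) (k : ℝ) :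
    IsRepr S (k • p) (k • G) (k • q) :=
  ⟨S.smul_mem k h.1, fun g K hr => by
    rw [real_inner_smul_left, real_inner_smul_left, h.2 g K hr]⟩

/-- Every element of `V'` is represented modulo `V` by its multiple with factor `l`. -/
def IsReprStep (S : Submodule ℝ (H × F)) (V' V : Submodule ℝ H) (l : ℝ) : Prop :=
  ∀ p ∈ V', ∃ G q, IsRepr S p G q ∧ q - l • p ∈ V

theorem isReprStep_span {B : Set H} {V : Submodule ℝ H} {l : ℝ}
    (h : ∀ p ∈ B, ∃ G q, IsRepr S p G q ∧ q - l • p ∈ V) :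
    IsReprStep S (Submodule.span ℝ B) V l := by
  intro p hp
  induction hp using Submodule.span_induction with
  | mem f hf => exact h f hf
  | zero => exact ⟨0, 0, IsRepr.zero, by simp⟩
  | add p p' _ _ h h' =>
    obtain ⟨G, q, h1, h2⟩ := h
    obtain ⟨G', q', h1', h2'⟩ := h'
    refine ⟨G + G', q + q', h1.add h1', ?_⟩
    have := Submodule.add_mem _ h2 h2'
    rwa [sub_add_sub_comm, ← smul_add] at this
  | smul k p _ h =>
    obtain ⟨G, q, h1, h2⟩ := h
    refine ⟨k • G, k • q, h1.smul k, ?_⟩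
    have := Submodule.smul_mem _ k h2
    rwa [smul_sub, smul_comm] at this

theorem IsReprStep.exists_mem {V' V : Submodule ℝ H} {l : ℝ} (h : IsReprStep S V' V l)
    (hV : V ≤ V') {p : H} (hp : p ∈ V') : ∃ G q, IsRepr S p G q ∧ q ∈ V' := by
  obtain ⟨G, q, h1, h2⟩ := h p hp
  refine ⟨G, q, h1, ?_⟩
  have := Submodule.add_mem _ (hV h2) (Submodule.smul_mem _ l hp)
  rwa [sub_add_cancel] at this

theorem inner_sub_starProjection (V : Submodule ℝ H) [FiniteDimensional ℝ V] (p : H) {f : H}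
    (hf : f ∈ V) : inner ℝ f (p - V.starProjection p) = 0 :=
  (Submodule.mem_orthogonal V _).1 (Submodule.sub_starProjection_mem_orthogonal p) f hf

theorem norm_sq_eq_add_of_inner_eq_zero {E : Type*} [NormedAddCommGroup E] [InnerProductSpace ℝ E]
    {x y : E} (h : inner ℝ y (x - y) = 0) : ‖x‖ ^ 2 = ‖y‖ ^ 2 + ‖x - y‖ ^ 2 := by
  have : x = y + (x - y) := by abel
  conv_lhs => rw [this]
  rw [norm_add_sq_real, h]; ring

/-- Induction on the degree. Let p' be the projection of p to `V m`. The form at p' is represented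
by an element of `V m`, so the gradients of p' and p - p' are orthogonal; and p - p' behaves like an
eigenvector with value `lam (m + 1)`, because the lower-order remainder is orthogonal to it.
Orthogonality to `V 1` means that only values with index at least 2 enter. -/
theorem spectral_gap_filtration {V : ℕ → Submodule ℝ H} [∀ m, FiniteDimensional ℝ (V m)]
    (hmono : Monotone V) {lam : ℕ → ℝ} {l : ℝ} (hl : ∀ m, 1 ≤ m → l ≤ lam (m + 1))
    (hstep : ∀ m, IsReprStep S (V (m + 1)) (V m) (lam (m + 1))) {m : ℕ} (hm : 1 ≤ m) {p : H}
    (hp : p ∈ V m) (hp1 : ∀ f ∈ V 1, inner ℝ f p = 0) {G : F} (hG : (p, G) ∈ S) :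
    l * ‖p‖ ^ 2 ≤ ‖G‖ ^ 2 := by
  induction m, hm using Nat.le_induction generalizing p G with
  | base =>
    have := hp1 p hp
    rw [inner_self_eq_zero] at this
    rw [this, norm_zero]
    nlinarith [sq_nonneg ‖G‖]
  | succ m hm ih =>
    set p' : H := (V m).starProjection p with hp'
    have hp'V : p' ∈ V m := Submodule.starProjection_apply_mem _ p
    have hgV : ∀ f ∈ V m, inner ℝ f (p - p') = 0 := fun f hf => inner_sub_starProjection _ p hf
    have h1V : V 1 ≤ V m := hmono hm
    -- Since m ≥ 1, `V m` is itself the upper space of a step, hence it contains representatives for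
    -- its own elements.
    obtain ⟨G', q', hG', hq'⟩ : ∃ G q, IsRepr S p' G q ∧ q ∈ V m := by
      obtain ⟨k, rfl⟩ := Nat.exists_eq_add_of_le' hm
      exact (hstep k).exists_mem (hmono (Nat.le_succ k)) hp'V
    have hIH := ih hp'V (fun f hf => by
      have := hgV f (h1V hf)
      rw [inner_sub_right, hp1 f hf] at this
      linarith) hG'.1
    have hgm : p - p' ∈ V (m + 1) :=
      Submodule.sub_mem _ hp (hmono (Nat.le_succ m) hp'V)
    obtain ⟨Gg, qg, hGg, hqg⟩ := hstep m _ hgm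
    have hΓ : (p - p', G - G') ∈ S := S.sub_mem hG hG'.1
    have e0 : inner ℝ G' (G - G') = 0 := by
      rw [hG'.2 _ _ hΓ]; exact hgV q' hq'
    have eq : inner ℝ qg (p - p') = lam (m + 1) * ‖p - p'‖ ^ 2 := by
      have := hgV _ hqg
      rw [inner_sub_left, real_inner_smul_left, real_inner_self_eq_norm_sq] at this
      linarith
    have e1 : inner ℝ Gg (G - G') = lam (m + 1) * ‖p - p'‖ ^ 2 := (hGg.2 _ _ hΓ).trans eq
    have e2 : ‖Gg‖ ^ 2 = lam (m + 1) * ‖p - p'‖ ^ 2 := by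
      rw [← real_inner_self_eq_norm_sq]; exact (hGg.2 _ _ hGg.1).trans eq
    -- `G - G'` and `Gg` both lie over p - p'. No uniqueness of gradients is needed: expanding this
    -- square gives ‖Gg‖² ≤ ‖G - G'‖².
    have e3 : 0 ≤ ‖G - G' - Gg‖ ^ 2 := by positivity
    rw [norm_sub_sq_real, real_inner_comm, e1, e2] at e3
    rw [norm_sq_eq_add_of_inner_eq_zero e0, norm_sq_eq_add_of_inner_eq_zero (hgV p' hp'V)]
    have e6 := mul_le_mul_of_nonneg_right (hl m hm) (sq_nonneg ‖p - p'‖)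
    linarith

/-- The gap passes to the closure of the filtration. -/
theorem spectral_gap_approx {V : ℕ → Submodule ℝ H} [∀ m, FiniteDimensional ℝ (V m)]
    (hmono : Monotone V) {lam : ℕ → ℝ} {l : ℝ} (hl0 : 0 ≤ l) (hl : ∀ m, 1 ≤ m → l ≤ lam (m + 1))
    (hstep : ∀ m, IsReprStep S (V (m + 1)) (V m) (lam (m + 1))) {m : ℕ} {p p₀ : H}
    (hp₀ : p₀ ∈ V m) (hp1 : ∀ f ∈ V 1, inner ℝ f p = 0) {G : F} (hG : (p, G) ∈ S) {ε : ℝ}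
    (hε : ‖p - p₀‖ ≤ ε) :
    l * (‖p‖ ^ 2 - ε ^ 2) ≤ ‖G‖ ^ 2 := by
  -- Raising the index by one guarantees that it is at least 1, as required by the gap and by the
  -- existence of representatives.
  replace hp₀ := hmono (Nat.le_succ m) hp₀
  set p' : H := (V (m + 1)).starProjection p with hp'
  have hp'V : p' ∈ V (m + 1) := Submodule.starProjection_apply_mem _ p
  have hgV : ∀ f ∈ V (m + 1), inner ℝ f (p - p') = 0 := fun f hf =>
    inner_sub_starProjection _ p hf
  have h1V : V 1 ≤ V (m + 1) := hmono (by omega)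
  obtain ⟨G', q', hG', hq'⟩ := (hstep m).exists_mem (hmono (Nat.le_succ m)) hp'V
  have hgap := spectral_gap_filtration hmono hl hstep (by omega) hp'V (fun f hf => by
    have := hgV f (h1V hf)
    rw [inner_sub_right, hp1 f hf] at this
    linarith) hG'.1
  have hΓ : (p - p', G - G') ∈ S := S.sub_mem hG hG'.1
  have e0 : inner ℝ G' (G - G') = 0 := by
    rw [hG'.2 _ _ hΓ]; exact hgV q' hq'
  have e4 := norm_sq_eq_add_of_inner_eq_zero e0
  have e5 := norm_sq_eq_add_of_inner_eq_zero (hgV p' hp'V)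
  -- The projection is the nearest point of the space, so p' is at least as close to p as p₀ is, and
  -- replacing p by p' loses at most ε² in the squared norm.
  have e6 : ‖p - p₀‖ ^ 2 = ‖p - p'‖ ^ 2 + ‖p' - p₀‖ ^ 2 := by
    have : p - p₀ = (p - p') + (p' - p₀) := by abel
    rw [this, norm_add_sq_real, real_inner_comm, hgV _ (Submodule.sub_mem _ hp'V hp₀)]; ring
  have e7 : ‖p - p₀‖ ^ 2 ≤ ε ^ 2 := by gcongr
  have e8 : ‖p‖ ^ 2 - ε ^ 2 ≤ ‖p'‖ ^ 2 := by nlinarith [sq_nonneg ‖p' - p₀‖]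
  calc _ ≤ l * ‖p'‖ ^ 2 := by gcongr
    _ ≤ ‖G'‖ ^ 2 := hgap
    _ ≤ _ := by rw [e4]; nlinarith [sq_nonneg ‖G - G'‖]

end Abstract

/-! ### The spectral gap -/

/-- The eigenvalue attached to the homogeneity `d`. -/
noncomputable def sphEig (n : ℕ) (a d : ℝ) : ℝ := d * (d + n + a - 1)

theorem sphEig_two_le {n : ℕ} (hn : 1 ≤ n) {a d : ℝ} (ha : -1 < a) (hd : 2 ≤ d) :
    sphEig n a 2 ≤ sphEig n a d := by
  have : (1 : ℝ) ≤ n := by exact_mod_cast hn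
  unfold sphEig
  nlinarith

/-- The span of the ridge monomials with directions in `E` and degree at most `m`. -/
noncomputable def monSpan {n : ℕ} {a : ℝ} (ha : -1 < a) (E : Finset (Amb n)) (m : ℕ) :
    Submodule ℝ (SphL2 n a) :=
  Submodule.span ℝ {f | ∃ e ∈ E, ∃ j k : ℕ, j + 2 * k ≤ m ∧ f = monL2 ha e j k}

theorem monSpan_mono {n : ℕ} {a : ℝ} (ha : -1 < a) {E E' : Finset (Amb n)} (hE : E ⊆ E')
    {m m' : ℕ} (hm : m ≤ m') : monSpan ha E m ≤ monSpan ha E' m' := by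
  apply Submodule.span_mono
  rintro f ⟨e, he, j, k, hjk, rfl⟩
  exact ⟨e, hE he, j, k, hjk.trans hm, rfl⟩

instance finiteDimensional_monSpan {n : ℕ} {a : ℝ} (ha : -1 < a) (E : Finset (Amb n)) (m : ℕ) :
    FiniteDimensional ℝ (monSpan ha E m) := by
  apply FiniteDimensional.span_of_finite
  have : {f | ∃ e ∈ E, ∃ j k : ℕ, j + 2 * k ≤ m ∧ f = monL2 ha e j k} ⊆
      (fun x : Amb n × ℕ × ℕ => monL2 ha x.1 x.2.1 x.2.2) ''
        ((E ×ˢ (Finset.range (m + 1) ×ˢ Finset.range (m + 1)) : Finset _) : Set _) := by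
    rintro f ⟨e, he, j, k, hjk, rfl⟩
    refine ⟨(e, j, k), ?_, rfl⟩
    simp only [Finset.coe_product, Set.mem_prod, Finset.mem_coe, Finset.mem_range]
    exact ⟨he, by omega, by omega⟩
  exact (Set.Finite.image _ (Finset.finite_toSet _)).subset this

/-- For a monomial of top degree m+1 the coefficient (j+2k)(j+2k+n+a-1) is exactly the eigenvalue,
and what remains has degree m-1. For a monomial of lower degree every term already lies in the
smaller span. -/
theorem isReprStep_monSpan {n : ℕ} (hn : 1 ≤ n) {a : ℝ} (ha0 : -1 < a) (ha1 : a < 1)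
    {E : Finset (Amb n)} (hE : ∀ e ∈ E, yCoord e = 0) (m : ℕ) :
    IsReprStep (sphH1 n ha1) (monSpan ha0 E (m + 1)) (monSpan ha0 E m)
      (sphEig n a ((m + 1 : ℕ) : ℝ)) := by
  apply isReprStep_span
  rintro f ⟨e, he, j, k, hjk, rfl⟩
  obtain ⟨G, hG, h⟩ := exists_monL2_grad hn ha0 ha1 (hE e he) j k
  refine ⟨G, _, ⟨hG, fun g K hr => h (g, K) hr⟩, ?_⟩
  have h1 : (‖e‖ ^ 2 * j * (j - 1)) • monL2 ha0 e (j - 2) k ∈ monSpan ha0 E m := by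
    rcases Nat.lt_or_ge j 2 with hj | hj
    · have : ‖e‖ ^ 2 * (j : ℝ) * ((j : ℝ) - 1) = 0 := by interval_cases j <;> simp
      rw [this, zero_smul]
      exact Submodule.zero_mem _
    · exact Submodule.smul_mem _ _ (Submodule.subset_span ⟨e, he, _, _, by omega, rfl⟩)
  have h2 : (2 * (k : ℝ) * (2 * k - 1 + a)) • monL2 ha0 e j (k - 1) ∈ monSpan ha0 E m := by
    rcases Nat.eq_zero_or_pos k with hk | hk
    · have : 2 * (k : ℝ) * (2 * k - 1 + a) = 0 := by simp [hk]
      rw [this, zero_smul]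
      exact Submodule.zero_mem _
    · exact Submodule.smul_mem _ _ (Submodule.subset_span ⟨e, he, _, _, by omega, rfl⟩)
  have h3 : (((j : ℝ) + 2 * k) * (j + 2 * k + n + a - 1) - sphEig n a ((m + 1 : ℕ) : ℝ)) •
      monL2 ha0 e j k ∈ monSpan ha0 E m := by
    rcases Nat.lt_or_ge m (j + 2 * k) with hj | hj
    · have : j + 2 * k = m + 1 := by omega
      have : (j : ℝ) + 2 * k = (m + 1 : ℕ) := by exact_mod_cast this
      rw [this, sphEig, sub_self, zero_smul]
      exact Submodule.zero_mem _
    · exact Submodule.smul_mem _ _ (Submodule.subset_span ⟨e, he, _, _, hj, rfl⟩)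
  have h4 := Submodule.sub_mem _ h3 (Submodule.add_mem _ h1 h2)
  rw [sub_smul, sub_right_comm] at h4
  exact h4

/-- The span of all ridge monomials with horizontal directions. -/
noncomputable def evenSpan {n : ℕ} {a : ℝ} (ha : -1 < a) : Submodule ℝ (SphL2 n a) :=
  Submodule.span ℝ {f | ∃ e : Amb n, yCoord e = 0 ∧ ∃ j k : ℕ, f = monL2 ha e j k}

/-- A single element involves finitely many directions and degrees. Fixing a finite set of
directions keeps the filtration finite-dimensional, so that orthogonal projections exist. -/
theorem exists_monSpan_of_mem_evenSpan {n : ℕ} {a : ℝ} (ha : -1 < a) {p : SphL2 n a}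
    (hp : p ∈ evenSpan ha) :
    ∃ E : Finset (Amb n), (∀ e ∈ E, yCoord e = 0) ∧ ∃ m, p ∈ monSpan ha E m := by
  classical
  induction hp using Submodule.span_induction with
  | mem f hf =>
    obtain ⟨e, he, j, k, rfl⟩ := hf
    refine ⟨{e}, by simpa using he, j + 2 * k, Submodule.subset_span ⟨e, by simp, j, k, le_rfl, rfl⟩⟩
  | zero => exact ⟨∅, by simp, 0, Submodule.zero_mem _⟩
  | add p p' _ _ h h' =>
    obtain ⟨E, hE, m, h⟩ := h
    obtain ⟨E', hE', m', h'⟩ := h'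
    refine ⟨E ∪ E', ?_, max m m', Submodule.add_mem _
      (monSpan_mono ha Finset.subset_union_left (le_max_left _ _) h)
      (monSpan_mono ha Finset.subset_union_right (le_max_right _ _) h')⟩
    intro e he
    rcases Finset.mem_union.1 he with he | he
    exacts [hE e he, hE' e he]
  | smul k p _ h =>
    obtain ⟨E, hE, m, h⟩ := h
    exact ⟨E, hE, m, Submodule.smul_mem _ k h⟩

/-- The coordinate y occurs only in even powers, so degree at most one leaves the constants and the
horizontal linear functions. -/
theorem inner_monSpan_one_eq_zero {n : ℕ} {a : ℝ} (ha0 : -1 < a) {p : SphL2 n a}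
    (hp0 : inner ℝ (monL2 ha0 (0 : Amb n) 0 0) p = 0)
    (hp1 : ∀ e : Amb n, yCoord e = 0 → inner ℝ (monL2 ha0 e 1 0) p = 0)
    {E : Finset (Amb n)} (hE : ∀ e ∈ E, yCoord e = 0) {f : SphL2 n a} (hf : f ∈ monSpan ha0 E 1) :
    inner ℝ f p = 0 := by
  induction hf using Submodule.span_induction with
  | mem f hf =>
    obtain ⟨e, he, j, k, hjk, rfl⟩ := hf
    have hk : k = 0 := by omega
    subst hk
    have hj : j = 0 ∨ j = 1 := by omega
    rcases hj with rfl | rfl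
    · have : monL2 ha0 e 0 0 = monL2 ha0 (0 : Amb n) 0 0 := by
        unfold monL2
        congr 1
      rw [this]; exact hp0
    · exact hp1 e (hE e he)
  | zero => exact inner_zero_left _
  | add f f' _ _ h h' => rw [inner_add_left, h, h', add_zero]
  | smul k f _ h => rw [real_inner_smul_left, h, mul_zero]

theorem spectral_gap_of_mem_closure {n : ℕ} (hn : 1 ≤ n) {a : ℝ} (ha0 : -1 < a) (ha1 : a < 1)
    {p : SphL2 n a} (hp : p ∈ closure ((evenSpan ha0 : Submodule ℝ (SphL2 n a)) : Set (SphL2 n a)))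
    (hp0 : inner ℝ (monL2 ha0 (0 : Amb n) 0 0) p = 0)
    (hp1 : ∀ e : Amb n, yCoord e = 0 → inner ℝ (monL2 ha0 e 1 0) p = 0)
    {G : SphField n a} (hG : (p, G) ∈ sphH1 n ha1) :
    sphEig n a 2 * ‖p‖ ^ 2 ≤ ‖G‖ ^ 2 := by
  have hl : 0 ≤ sphEig n a 2 := by
    have : (1 : ℝ) ≤ n := by exact_mod_cast hn
    unfold sphEig; nlinarith
  have main : ∀ ε > 0, sphEig n a 2 * (‖p‖ ^ 2 - ε ^ 2) ≤ ‖G‖ ^ 2 := by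
    intro ε hε
    obtain ⟨p₀, hp₀, hd⟩ := Metric.mem_closure_iff.1 hp ε hε
    obtain ⟨E, hE, m, hm⟩ := exists_monSpan_of_mem_evenSpan ha0 hp₀
    refine spectral_gap_approx (S := sphH1 n ha1) (V := monSpan ha0 E)
      (lam := fun m => sphEig n a (m : ℝ)) (fun m m' h => monSpan_mono ha0 (subset_refl E) h) hl
      (fun m hm => sphEig_two_le hn ha0 ?_) (isReprStep_monSpan hn ha0 ha1 hE) hm
      (fun f hf => inner_monSpan_one_eq_zero ha0 hp0 hp1 hE hf) hG ?_
    · have : (1 : ℝ) ≤ m := by exact_mod_cast hm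
      push_cast; linarith
    · rw [dist_eq_norm] at hd
      exact hd.le
  have ht : Tendsto (fun ε : ℝ => sphEig n a 2 * (‖p‖ ^ 2 - ε ^ 2)) (𝓝[>] 0)
      (𝓝 (sphEig n a 2 * (‖p‖ ^ 2 - 0 ^ 2))) := by
    apply Tendsto.mono_left _ nhdsWithin_le_nhds
    apply Continuous.tendsto; fun_prop
  have := le_of_tendsto ht (by filter_upwards [self_mem_nhdsWithin] with ε hε using main ε hε)
  simpa using this

/-! ### Reflections -/

/-- The reflection `X ↦ X - 2 ⟨v, X⟩ v`. -/
noncomputable def mirror {n : ℕ} (v : Amb n) : Amb n ≃ₗᵢ[ℝ] Amb n := (ℝ ∙ v)ᗮ.reflection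

theorem mirror_apply {n : ℕ} {v : Amb n} (hv : ‖v‖ = 1) (X : Amb n) :
    mirror v X = X - (2 * inner ℝ X v) • v := by
  rw [mirror, Submodule.reflection_orthogonal_apply, Submodule.reflection_singleton_apply, hv,
    real_inner_comm]
  simp only [RCLike.ofReal_real_eq_id, id, one_pow, div_one, two_smul, two_mul, add_smul]
  abel

theorem inner_mirror {n : ℕ} {v : Amb n} (hv : ‖v‖ = 1) (X w : Amb n) :
    inner ℝ (mirror v X) w = inner ℝ X w - 2 * inner ℝ X v * inner ℝ v w := by
  rw [mirror_apply hv, inner_sub_left, real_inner_smul_left]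

theorem inner_mirror_self {n : ℕ} {v : Amb n} (hv : ‖v‖ = 1) (X : Amb n) :
    inner ℝ (mirror v X) v = -inner ℝ X v := by
  rw [inner_mirror hv, real_inner_self_eq_norm_sq, hv]; ring

theorem inner_mirror_of_orthogonal {n : ℕ} {v w : Amb n} (hv : ‖v‖ = 1) (hw : inner ℝ v w = 0)
    (X : Amb n) : inner ℝ (mirror v X) w = inner ℝ X w := by
  rw [inner_mirror hv, hw, mul_zero, sub_zero]

theorem yCoord_mirror_horizontal {n : ℕ} {v : Amb n} (hv : ‖v‖ = 1) (hy : yCoord v = 0)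
    (X : Amb n) : yCoord (mirror v X) = yCoord X := by
  rw [← inner_yDir, ← inner_yDir, inner_mirror_of_orthogonal hv]
  rw [inner_yDir, hy]

theorem yCoord_mirror_yDir {n : ℕ} (X : Amb n) : yCoord (mirror (yDir n) X) = -yCoord X := by
  rw [← inner_yDir, inner_mirror_self (norm_yDir n), inner_yDir]

theorem reflectY_eq_mirror {n : ℕ} (X : Amb n) : reflectY X = mirror (yDir n) X := by
  rw [mirror_apply (norm_yDir n), inner_yDir]
  ext i
  rcases eq_or_ne i (Fin.last n) with rfl | hi
  · simp [reflectY, yDir, yCoord]; ring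
  · simp [reflectY, yDir, hi]

/-- The reflection `(x, y) ↦ (x, -y)` on the sphere. -/
noncomputable def sphFlip {n : ℕ} : Sph n → Sph n := sphMap (mirror (yDir n))

theorem measurePreserving_sphFlip {n : ℕ} (a : ℝ) :
    MeasurePreserving (sphFlip (n := n)) (sphereMeasure n a) (sphereMeasure n a) :=
  measurePreserving_sphMap_weighted a _ fun X => by rw [yCoord_mirror_yDir, abs_neg]

theorem yCoord_sphFlip {n : ℕ} (θ : Sph n) : yCoord (sphFlip θ : Amb n) = -yCoord (θ : Amb n) :=
  yCoord_mirror_yDir _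

theorem inner_sphFlip {n : ℕ} {e : Amb n} (he : yCoord e = 0) (θ : Sph n) :
    inner ℝ (sphFlip θ : Amb n) e = inner ℝ (θ : Amb n) e :=
  inner_mirror_of_orthogonal (norm_yDir n) (inner_dir_yDir he) _

theorem sphFlip_sphFlip {n : ℕ} (θ : Sph n) : sphFlip (sphFlip θ) = θ := by
  apply Subtype.ext
  exact Submodule.reflection_reflection _ _

theorem integral_comp_sphMap {n : ℕ} {a : ℝ} {R : Amb n ≃ₗᵢ[ℝ] Amb n}
    (hR : ∀ X, |yCoord (R X)| = |yCoord X|) {f : Sph n → ℝ}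
    (hf : AEStronglyMeasurable f (sphereMeasure n a)) :
    ∫ θ, f (sphMap R θ) ∂(sphereMeasure n a) = ∫ θ, f θ ∂(sphereMeasure n a) := by
  have h := measurePreserving_sphMap_weighted a R hR
  conv_rhs => rw [← h.map_eq]
  rw [integral_map h.measurable.aemeasurable (by rwa [h.map_eq])]

theorem integral_comp_sphFlip {n : ℕ} {a : ℝ} {f : Sph n → ℝ}
    (hf : AEStronglyMeasurable f (sphereMeasure n a)) :
    ∫ θ, f (sphFlip θ) ∂(sphereMeasure n a) = ∫ θ, f θ ∂(sphereMeasure n a) :=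
  integral_comp_sphMap (fun X => by rw [yCoord_mirror_yDir, abs_neg]) hf

/-! ### Density of the ridge monomials -/

/-- The function `exp ⟨θ, e⟩ y^l` on the sphere. -/
noncomputable def expMon {n : ℕ} (e : Amb n) (l : ℕ) : C(Sph n, ℝ) :=
  ⟨fun θ => Real.exp (inner ℝ (θ : Amb n) e) * yCoord (θ : Amb n) ^ l, by
    have := continuous_yCoord (n := n)
    fun_prop⟩

/-- The monoid of the functions `exp ⟨θ, e⟩ y^l` with `e` horizontal. -/
noncomputable def expMonoid (n : ℕ) : Submonoid C(Sph n, ℝ) where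
  carrier := {f | ∃ e l, yCoord e = 0 ∧ f = expMon e l}
  one_mem' := ⟨0, 0, by simp [yCoord], by ext θ; simp [expMon]⟩
  mul_mem' := by
    rintro _ _ ⟨e, l, he, rfl⟩ ⟨e', l', he', rfl⟩
    refine ⟨e + e', l + l', by simp only [yCoord] at he he' ⊢; simp [he, he'], ?_⟩
    ext θ
    simp only [expMon, ContinuousMap.coe_mul, ContinuousMap.coe_mk, Pi.mul_apply]
    rw [inner_add_right, Real.exp_add, pow_add]; ring

/-- Stone–Weierstrass. Exponentials are used because, unlike ridge monomials with different
directions, they are closed under products. Two points with different y are separated by y;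
otherwise θ - θ' is horizontal, and equal values of exp⟨·, θ - θ'⟩ would force ‖θ - θ'‖² = 0. -/
theorem expMonoid_adjoin_closure (n : ℕ) :
    (Algebra.adjoin ℝ (expMonoid n : Set C(Sph n, ℝ))).topologicalClosure = ⊤ := by
  apply ContinuousMap.subalgebra_topologicalClosure_eq_top_of_separatesPoints
  intro θ θ' hne
  by_cases hy : yCoord (θ : Amb n) = yCoord (θ' : Amb n)
  · have hh : yCoord ((θ : Amb n) - (θ' : Amb n)) = 0 := by
      simp only [yCoord] at hy ⊢; simp [hy]
    refine ⟨expMon ((θ : Amb n) - (θ' : Amb n)) 0, ⟨_, Algebra.subset_adjoin ⟨_, _, hh, rfl⟩, rfl⟩, ?_⟩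
    intro h
    simp only [expMon, ContinuousMap.coe_mk, pow_zero, mul_one] at h
    have h1 := Real.exp_injective h
    rw [← sub_eq_zero, ← inner_sub_left, inner_self_eq_zero, sub_eq_zero] at h1
    exact hne (Subtype.ext h1)
  · refine ⟨expMon 0 1, ⟨_, Algebra.subset_adjoin ⟨_, _, by simp [yCoord], rfl⟩, rfl⟩, ?_⟩
    intro h
    simp only [expMon, ContinuousMap.coe_mk, pow_one, inner_zero_right, Real.exp_zero, one_mul] at h
    exact hy h

theorem integrable_mul_continuousMap {n : ℕ} {a : ℝ} {g : Sph n → ℝ}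
    (hg : Integrable g (sphereMeasure n a)) (f : C(Sph n, ℝ)) :
    Integrable (fun θ => g θ * f θ) (sphereMeasure n a) :=
  hg.mul_bdd f.continuous.aestronglyMeasurable (ae_of_all _ f.norm_coe_le_norm)

theorem integral_mul_eq_zero_of_expMon {n : ℕ} {a : ℝ} {g : Sph n → ℝ}
    (hg : Integrable g (sphereMeasure n a))
    (h : ∀ e l, yCoord e = 0 → ∫ θ, g θ * expMon e l θ ∂(sphereMeasure n a) = 0)
    (f : C(Sph n, ℝ)) : ∫ θ, g θ * f θ ∂(sphereMeasure n a) = 0 := by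
  have hspan : ∀ f ∈ Algebra.adjoin ℝ (expMonoid n : Set C(Sph n, ℝ)),
      ∫ θ, g θ * f θ ∂(sphereMeasure n a) = 0 := by
    intro f hf
    rw [← Subalgebra.mem_toSubmodule, Algebra.adjoin_eq_span, Submonoid.closure_eq] at hf
    induction hf using Submodule.span_induction with
    | mem f hf =>
      obtain ⟨e, l, he, rfl⟩ := hf
      exact h e l he
    | zero => simp
    | add f f' _ _ h h' =>
      simp only [ContinuousMap.add_apply, mul_add]
      rw [integral_add (integrable_mul_continuousMap hg f) (integrable_mul_continuousMap hg f'), h,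
        h', add_zero]
    | smul k f _ h =>
      simp only [ContinuousMap.smul_apply, smul_eq_mul, mul_left_comm _ k]
      rw [integral_const_mul, h, mul_zero]
  have hf : f ∈ (Algebra.adjoin ℝ (expMonoid n : Set C(Sph n, ℝ))).topologicalClosure := by
    rw [expMonoid_adjoin_closure]; trivial
  have hf' : f ∈ closure ((Algebra.adjoin ℝ (expMonoid n : Set C(Sph n, ℝ)) : Subalgebra ℝ _) :
      Set C(Sph n, ℝ)) := hf
  have key : ∀ ε > 0, |∫ θ, g θ * f θ ∂(sphereMeasure n a)| ≤
      ε * ∫ θ, |g θ| ∂(sphereMeasure n a) := by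
    intro ε hε
    obtain ⟨f', hf', hd⟩ := Metric.mem_closure_iff.1 hf' ε hε
    have e1 : ∫ θ, g θ * f θ ∂(sphereMeasure n a) =
        ∫ θ, g θ * (f - f') θ ∂(sphereMeasure n a) := by
      simp only [ContinuousMap.sub_apply, mul_sub]
      rw [integral_sub (integrable_mul_continuousMap hg f) (integrable_mul_continuousMap hg f'),
        hspan f' hf', sub_zero]
    rw [e1, ← integral_const_mul]
    refine (abs_integral_le_integral_abs).trans (integral_mono
      (integrable_mul_continuousMap hg (f - f')).abs (hg.abs.const_mul ε) fun θ => ?_)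
    simp only [abs_mul]
    rw [mul_comm]
    rw [dist_eq_norm] at hd
    gcongr
    exact ((f - f').norm_coe_le_norm θ).trans hd.le
  have ht : Tendsto (fun ε : ℝ => ε * ∫ θ, |g θ| ∂(sphereMeasure n a)) (𝓝[>] 0)
      (𝓝 (0 * ∫ θ, |g θ| ∂(sphereMeasure n a))) :=
    Tendsto.mono_left (Continuous.tendsto (by fun_prop) _) nhdsWithin_le_nhds
  have := ge_of_tendsto ht (by filter_upwards [self_mem_nhdsWithin] with ε hε using key ε hε)
  rw [zero_mul] at this
  exact abs_nonpos_iff.1 this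

theorem ae_eq_zero_of_integral_mul_continuousMap {n : ℕ} {a : ℝ} {g : Sph n → ℝ}
    (hg : Integrable g (sphereMeasure n a))
    (h : ∀ f : C(Sph n, ℝ), ∫ θ, g θ * f θ ∂(sphereMeasure n a) = 0) :
    g =ᵐ[sphereMeasure n a] 0 := by
  have hi := (integrable_sphereMeasure_iff a).1 hg
  have h0 := ae_eq_zero_of_integral_mul_contDiff hi (fun φ hφ => by
    have := h ⟨fun θ => φ θ, hφ.continuous.comp continuous_subtype_val⟩
    rw [integral_sphereMeasure] at this
    simp only [ContinuousMap.coe_mk, smul_eq_mul] at this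
    rw [← this]
    congr 1; ext θ; simp only [smul_eq_mul]; ring)
  rw [Filter.EventuallyEq, ae_sphereMeasure_iff]
  filter_upwards [h0, ae_sphere_yCoord_ne n] with θ h1 h2
  simp only [smul_eq_mul, mul_eq_zero] at h1
  rcases h1 with h1 | h1
  · exact absurd h1 (Real.rpow_pos_of_pos (abs_pos.2 h2) a).ne'
  · exact h1

/-- For even l the exponential is expanded into ridge monomials, with termwise integration justified
by the majorant ‖e‖^j / j!. For odd l the integrand is odd under y ↦ -y. -/
theorem integral_mul_expMon_eq_zero {n : ℕ} {a : ℝ} {g : Sph n → ℝ}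
    (hg : Integrable g (sphereMeasure n a)) (heven : ∀ᵐ θ ∂(sphereMeasure n a), g (sphFlip θ) = g θ)
    {e : Amb n} (he : yCoord e = 0)
    (h : ∀ j k, ∫ θ : Sph n, g θ * ridgeMon e j (2 * k) (θ : Amb n) ∂(sphereMeasure n a) = 0)
    (l : ℕ) : ∫ θ, g θ * expMon e l θ ∂(sphereMeasure n a) = 0 := by
  rcases Nat.even_or_odd' l with ⟨k, rfl | rfl⟩
  · have hb : ∀ j, Integrable (fun θ : Sph n =>
        g θ * (((j.factorial : ℝ)⁻¹ • ridgeMon e j (2 * k) (θ : Amb n)))) (sphereMeasure n a) := by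
      intro j
      exact integrable_mul_continuousMap hg ⟨fun θ : Sph n =>
        (j.factorial : ℝ)⁻¹ • ridgeMon e j (2 * k) (θ : Amb n),
        ((contDiff_ridgeMon e j (2 * k)).continuous.comp continuous_subtype_val).const_mul _⟩
    have hsum := hasSum_integral_of_summable_integral_norm hb (by
      refine Summable.of_nonneg_of_le (fun j => integral_nonneg fun θ => norm_nonneg _)
        (fun j => ?_) ((Real.summable_pow_div_factorial ‖e‖).mul_right
          (∫ θ, |g θ| ∂(sphereMeasure n a)))
      rw [← integral_const_mul]
      refine integral_mono (hb j).norm (hg.abs.const_mul _) fun θ => ?_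
      have h1 : |inner ℝ (θ : Amb n) e| ≤ ‖e‖ := by
        simpa [norm_sph] using abs_real_inner_le_norm (θ : Amb n) e
      have h2 := (abs_yCoord_le (θ : Amb n)).trans (norm_sph θ).le
      simp only [ridgeMon, smul_eq_mul, norm_mul, Real.norm_eq_abs, abs_pow, abs_inv, Nat.abs_cast]
      calc |g θ| * ((j.factorial : ℝ)⁻¹ * (|inner ℝ (θ : Amb n) e| ^ j *
            |yCoord (θ : Amb n)| ^ (2 * k)))
          ≤ |g θ| * ((j.factorial : ℝ)⁻¹ * (‖e‖ ^ j * 1)) := by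
            gcongr
            exact pow_le_one₀ (abs_nonneg _) h2
        _ = _ := by rw [div_eq_mul_inv]; ring)
    have hz : ∀ j, ∫ θ : Sph n, g θ * (((j.factorial : ℝ)⁻¹ •
        ridgeMon e j (2 * k) (θ : Amb n))) ∂(sphereMeasure n a) = 0 := by
      intro j
      simp only [smul_eq_mul, mul_left_comm _ ((j.factorial : ℝ)⁻¹)]
      rw [integral_const_mul, h j k, mul_zero]
    simp only [hz] at hsum
    have h0 := hsum.unique hasSum_zero
    rw [← h0]
    congr 1; ext θ
    have hexp := NormedSpace.expSeries_div_hasSum_exp (inner ℝ (θ : Amb n) e)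
    rw [← Real.exp_eq_exp_ℝ] at hexp
    have hs := (hexp.mul_right (yCoord (θ : Amb n) ^ (2 * k))).mul_left (g θ)
    change g θ * (Real.exp (inner ℝ (θ : Amb n) e) * yCoord (θ : Amb n) ^ (2 * k)) = _
    rw [← hs.tsum_eq]
    congr 1; ext j
    simp only [ridgeMon, smul_eq_mul, div_eq_mul_inv]; ring
  · have h1 := integral_comp_sphFlip (integrable_mul_continuousMap hg
      (expMon e (2 * k + 1))).aestronglyMeasurable
    have h2 : ∫ θ, g (sphFlip θ) * expMon e (2 * k + 1) (sphFlip θ) ∂(sphereMeasure n a) =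
        ∫ θ, -(g θ * expMon e (2 * k + 1) θ) ∂(sphereMeasure n a) := by
      apply integral_congr_ae
      filter_upwards [heven] with θ hθ
      rw [hθ]
      simp only [expMon, ContinuousMap.coe_mk]
      rw [inner_sphFlip he, yCoord_sphFlip, pow_succ, pow_succ, pow_mul, pow_mul, neg_sq]; ring
    rw [h1, integral_neg] at h2
    linarith

/-- The closure is the double orthogonal complement. If g is orthogonal to the even monomials, then
g symmetrized in y is orthogonal to all continuous functions, hence zero, and pairing g with an even
function only sees this symmetrization. -/
theorem mem_closure_evenSpan {n : ℕ} {a : ℝ} (ha0 : -1 < a) (p : SphL2 n a)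
    (hp : ∀ᵐ θ ∂(sphereMeasure n a), p (sphFlip θ) = p θ) :
    p ∈ closure ((evenSpan ha0 : Submodule ℝ (SphL2 n a)) : Set (SphL2 n a)) := by
  have hfin := isFiniteMeasure_sphereMeasure n ha0
  have hflip := measurePreserving_sphFlip (n := n) a
  change p ∈ (evenSpan ha0).topologicalClosure
  rw [← Submodule.orthogonal_orthogonal_eq_closure, Submodule.mem_orthogonal]
  intro g hg
  have hgm := Lp.memLp g
  have hgf : MemLp (fun θ => g (sphFlip θ)) 2 (sphereMeasure n a) :=
    hgm.comp_measurePreserving hflip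
  set ge : Sph n → ℝ := fun θ => g θ + g (sphFlip θ) with hge
  have hgem : MemLp ge 2 (sphereMeasure n a) := hgm.add hgf
  have hgi : Integrable ge (sphereMeasure n a) := hgem.integrable (by norm_num)
  have hsym : ∀ f : Sph n → ℝ, MemLp f 2 (sphereMeasure n a) →
      (∀ᵐ θ ∂(sphereMeasure n a), f (sphFlip θ) = f θ) →
      ∫ θ, ge θ * f θ ∂(sphereMeasure n a) = 2 * ∫ θ, g θ * f θ ∂(sphereMeasure n a) := by
    intro f hf hfe
    have h1 := integrable_mul_of_memLp hgm hf
    have h2 : ∫ θ, g (sphFlip θ) * f θ ∂(sphereMeasure n a) =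
        ∫ θ, g θ * f θ ∂(sphereMeasure n a) := by
      rw [← integral_comp_sphFlip h1.aestronglyMeasurable]
      apply integral_congr_ae
      filter_upwards [hfe] with θ hθ
      rw [hθ]
    simp only [hge, add_mul]
    rw [integral_add h1 (integrable_mul_of_memLp hgf hf), h2]; ring
  have hz : ge =ᵐ[sphereMeasure n a] 0 := by
    apply ae_eq_zero_of_integral_mul_continuousMap hgi
    apply integral_mul_eq_zero_of_expMon hgi
    intro e l he
    refine integral_mul_expMon_eq_zero hgi (ae_of_all _ fun θ => ?_) he (fun j k => ?_) l
    · simp only [hge, sphFlip_sphFlip]; ring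
    · rw [hsym _ (memLp_ridgeMon ha0 e j (2 * k)) (ae_of_all _ fun θ => ?_)]
      · have h3 := (Submodule.mem_orthogonal _ _).1 hg (monL2 ha0 e j k)
          (Submodule.subset_span ⟨e, he, j, k, rfl⟩)
        rw [← Lp.toLp_coeFn g hgm, monL2, inner_toLp_real] at h3
        simp only [mul_comm (g _)]
        rw [h3, mul_zero]
      · simp only [ridgeMon]
        rw [inner_sphFlip he, yCoord_sphFlip, pow_mul, pow_mul, neg_sq]
  have h4 := hsym p (Lp.memLp p) hp
  rw [integral_congr_ae (g := fun _ => (0 : ℝ)) (by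
    filter_upwards [hz] with θ hθ
    rw [hθ]; simp), integral_zero] at h4
  rw [← Lp.toLp_coeFn g hgm, ← Lp.toLp_coeFn p (Lp.memLp p), inner_toLp_real]
  linarith

/-! ### The profiles on the sphere -/

theorem integrable_add_fun {α : Type*} {m : MeasurableSpace α} {μ : Measure α} {f g : α → ℝ}
    (hf : Integrable f μ) (hg : Integrable g μ) : Integrable (fun x => f x + g x) μ :=
  hf.add hg


section Profiles

variable {n : ℕ} {s a : ℝ} {e : Amb n}

theorem memLp_slit (hs0 : 0 < s) (ha : -1 < a) (e : Amb n) :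
    MemLp (fun θ : Sph n => slit s e 0 (θ : Amb n)) 2 (sphereMeasure n a) :=
  memLp_of_continuous ha ((continuous_slit e 0 hs0.le).comp continuous_subtype_val)

theorem continuous_thinProfile (hs0 : 0 < s) : Continuous (thinProfile s : Amb n → ℝ) :=
  continuous_yCoord.abs.rpow_const fun _ => Or.inr (by linarith)

theorem memLp_thinProfile (n : ℕ) (hs0 : 0 < s) (ha : -1 < a) :
    MemLp (fun θ : Sph n => thinProfile s (θ : Amb n)) 2 (sphereMeasure n a) :=
  memLp_of_continuous ha ((continuous_thinProfile hs0).comp continuous_subtype_val)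

/-- The flux of `slit` through the thin space lives where ⟨X,e⟩ < 0. The bound on `g` forces it to
be small there, so the eigenvalue equation holds tested against such `g`, although not against
arbitrary functions. -/
theorem integral_inner_slitGrad (hn : 1 ≤ n) (hs0 : 0 < s) (hs1 : s < 1) (ha : a = 1 - 2 * s)
    (he : yCoord e = 0) (hne : ‖e‖ = 1) {g : Sph n → ℝ} {G : Sph n → Amb n}
    (hg : MemLp g 2 (sphereMeasure n a)) (hG : IsWeakSphereGrad a g G) {K : ℝ} (hK : 0 ≤ K)
    (hb : ∀ θ : Sph n, |g θ| ≤
      K * (slitBase e 0 (θ : Amb n) ^ s + |yCoord (θ : Amb n)| ^ (2 * s))) :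
    ∫ θ, inner ℝ (slitGrad s e θ) (G θ) ∂(sphereMeasure n a) =
      sphEig n a (1 + s) * ∫ θ : Sph n, slit s e 0 (θ : Amb n) * g θ ∂(sphereMeasure n a) := by
  rw [← integral_const_mul]
  have h := (isRidge_slit hs0 ha he hne).integral_inner_tangentPart (by linarith) hg hG
    (memLp_slit hs0 (by linarith) e) ((memLp_slit hs0 (by linarith) e).const_mul _)
    (isWeakSphereGrad_slit hn hs0 hs1 ha hne).1
    (w := fun θ => 2 * K * (3 * |yCoord (θ : Amb n)| ^ a + 6 * |yCoord (θ : Amb n)| ^ (-a)))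
    ((((integrable_abs_yCoord_rpow n (by linarith)).const_mul 3).add
      ((integrable_abs_yCoord_rpow n (by linarith)).const_mul 6)).const_mul _)
    (by
      filter_upwards [ae_sphere_yCoord_ne n] with θ hθ
      exact slit_boundary_bound hs0 hs1 ha hne hθ hK (hb θ))
  refine h.trans ?_
  congr 1; ext θ; rw [sphEig]; ring

/-- The flux |y|^a ∂_y |y|^(2s) does not vanish on the thin space, but the test function |y|^(2s)
does: the identity |y|^(2s) |y|^a = |y| supplies exactly the factor that removes the boundary term.
-/
theorem integral_inner_thinProfileGrad (hn : 1 ≤ n) (hs0 : 0 < s) (hs1 : s < 1)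
    (ha : a = 1 - 2 * s) :
    ∫ θ : Sph n, inner ℝ (thinProfileGrad s θ) (thinProfileGrad s θ) ∂(sphereMeasure n a) =
      sphEig n a (2 * s) * ∫ θ : Sph n, thinProfile s (θ : Amb n) * thinProfile s (θ : Amb n)
        ∂(sphereMeasure n a) := by
  rw [← integral_const_mul]
  have hw := isWeakSphereGrad_thinProfile hn hs0 hs1 ha
  have hm : MemLp _ 2 (sphereMeasure n a) := memLp_thinProfile n hs0 (by linarith)
  have h := (isRidge_thinProfile (n := n) ha (e := 0) (by simp [yCoord])).integral_inner_tangentPart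
    (by linarith) hm hw hm (hm.const_mul _) hw.1
    (w := fun θ => 2 * s * |yCoord (θ : Amb n)| ^ (-a))
    ((integrable_abs_yCoord_rpow n (by linarith)).const_mul _)
    (by
      filter_upwards [ae_sphere_yCoord_ne n] with θ hθ
      have h0 := abs_pos.2 hθ
      have hd := abs_thinProfile_div (s := s) ha hθ
      have ht : 0 ≤ |yCoord (θ : Amb n)| ^ (2 * s) := by positivity
      rw [mul_div_assoc, abs_mul, hd, abs_of_pos (by linarith : 0 < 2 * s), thinProfile,
        abs_of_nonneg ht, ← Real.rpow_add h0, show 2 * s + a = 1 by rw [ha]; ring, Real.rpow_one])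
  refine h.trans ?_
  congr 1; ext θ; rw [sphEig]; ring

theorem abs_thinProfile_le (e : Amb n) (θ : Sph n) : |thinProfile s (θ : Amb n)| ≤
    1 * (slitBase e 0 (θ : Amb n) ^ s + |yCoord (θ : Amb n)| ^ (2 * s)) := by
  have h1 : 0 ≤ slitBase e 0 (θ : Amb n) ^ s := Real.rpow_nonneg (slitBase_nonneg le_rfl) _
  have h2 : 0 ≤ |yCoord (θ : Amb n)| ^ (2 * s) := by positivity
  rw [thinProfile, abs_of_nonneg h2]; linarith

theorem abs_slit_le' (hs0 : 0 < s) (hne : ‖e‖ = 1) (θ : Sph n) : |slit s e 0 (θ : Amb n)| ≤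
    (1 / s + 2) * (slitBase e 0 (θ : Amb n) ^ s + |yCoord (θ : Amb n)| ^ (2 * s)) := by
  have h2 : 0 ≤ |yCoord (θ : Amb n)| ^ (2 * s) := by positivity
  refine (abs_slit_le hs0 hne le_rfl zero_le_one θ).trans ?_
  gcongr
  linarith

theorem sphEig_two_mul_le (hn : 1 ≤ n) (hs0 : 0 < s) (hs1 : s < 1) (ha : a = 1 - 2 * s) :
    sphEig n a (2 * s) ≤ sphEig n a (1 + s) := by
  have : (1 : ℝ) ≤ n := by exact_mod_cast hn
  unfold sphEig
  rw [ha]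
  nlinarith

/-- The combination `C slit + c₀ thinProfile` on the sphere. -/
noncomputable def profile (s : ℝ) (e : Amb n) (C c₀ : ℝ) (θ : Sph n) : ℝ :=
  C * slit s e 0 (θ : Amb n) + c₀ * thinProfile s (θ : Amb n)

/-- The weak tangential gradient of `profile`. -/
noncomputable def profileGrad (s : ℝ) (e : Amb n) (C c₀ : ℝ) (θ : Sph n) : Amb n :=
  C • slitGrad s e θ + c₀ • thinProfileGrad s θ

theorem memLp_profile (hs0 : 0 < s) (ha : -1 < a) (e : Amb n) (C c₀ : ℝ) :
    MemLp (profile s e C c₀) 2 (sphereMeasure n a) :=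
  ((memLp_slit hs0 ha e).const_mul C).add ((memLp_thinProfile n hs0 ha).const_mul c₀)

theorem isWeakSphereGrad_profile (hn : 1 ≤ n) (hs0 : 0 < s) (hs1 : s < 1) (ha : a = 1 - 2 * s)
    (hne : ‖e‖ = 1) (C c₀ : ℝ) : IsWeakSphereGrad a (profile s e C c₀) (profileGrad s e C c₀) :=
  (isWeakSphereGrad_slit hn hs0 hs1 ha hne).lin (by linarith)
    (isWeakSphereGrad_thinProfile hn hs0 hs1 ha) (memLp_slit hs0 (by linarith) e)
    (memLp_thinProfile n hs0 (by linarith)) C c₀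

/-- In the expanded square, the pure `slit` term and the mixed term have eigenvalue λ(1+s) exactly.
The pure `thinProfile` term has eigenvalue λ(2s) ≤ λ(1+s) and a nonnegative coefficient, so the
signs of C and c₀ play no role. -/
theorem energy_profile_le (hn : 1 ≤ n) (hs0 : 0 < s) (hs1 : s < 1) (ha : a = 1 - 2 * s)
    (he : yCoord e = 0) (hne : ‖e‖ = 1) (C c₀ : ℝ) :
    ∫ θ, ‖profileGrad s e C c₀ θ‖ ^ 2 ∂(sphereMeasure n a) ≤
      sphEig n a (1 + s) * ∫ θ, profile s e C c₀ θ ^ 2 ∂(sphereMeasure n a) := by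
  have hm1 : -1 < a := by linarith
  have hwh := isWeakSphereGrad_slit hn hs0 hs1 ha hne
  have hwu := isWeakSphereGrad_thinProfile hn hs0 hs1 ha
  have hh := memLp_slit hs0 hm1 e
  have hu := memLp_thinProfile n hs0 hm1
  have e1 := integral_inner_slitGrad hn hs0 hs1 ha he hne hh hwh (by positivity)
    (abs_slit_le' hs0 hne)
  have e2 := integral_inner_slitGrad hn hs0 hs1 ha he hne hu hwu zero_le_one
    (abs_thinProfile_le e)
  have e3 := integral_inner_thinProfileGrad hn hs0 hs1 ha
  have i1 := (integrable_inner_of_memLp hwh.1 hwh.1).const_mul (C ^ 2)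
  have i2 := (integrable_inner_of_memLp hwh.1 hwu.1).const_mul (2 * C * c₀)
  have i3 := (integrable_inner_of_memLp hwu.1 hwu.1).const_mul (c₀ ^ 2)
  have j1 := (integrable_mul_of_memLp hh hh).const_mul (C ^ 2)
  have j2 := (integrable_mul_of_memLp hh hu).const_mul (2 * C * c₀)
  have j3 := (integrable_mul_of_memLp hu hu).const_mul (c₀ ^ 2)
  have eL : ∫ θ, ‖profileGrad s e C c₀ θ‖ ^ 2 ∂(sphereMeasure n a) =
      C ^ 2 * ∫ θ, inner ℝ (slitGrad s e θ) (slitGrad s e θ) ∂(sphereMeasure n a) +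
      2 * C * c₀ * ∫ θ, inner ℝ (slitGrad s e θ) (thinProfileGrad s θ) ∂(sphereMeasure n a) +
      c₀ ^ 2 * ∫ θ : Sph n, inner ℝ (thinProfileGrad s θ) (thinProfileGrad s θ)
        ∂(sphereMeasure n a) := by
    rw [← integral_const_mul, ← integral_const_mul, ← integral_const_mul, ← integral_add i1 i2,
      ← integral_add (integrable_add_fun i1 i2) i3]
    congr 1; ext θ
    rw [profileGrad, norm_add_sq_real, norm_smul, norm_smul, real_inner_smul_left,
      real_inner_smul_right, mul_pow, mul_pow, Real.norm_eq_abs, Real.norm_eq_abs, sq_abs, sq_abs,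
      real_inner_self_eq_norm_sq, real_inner_self_eq_norm_sq]
    ring
  have eR : ∫ θ, profile s e C c₀ θ ^ 2 ∂(sphereMeasure n a) =
      C ^ 2 * ∫ θ : Sph n, slit s e 0 (θ : Amb n) * slit s e 0 (θ : Amb n) ∂(sphereMeasure n a) +
      2 * C * c₀ * ∫ θ : Sph n, slit s e 0 (θ : Amb n) * thinProfile s (θ : Amb n)
        ∂(sphereMeasure n a) +
      c₀ ^ 2 * ∫ θ : Sph n, thinProfile s (θ : Amb n) * thinProfile s (θ : Amb n)
        ∂(sphereMeasure n a) := by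
    rw [← integral_const_mul, ← integral_const_mul, ← integral_const_mul, ← integral_add j1 j2,
      ← integral_add (integrable_add_fun j1 j2) j3]
    congr 1; ext θ
    rw [profile]; ring
  have hpos : 0 ≤ c₀ ^ 2 * ∫ θ : Sph n, thinProfile s (θ : Amb n) * thinProfile s (θ : Amb n)
      ∂(sphereMeasure n a) :=
    mul_nonneg (sq_nonneg _) (integral_nonneg fun θ => mul_self_nonneg _)
  have := mul_le_mul_of_nonneg_right (sphEig_two_mul_le hn hs0 hs1 ha) hpos
  rw [eL, eR, e1, e2, e3]
  linarith

/-! ### Moments of the profiles -/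

/-- With t = ⟨X,e⟩ this says that `slit` is larger at X than at its mirror image. Because t < t/s,
it is enough to compare (ρ-t)(ρ+t)^s with (ρ+t)(ρ-t)^s, that is, (ρ-t)^(1-s) with (ρ+t)^(1-s). -/
theorem slitBase_rpow_lt (hs0 : 0 < s) (hs1 : s < 1) {t ρ : ℝ} (ht : 0 < t) (hρ : t < ρ) :
    (ρ - t / s) * (ρ + t) ^ s < (ρ + t / s) * (ρ - t) ^ s := by
  have h1 : t < t / s := by rw [lt_div_iff₀ hs0]; nlinarith
  have hp : 0 < ρ + t := by linarith
  have hm : 0 < ρ - t := by linarith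
  have hps := Real.rpow_pos_of_pos hp s
  have hms := Real.rpow_pos_of_pos hm s
  calc (ρ - t / s) * (ρ + t) ^ s < (ρ - t) * (ρ + t) ^ s := by gcongr
    _ = (ρ - t) ^ s * ((ρ - t) ^ (1 - s) * (ρ + t) ^ s) := by
        rw [← mul_assoc, ← Real.rpow_add hm, add_sub_cancel, Real.rpow_one]
    _ ≤ (ρ - t) ^ s * ((ρ + t) ^ (1 - s) * (ρ + t) ^ s) := by
        have : (ρ - t) ^ (1 - s) ≤ (ρ + t) ^ (1 - s) :=
          Real.rpow_le_rpow hm.le (by linarith) (by linarith)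
        gcongr
    _ = (ρ - t) ^ s * (ρ + t) := by
        rw [← Real.rpow_add hp, sub_add_cancel, Real.rpow_one]
    _ < (ρ - t) ^ s * (ρ + t / s) := by gcongr
    _ = _ := mul_comm _ _

theorem slit_mirror_lt (hs0 : 0 < s) (hs1 : s < 1) (he : yCoord e = 0) (hne : ‖e‖ = 1) {X : Amb n}
    (hX : yCoord X ≠ 0) (hXe : inner ℝ X e ≠ 0) :
    0 < inner ℝ X e * (slit s e 0 X - slit s e 0 (mirror e X)) := by
  have hρ : slitRho e 0 (mirror e X) = slitRho e 0 X := by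
    rw [slitRho, slitRho, inner_mirror_self hne, yCoord_mirror_horizontal hne he, neg_sq]
  have hlt := abs_inner_lt_slitRho (X := X) (e := e) (ε := 0) (by positivity)
  simp only [slit, slitBase, hρ, inner_mirror_self hne]
  set ρ := slitRho e 0 X
  set t := inner ℝ X e
  rcases lt_or_gt_of_ne hXe with h | h
  · have h1 := slitBase_rpow_lt hs0 hs1 (t := -t) (ρ := ρ) (by linarith) (by
      rw [abs_of_neg h] at hlt; exact hlt)
    refine mul_pos_of_neg_of_neg h ?_
    rw [neg_div, sub_neg_eq_add, sub_neg_eq_add] at h1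
    rw [neg_div]
    have e1 : (ρ - t / s - 2 * ρ) * (ρ + -t) ^ s = -(ρ + t / s) * (ρ + -t) ^ s := by ring
    nlinarith [h1]
  · have h1 := slitBase_rpow_lt hs0 hs1 (t := t) (ρ := ρ) h (by
      rw [abs_of_pos h] at hlt; exact hlt)
    refine mul_pos h ?_
    rw [neg_div, ← sub_eq_add_neg]
    nlinarith [h1]

theorem norm_horizontal_sub_yDir (he : yCoord e = 0) (hne : ‖e‖ = 1) :
    ‖e - yDir n‖ = √2 := by
  have h : ‖e - yDir n‖ ^ 2 = 2 := by
    rw [norm_sub_sq_real, inner_yDir, he, hne, norm_yDir]; norm_num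
  rw [← h, Real.sqrt_sq (norm_nonneg _)]

theorem ae_sphere_inner_ne (he : yCoord e = 0) (hne : ‖e‖ = 1) :
    ∀ᵐ θ : Sph n ∂(surfaceMeasure n), inner ℝ (θ : Amb n) e ≠ 0 := by
  -- The mirror with this unit normal exchanges `e` and the y-direction, so it carries {⟨θ,e⟩ = 0}
  -- to the null set {y = 0}.
  set v : Amb n := (√2)⁻¹ • (e - yDir n) with hv
  have hsq : (√2 : ℝ)⁻¹ * (√2)⁻¹ = 1 / 2 := by
    rw [← mul_inv, Real.mul_self_sqrt (by norm_num)]; norm_num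
  have hvn : ‖v‖ = 1 := by
    rw [hv, norm_smul, norm_horizontal_sub_yDir he hne, norm_inv, Real.norm_eq_abs,
      abs_of_nonneg (Real.sqrt_nonneg _), inv_mul_cancel₀ (by positivity)]
  have hmp := measurePreserving_sphMap (mirror v)
  have h := hmp.quasiMeasurePreserving.ae (ae_sphere_yCoord_ne n)
  filter_upwards [h] with θ hθ hc
  apply hθ
  change yCoord (mirror v (θ : Amb n)) = 0
  rw [← inner_yDir, inner_mirror hvn, inner_yDir, inner_yDir, hv, real_inner_smul_right,
    inner_sub_right, hc, inner_yDir, yCoord_smul]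
  have : yCoord (e - yDir n) = -1 := by
    have h2 : yCoord (e - yDir n) = yCoord e - yCoord (yDir n) := by simp [yCoord]
    rw [h2, he, yCoord_yDir]; ring
  rw [this]
  linear_combination (-2) * yCoord (θ : Amb n) * hsq

theorem surfaceMeasure_ne_zero (n : ℕ) : surfaceMeasure n ≠ 0 := by
  intro h
  have h1 := (volume : Measure (Amb n)).toSphere_apply_univ
  rw [← surfaceMeasure, h] at h1
  simp only [Measure.coe_zero, Pi.zero_apply] at h1
  have h2 : volume (Metric.ball (0 : Amb n) 1) ≠ 0 := (Metric.measure_ball_pos _ _ one_pos).ne'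
  rw [eq_comm, mul_eq_zero] at h1
  rcases h1 with h1 | h1
  · simp at h1
  · exact h2 h1

theorem integral_sphereMeasure_pos {f : Sph n → ℝ} (hf : Integrable f (sphereMeasure n a))
    (hpos : ∀ᵐ θ ∂(surfaceMeasure n), 0 < f θ) : 0 < ∫ θ, f θ ∂(sphereMeasure n a) := by
  have hpos' : ∀ᵐ θ ∂(sphereMeasure n a), 0 < f θ := (ae_sphereMeasure_iff a).2 hpos
  rw [integral_pos_iff_support_of_nonneg_ae (hpos'.mono fun θ h => h.le) hf]
  refine pos_iff_ne_zero.2 fun h0 => surfaceMeasure_ne_zero n ?_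
  have h1 : ∀ᵐ θ ∂(sphereMeasure n a), f θ = 0 := by
    rw [ae_iff]; exact h0
  have h2 : ∀ᵐ θ ∂(sphereMeasure n a), False := by
    filter_upwards [hpos', h1] with θ h3 h4
    exact h3.ne' h4
  exact ae_eq_bot.1 (eventually_false_iff_eq_bot.1 ((ae_sphereMeasure_iff a).1 h2))

theorem memLp_inner (ha : -1 < a) (e : Amb n) :
    MemLp (fun θ : Sph n => inner ℝ (θ : Amb n) e) 2 (sphereMeasure n a) :=
  memLp_of_continuous ha (by fun_prop)

theorem integrable_comp_sphMap {R : Amb n ≃ₗᵢ[ℝ] Amb n} (hR : ∀ X, |yCoord (R X)| = |yCoord X|)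
    {f : Sph n → ℝ} (hf : Integrable f (sphereMeasure n a)) :
    Integrable (fun θ => f (sphMap R θ)) (sphereMeasure n a) :=
  (measurePreserving_sphMap_weighted a R hR).integrable_comp_of_integrable hf

theorem integral_inner_mul_sub_mirror (ha : -1 < a) (he : yCoord e = 0) (hne : ‖e‖ = 1)
    {f : Sph n → ℝ} (hf : MemLp f 2 (sphereMeasure n a)) :
    Integrable (fun θ : Sph n => inner ℝ (θ : Amb n) e * (f θ - f (sphMap (mirror e) θ)))
      (sphereMeasure n a) ∧
    ∫ θ : Sph n, inner ℝ (θ : Amb n) e * (f θ - f (sphMap (mirror e) θ)) ∂(sphereMeasure n a) =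
      2 * ∫ θ : Sph n, f θ * inner ℝ (θ : Amb n) e ∂(sphereMeasure n a) := by
  have hR : ∀ X, |yCoord (mirror e X)| = |yCoord X| := fun X => by
    rw [yCoord_mirror_horizontal hne he]
  have i1 := integrable_mul_of_memLp hf (memLp_inner ha e)
  have i2 : Integrable (fun θ : Sph n => f (sphMap (mirror e) θ) *
      inner ℝ (sphMap (mirror e) θ : Amb n) e) (sphereMeasure n a) :=
    integrable_comp_sphMap (R := mirror e) (f := fun θ : Sph n => f θ * inner ℝ (θ : Amb n) e) hR i1
  have h1 := integral_comp_sphMap (R := mirror e) (f := fun θ : Sph n => f θ * inner ℝ (θ : Amb n) e)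
    hR i1.aestronglyMeasurable
  have h2 : ∀ θ : Sph n, inner ℝ (θ : Amb n) e * (f θ - f (sphMap (mirror e) θ)) =
      f θ * inner ℝ (θ : Amb n) e +
        f (sphMap (mirror e) θ) * inner ℝ (sphMap (mirror e) θ : Amb n) e := by
    intro θ
    have h3 : inner ℝ (sphMap (mirror e) θ : Amb n) e = -inner ℝ (θ : Amb n) e :=
      inner_mirror_self hne _
    rw [h3]; ring
  simp only [h2]
  exact ⟨integrable_add_fun i1 i2, by rw [integral_add i1 i2, h1, two_mul]⟩

/-- Averaging with the mirror image turns twice the moment into the integral of ⟨θ,e⟩ (h(θ) -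
h(mirror θ)), which is positive almost everywhere. -/
theorem slit_moment_pos (hs0 : 0 < s) (hs1 : s < 1) (ha : -1 < a)
    (he : yCoord e = 0) (hne : ‖e‖ = 1) :
    0 < ∫ θ : Sph n, slit s e 0 (θ : Amb n) * inner ℝ (θ : Amb n) e ∂(sphereMeasure n a) := by
  obtain ⟨hi, h⟩ := integral_inner_mul_sub_mirror ha he hne (memLp_slit hs0 ha e)
  have hp := integral_sphereMeasure_pos hi (by
    filter_upwards [ae_sphere_yCoord_ne n, ae_sphere_inner_ne he hne] with θ h2 h3
    exact slit_mirror_lt hs0 hs1 he hne h2 h3)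
  rw [h] at hp
  exact pos_of_mul_pos_right hp (by norm_num)

/-- A function invariant under the reflections orthogonal to a horizontal direction has no moment
in this direction. -/
theorem moment_eq_zero_of_mirror (ha : -1 < a) {f : Sph n → ℝ}
    (hf : MemLp f 2 (sphereMeasure n a)) {w : Amb n} (hw : yCoord w = 0)
    (hinv : ∀ v : Amb n, ‖v‖ = 1 → (∃ k : ℝ, v = k • w) → ∀ θ, f (sphMap (mirror v) θ) = f θ) :
    ∫ θ : Sph n, f θ * inner ℝ (θ : Amb n) w ∂(sphereMeasure n a) = 0 := by
  rcases eq_or_ne w 0 with rfl | h0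
  · simp
  have hn0 := norm_ne_zero_iff.2 h0
  have hv1 : ‖‖w‖⁻¹ • w‖ = 1 := by rw [norm_smul, norm_inv, norm_norm, inv_mul_cancel₀ hn0]
  set v := ‖w‖⁻¹ • w with hv
  have hvy : yCoord v = 0 := by rw [hv, yCoord_smul, hw, mul_zero]
  have hwv : w = ‖w‖ • v := by rw [hv, smul_smul, mul_inv_cancel₀ hn0, one_smul]
  have i1 := integrable_mul_of_memLp hf (memLp_inner ha w)
  have h1 := integral_comp_sphMap (R := mirror v) (fun X => by
    rw [yCoord_mirror_horizontal hv1 hvy]) i1.aestronglyMeasurable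
  have h2 : ∀ θ : Sph n, f (sphMap (mirror v) θ) * inner ℝ (sphMap (mirror v) θ : Amb n) w =
      -(f θ * inner ℝ (θ : Amb n) w) := by
    intro θ
    rw [hinv v hv1 ⟨_, hv⟩, sphMap]
    simp only
    have h3 : inner ℝ (mirror v (θ : Amb n)) w = -inner ℝ (θ : Amb n) w := by
      have h4 : ∀ X : Amb n, inner ℝ X w = ‖w‖ * inner ℝ X v := fun X => by
        conv_lhs => rw [hwv, real_inner_smul_right]
      rw [h4, h4, inner_mirror_self hv1]; ring
    rw [h3]; ring
  simp only [h2] at h1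
  rw [integral_neg] at h1
  linarith

theorem slit_mirror_orthogonal {v : Amb n} (hv : ‖v‖ = 1) (hvy : yCoord v = 0)
    (hve : inner ℝ v e = 0) (X : Amb n) : slit s e 0 (mirror v X) = slit s e 0 X := by
  simp only [slit, slitBase, slitRho]
  rw [inner_mirror_of_orthogonal hv hve, yCoord_mirror_horizontal hv hvy]

/-- `slit` is invariant under mirrors orthogonal to `e`, so only the component of `w` along `e`
contributes: the horizontal moment vector of `slit` points along `e`. -/
theorem slit_moment (hs0 : 0 < s) (ha : -1 < a) (hne : ‖e‖ = 1) (he : yCoord e = 0) {w : Amb n}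
    (hw : yCoord w = 0) :
    ∫ θ : Sph n, slit s e 0 (θ : Amb n) * inner ℝ (θ : Amb n) w ∂(sphereMeasure n a) =
      inner ℝ w e *
        ∫ θ : Sph n, slit s e 0 (θ : Amb n) * inner ℝ (θ : Amb n) e ∂(sphereMeasure n a) := by
  set w' : Amb n := w - (inner ℝ w e : ℝ) • e with hw'
  have hw'y : yCoord w' = 0 := by
    have : yCoord w' = yCoord w - (inner ℝ w e : ℝ) * yCoord e := by simp [hw', yCoord]
    rw [this, hw, he]; ring
  have hw'e : inner ℝ w' e = 0 := by
    rw [hw', inner_sub_left, real_inner_smul_left, real_inner_self_eq_norm_sq, hne]; ring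
  have hz := moment_eq_zero_of_mirror ha (memLp_slit hs0 ha e) hw'y (by
    rintro v hv ⟨k, rfl⟩ θ
    exact slit_mirror_orthogonal hv (by rw [yCoord_smul, hw'y, mul_zero])
      (by rw [real_inner_smul_left, hw'e, mul_zero]) _)
  have i1 := integrable_mul_of_memLp (memLp_slit hs0 ha e) (memLp_inner ha w)
  have i2 := (integrable_mul_of_memLp (memLp_slit hs0 ha e) (memLp_inner ha e)).const_mul
    (inner ℝ w e)
  have h1 : ∀ θ : Sph n, slit s e 0 (θ : Amb n) * inner ℝ (θ : Amb n) w' =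
      slit s e 0 (θ : Amb n) * inner ℝ (θ : Amb n) w -
        inner ℝ w e * (slit s e 0 (θ : Amb n) * inner ℝ (θ : Amb n) e) := fun θ => by
    rw [hw', inner_sub_right, real_inner_smul_right]; ring
  simp only [h1] at hz
  rw [integral_sub i1 i2, integral_const_mul] at hz
  linarith

theorem thinProfile_moment (hs0 : 0 < s) (ha : -1 < a) {w : Amb n} (hw : yCoord w = 0) :
    ∫ θ : Sph n, thinProfile s (θ : Amb n) * inner ℝ (θ : Amb n) w ∂(sphereMeasure n a) = 0 :=
  moment_eq_zero_of_mirror ha (memLp_thinProfile n hs0 ha) hw (by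
    rintro v hv ⟨k, rfl⟩ θ
    simp only [thinProfile, sphMap]
    rw [yCoord_mirror_horizontal hv (by rw [yCoord_smul, hw, mul_zero])])

theorem thinProfile_integral_pos (hs0 : 0 < s) (ha : -1 < a) :
    0 < ∫ θ : Sph n, thinProfile s (θ : Amb n) ∂(sphereMeasure n a) := by
  have := isFiniteMeasure_sphereMeasure n ha
  apply integral_sphereMeasure_pos ((memLp_thinProfile n hs0 ha).integrable (by norm_num))
  filter_upwards [ae_sphere_yCoord_ne n] with θ hθ
  exact Real.rpow_pos_of_pos (abs_pos.2 hθ) _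

theorem exists_horizontal_unit (hn : 1 ≤ n) : ∃ e : Amb n, yCoord e = 0 ∧ ‖e‖ = 1 := by
  refine ⟨EuclideanSpace.single 0 1, ?_, by simp⟩
  have : Fin.last n ≠ 0 := by
    intro h
    have := congrArg Fin.val h
    simp at this
    omega
  simp [yCoord, this]

/-- The horizontal first moments of a function on the sphere are those of a multiple of `slit`. -/
theorem exists_slit_moment (hn : 1 ≤ n) (hs0 : 0 < s) (hs1 : s < 1) (ha : -1 < a)
    {c : Sph n → ℝ} (hc : MemLp c 2 (sphereMeasure n a)) :
    ∃ (e : Amb n) (C : ℝ), yCoord e = 0 ∧ ‖e‖ = 1 ∧ 0 ≤ C ∧ ∀ w : Amb n, yCoord w = 0 →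
      ∫ θ : Sph n, c θ * inner ℝ (θ : Amb n) w ∂(sphereMeasure n a) =
        C * ∫ θ : Sph n, slit s e 0 (θ : Amb n) * inner ℝ (θ : Amb n) w ∂(sphereMeasure n a) := by
  have hfin := isFiniteMeasure_sphereMeasure n ha
  have hci : Integrable c (sphereMeasure n a) := hc.integrable (by norm_num)
  have hci' : Integrable (fun θ : Sph n => c θ • (θ : Amb n)) (sphereMeasure n a) := by
    refine hci.norm.mono' (hc.1.smul continuous_subtype_val.aestronglyMeasurable)
      (ae_of_all _ fun θ => ?_)
    rw [norm_smul, norm_sph, mul_one]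
  set q : Amb n := ∫ θ : Sph n, c θ • (θ : Amb n) ∂(sphereMeasure n a) with hq
  have hqw : ∀ w, ∫ θ : Sph n, c θ * inner ℝ (θ : Amb n) w ∂(sphereMeasure n a) = inner ℝ q w := by
    intro w
    rw [real_inner_comm, hq, ← integral_inner hci' w]
    congr 1; ext θ
    rw [real_inner_smul_right, real_inner_comm]
  -- The horizontal part of the moment vector of `c` dictates the choice: e = p/|p| and C = |p|/γ,
  -- where γ > 0 is the moment of `slit` along e. If p = 0, then C = 0 and any direction will do.
  set p : Amb n := q - yCoord q • yDir n with hp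
  have hpw : ∀ w, yCoord w = 0 → inner ℝ q w = inner ℝ p w := by
    intro w hw
    rw [hp, inner_sub_left, real_inner_smul_left, inner_dir_yDir hw]; ring
  have hpy : yCoord p = 0 := by
    have : yCoord p = yCoord q - yCoord q * yCoord (yDir n) := by simp [hp, yCoord]
    rw [this, yCoord_yDir]; ring
  rcases eq_or_ne p 0 with h0 | h0
  · obtain ⟨e, he, hne⟩ := exists_horizontal_unit hn
    refine ⟨e, 0, he, hne, le_rfl, fun w hw => ?_⟩
    rw [hqw, hpw w hw, h0, inner_zero_left, zero_mul]
  · have hn0 := norm_ne_zero_iff.2 h0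
    have hey : yCoord (‖p‖⁻¹ • p) = 0 := by rw [yCoord_smul, hpy, mul_zero]
    have hne : ‖‖p‖⁻¹ • p‖ = 1 := by rw [norm_smul, norm_inv, norm_norm, inv_mul_cancel₀ hn0]
    have hγ := slit_moment_pos hs0 hs1 ha hey hne
    refine ⟨‖p‖⁻¹ • p, ‖p‖ / ∫ θ : Sph n, slit s (‖p‖⁻¹ • p) 0 (θ : Amb n) *
      inner ℝ (θ : Amb n) (‖p‖⁻¹ • p) ∂(sphereMeasure n a), hey, hne,
      div_nonneg (norm_nonneg _) hγ.le, fun w hw => ?_⟩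
    rw [hqw, hpw w hw, slit_moment hs0 ha hne hey hw]
    set γ := ∫ θ : Sph n, slit s (‖p‖⁻¹ • p) 0 (θ : Amb n) *
      inner ℝ (θ : Amb n) (‖p‖⁻¹ • p) ∂(sphereMeasure n a)
    rw [real_inner_smul_right, real_inner_comm]
    field_simp

/-- The spectral gap for even functions without moments of degree at most one. -/
theorem spectral_gap_even (hn : 1 ≤ n) (ha0 : -1 < a) (ha1 : a < 1) {f : Sph n → ℝ}
    {G : Sph n → Amb n} (hf : MemLp f 2 (sphereMeasure n a)) (hG : IsWeakSphereGrad a f G)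
    (heven : ∀ᵐ θ ∂(sphereMeasure n a), f (sphFlip θ) = f θ)
    (h0 : ∫ θ, f θ ∂(sphereMeasure n a) = 0)
    (h1 : ∀ w : Amb n, yCoord w = 0 →
      ∫ θ : Sph n, f θ * inner ℝ (θ : Amb n) w ∂(sphereMeasure n a) = 0) :
    sphEig n a 2 * ∫ θ, f θ ^ 2 ∂(sphereMeasure n a) ≤ ∫ θ, ‖G θ‖ ^ 2 ∂(sphereMeasure n a) := by
  have hcl := mem_closure_evenSpan ha0 (hf.toLp f) (by
    have h2 := hf.coeFn_toLp
    have h3 := (measurePreserving_sphFlip (n := n) a).quasiMeasurePreserving.ae h2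
    filter_upwards [heven, h2, h3] with θ e1 e2 e3
    rw [e3, e2, e1])
  have h := spectral_gap_of_mem_closure hn ha0 ha1 hcl
    (by
      rw [monL2, inner_toLp_real, ← h0]
      congr 1; ext θ; simp [ridgeMon])
    (by
      intro w hw
      rw [monL2, inner_toLp_real, ← h1 w hw]
      congr 1; ext θ; simp [ridgeMon, mul_comm])
    (toLp_mem_sphH1 ha1 hf hG)
  rw [← real_inner_self_eq_norm_sq, ← real_inner_self_eq_norm_sq, inner_toLp_real,
    inner_toLp_field] at h
  simp only [real_inner_self_eq_norm_sq, ← sq] at h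
  exact h

/-- Every even function on the sphere is a profile up to a function satisfying the gap. -/
theorem exists_profile (hn : 1 ≤ n) (hs0 : 0 < s) (hs1 : s < 1) (ha : a = 1 - 2 * s)
    {c : Sph n → ℝ} {G : Sph n → Amb n} (hc : MemLp c 2 (sphereMeasure n a))
    (hG : IsWeakSphereGrad a c G) (heven : ∀ᵐ θ ∂(sphereMeasure n a), c (sphFlip θ) = c θ) :
    ∃ (e : Amb n) (C c₀ : ℝ), yCoord e = 0 ∧ ‖e‖ = 1 ∧ 0 ≤ C ∧
      sphEig n a 2 * ∫ θ, (c θ - profile s e C c₀ θ) ^ 2 ∂(sphereMeasure n a) ≤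
        ∫ θ, ‖G θ - profileGrad s e C c₀ θ‖ ^ 2 ∂(sphereMeasure n a) := by
  have ha0 : -1 < a := by linarith
  have ha1 : a < 1 := by linarith
  have hfin := isFiniteMeasure_sphereMeasure n ha0
  obtain ⟨e, C, he, hne, hC, hmom⟩ := exists_slit_moment hn hs0 hs1 ha0 hc
  have hu := thinProfile_integral_pos (n := n) hs0 ha0
  set U := ∫ θ : Sph n, thinProfile s (θ : Amb n) ∂(sphereMeasure n a) with hU
  -- c₀ corrects the mean; it does not disturb the horizontal moments already matched, since
  -- `thinProfile` has none.
  set c₀ := ((∫ θ, c θ ∂(sphereMeasure n a)) -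
    C * ∫ θ : Sph n, slit s e 0 (θ : Amb n) ∂(sphereMeasure n a)) / U with hc₀
  refine ⟨e, C, c₀, he, hne, hC, ?_⟩
  have hψ := memLp_profile hs0 ha0 e C c₀
  have hf := hc.sub hψ
  have hw := hG.lin ha1 (isWeakSphereGrad_profile hn hs0 hs1 ha hne C c₀) hc hψ 1 (-1)
  have hw' : IsWeakSphereGrad a (fun θ => c θ - profile s e C c₀ θ)
      (fun θ => G θ - profileGrad s e C c₀ θ) := by
    refine hw.congr (ae_of_all _ fun θ => ?_) (ae_of_all _ fun θ => ?_)
    · simp only; ring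
    · simp only [one_smul, neg_smul, sub_eq_add_neg]
  refine spectral_gap_even hn ha0 ha1 hf hw' ?_ ?_ ?_
  · filter_upwards [heven] with θ hθ
    simp only [hθ, profile, slit, slitBase, slitRho, thinProfile]
    rw [inner_sphFlip he, yCoord_sphFlip, neg_sq, abs_neg]
  · have i1 : Integrable c (sphereMeasure n a) := hc.integrable (by norm_num)
    have i2 : Integrable (fun θ : Sph n => slit s e 0 (θ : Amb n)) (sphereMeasure n a) :=
      (memLp_slit hs0 ha0 e).integrable (by norm_num)
    have i3 : Integrable (fun θ : Sph n => thinProfile s (θ : Amb n)) (sphereMeasure n a) :=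
      (memLp_thinProfile n hs0 ha0).integrable (by norm_num)
    simp only [profile]
    rw [integral_sub i1 (integrable_add_fun (i2.const_mul C) (i3.const_mul c₀)),
      integral_add (i2.const_mul C) (i3.const_mul c₀), integral_const_mul, integral_const_mul,
      ← hU, hc₀, div_mul_cancel₀ _ hu.ne']
    ring
  · intro w hw
    have i0 := memLp_inner ha0 w
    have i1 := integrable_mul_of_memLp hc i0
    have i2 := (integrable_mul_of_memLp (memLp_slit hs0 ha0 e) i0).const_mul C
    have i3 := (integrable_mul_of_memLp (memLp_thinProfile n hs0 ha0) i0).const_mul c₀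
    have : ∀ θ : Sph n, (c θ - profile s e C c₀ θ) * inner ℝ (θ : Amb n) w =
        c θ * inner ℝ (θ : Amb n) w - (C * (slit s e 0 (θ : Amb n) * inner ℝ (θ : Amb n) w) +
          c₀ * (thinProfile s (θ : Amb n) * inner ℝ (θ : Amb n) w)) := by
      intro θ
      rw [profile]; ring
    simp only [this]
    rw [integral_sub i1 (integrable_add_fun i2 i3), integral_add i2 i3, integral_const_mul, integral_const_mul,
      hmom w hw, thinProfile_moment hs0 ha0 hw]
    ring

end Profiles

/-! ### Homogeneous extensions: square integrability -/

theorem isFiniteMeasure_radialMeasure {b : ℝ} (hb : -1 < b) : IsFiniteMeasure (radialMeasure b) := by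
  have h := integrable_rpow_radialMeasure (b := b) (t := 0) (by linarith)
  simp only [Real.rpow_zero] at h
  simpa [integrable_const_iff, isFiniteMeasure_iff] using h

theorem isFiniteMeasure_ballMeasure (n : ℕ) {a : ℝ} (ha : -1 < a) :
    IsFiniteMeasure (ballMeasure n a) :=
  ⟨ballMeasure_univ_lt_top n ha⟩

theorem neg_one_lt_dim_add (n : ℕ) {a : ℝ} (ha : -1 < a) : -1 < (n : ℝ) + a := by
  have : (0 : ℝ) ≤ n := n.cast_nonneg
  linarith

section Ball

variable {n : ℕ} {a : ℝ}

theorem aestronglyMeasurable_comp_dirMap {E : Type*} [TopologicalSpace E] {g : Sph n → E}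
    (hg : AEStronglyMeasurable g (sphereMeasure n a)) :
    AEStronglyMeasurable (fun X => g (dirMap X)) (ballMeasure n a) :=
  hg.comp_quasiMeasurePreserving (quasiMeasurePreserving_dirMap n a)

theorem memLp_comp_dirMap (ha : -1 < a) {E : Type*} [NormedAddCommGroup E] {g : Sph n → E}
    (hg : MemLp g 2 (sphereMeasure n a)) :
    MemLp (fun X => g (dirMap X)) 2 (ballMeasure n a) := by
  have hfin := isFiniteMeasure_radialMeasure (neg_one_lt_dim_add n ha)
  have hm := aestronglyMeasurable_comp_dirMap hg.1
  rw [← (measurePreserving_polarMap n a).map_eq] at hm ⊢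
  rw [memLp_map_measure_iff hm measurable_polarMap.aemeasurable]
  refine (hg.comp_fst (radialMeasure (n + a))).ae_eq ?_
  filter_upwards [ae_prod_radial_mem _ _] with p hp
  simp only [Function.comp, polarMap, dirMap_smul p.1 hp.1]

theorem ae_ball_norm_mem (n : ℕ) (a : ℝ) :
    ∀ᵐ X ∂(ballMeasure n a), 0 < ‖X‖ ∧ ‖X‖ < 1 := by
  filter_upwards [ae_ball_ne_zero n a, (ballMeasure_ac n a).ae_le
    (ae_restrict_mem measurableSet_ball)] with X h1 h2
  exact ⟨norm_pos_iff.2 h1, by simpa using h2⟩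

theorem memLp_rpow_norm_smul {E : Type*} [NormedAddCommGroup E] [NormedSpace ℝ E] {f : Amb n → E}
    (hf : MemLp f 2 (ballMeasure n a)) {t : ℝ} (ht : 0 ≤ t) :
    MemLp (fun X => ‖X‖ ^ t • f X) 2 (ballMeasure n a) := by
  have hm : Measurable fun X : Amb n => ‖X‖ ^ t := by fun_prop
  refine hf.of_le (hm.aestronglyMeasurable.smul hf.1) ?_
  filter_upwards [ae_ball_norm_mem n a] with X hX
  rw [norm_smul, Real.norm_eq_abs, abs_of_nonneg (by positivity)]
  exact mul_le_of_le_one_left (norm_nonneg _) (Real.rpow_le_one hX.1.le hX.2.le ht)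

theorem homExt_ae_eq (α : ℝ) (c : Sph n → ℝ) :
    homExt α c =ᵐ[ballMeasure n a] fun X => ‖X‖ ^ α • c (dirMap X) := by
  filter_upwards [ae_ball_ne_zero n a] with X hX
  rw [homExt, radialExt_eq c hX, smul_eq_mul]

theorem memLp_homExt (ha : -1 < a) {α : ℝ} (hα : 0 ≤ α) {c : Sph n → ℝ}
    (hc : MemLp c 2 (sphereMeasure n a)) : MemLp (homExt α c) 2 (ballMeasure n a) :=
  (memLp_rpow_norm_smul (memLp_comp_dirMap ha hc) hα).ae_eq (homExt_ae_eq α c).symm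

/-- The gradient of the `α`-homogeneous extension of `c`, if `G` is the tangential gradient. -/
noncomputable def homGrad (α : ℝ) (c : Sph n → ℝ) (G : Sph n → Amb n) (X : Amb n) : Amb n :=
  ‖X‖ ^ (α - 1) • ((α * c (dirMap X)) • (dirMap X : Amb n) + G (dirMap X))

theorem memLp_smul_sph {c : Sph n → ℝ} (hc : MemLp c 2 (sphereMeasure n a)) :
    MemLp (fun θ : Sph n => c θ • (θ : Amb n)) 2 (sphereMeasure n a) := by
  refine hc.of_le (hc.1.smul continuous_subtype_val.aestronglyMeasurable) (ae_of_all _ fun θ => ?_)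
  rw [norm_smul, norm_sph, mul_one]

theorem memLp_homGrad (ha : -1 < a) {α : ℝ} (hα : 1 ≤ α) {c : Sph n → ℝ} {G : Sph n → Amb n}
    (hc : MemLp c 2 (sphereMeasure n a)) (hG : MemLp G 2 (sphereMeasure n a)) :
    MemLp (homGrad α c G) 2 (ballMeasure n a) :=
  memLp_rpow_norm_smul (memLp_comp_dirMap ha ((memLp_smul_sph (hc.const_mul α)).add hG))
    (sub_nonneg.2 hα)

theorem integrable_ballMeasure_iff (b : ℝ) {F : Type*} [NormedAddCommGroup F] [NormedSpace ℝ F]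
    (f : Amb n → F) : Integrable f (ballMeasure n b) ↔
      Integrable (fun X => |yCoord X| ^ b • f X) (volume.restrict (Metric.ball (0 : Amb n) 1)) := by
  unfold ballMeasure
  rw [integrable_withDensity_iff_integrable_smul' (measurable_weight n b)
    (ae_of_all _ fun _ => ENNReal.ofReal_lt_top)]
  refine integrable_congr (ae_of_all _ fun X => ?_)
  simp only
  rw [ENNReal.toReal_ofReal (Real.rpow_nonneg (abs_nonneg _) _)]

/-- Weighted square integrability on the ball implies integrability. -/
theorem MemLp.integrable_ball (ha : a < 1) {E : Type*} [NormedAddCommGroup E]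
    [NormedSpace ℝ E] {g : Amb n → E} (hg : MemLp g 2 (ballMeasure n a)) :
    Integrable g (volume.restrict (Metric.ball (0 : Amb n) 1)) := by
  have hm : Measurable fun X : Amb n => |yCoord X| ^ (-a) := by
    have := measurable_yCoord (n := n)
    fun_prop
  have hinv : MemLp (fun X : Amb n => |yCoord X| ^ (-a)) 2 (ballMeasure n a) := by
    have hfin := isFiniteMeasure_ballMeasure n (a := -a) (by linarith)
    rw [memLp_two_iff_integrable_sq hm.aestronglyMeasurable, integrable_ballMeasure_iff]
    have h1 := (integrable_ballMeasure_iff (-a) fun _ : Amb n => (1 : ℝ)).1 (integrable_const 1)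
    refine h1.congr ?_
    filter_upwards [(ae_ballMeasure_iff a).1 (ae_ball_yCoord_ne n a)] with X hX
    have : 0 < |yCoord X| := abs_pos.2 hX
    rw [smul_eq_mul, smul_eq_mul, ← Real.rpow_natCast, ← Real.rpow_mul this.le,
      ← Real.rpow_add this, mul_one]
    congr 1; push_cast; ring
  have h := memLp_one_iff_integrable.1 (hg.smul hinv)
  rw [integrable_ballMeasure_iff] at h
  refine h.congr ?_
  filter_upwards [(ae_ballMeasure_iff a).1 (ae_ball_yCoord_ne n a)] with X hX
  have : 0 < |yCoord X| := abs_pos.2 hX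
  simp only [Pi.smul_apply']
  rw [smul_smul, ← Real.rpow_add this]
  simp

/-! ### The weak gradient of a homogeneous extension -/

/-- Against r^b dr the integrand is the derivative of r^(b+α) φ(rθ), which vanishes at r = 0 and,
because φ = 0 on the sphere, at r = 1. -/
theorem integral_radial_div {b : ℝ} (hb : 0 ≤ b) {α : ℝ} (hα : 1 ≤ α) {φ : Amb n → ℝ}
    (hφ : ContDiff ℝ ∞ φ) (h0 : ∀ θ : Sph n, φ θ = 0) (θ : Sph n) :
    ∫ r, r ^ (α - 1) * (r * fderiv ℝ φ (r • (θ : Amb n)) (θ : Amb n) +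
      (b + α) * φ (r • (θ : Amb n))) ∂(radialMeasure b) = 0 := by
  have hd : ∀ r : ℝ, HasDerivAt (fun r : ℝ => φ (r • (θ : Amb n)))
      (fderiv ℝ φ (r • (θ : Amb n)) (θ : Amb n)) r := by
    intro r
    have h1 : HasDerivAt (fun r : ℝ => r • (θ : Amb n)) (θ : Amb n) r := by
      simpa using (hasDerivAt_id r).smul_const (θ : Amb n)
    exact ((hφ.differentiable (by simp)) _).hasFDerivAt.comp_hasDerivAt r h1
  have hc' : Continuous fun r : ℝ => fderiv ℝ φ (r • (θ : Amb n)) (θ : Amb n) := by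
    have := hφ.continuous_fderiv (by simp)
    fun_prop
  have hc : Continuous fun r : ℝ => φ (r • (θ : Amb n)) :=
    hφ.continuous.comp (by fun_prop)
  have h := integral_rpow_mul_deriv (b := b + α) (by linarith) hd hc' (by simp [h0])
  rw [integral_radialMeasure]
  have i1 : IntervalIntegrable (fun r : ℝ => r ^ (b + α) * fderiv ℝ φ (r • (θ : Amb n)) (θ : Amb n))
      volume 0 1 :=
    ((Real.continuous_rpow_const (by linarith)).mul hc').intervalIntegrable _ _
  have i2 : IntervalIntegrable (fun r : ℝ => (b + α) * (r ^ (b + α - 1) * φ (r • (θ : Amb n))))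
      volume 0 1 :=
    (continuous_const.mul ((Real.continuous_rpow_const (by linarith)).mul hc)).intervalIntegrable _ _
  calc _ = ∫ r in (0 : ℝ)..1, (r ^ (b + α) * fderiv ℝ φ (r • (θ : Amb n)) (θ : Amb n) +
        (b + α) * (r ^ (b + α - 1) * φ (r • (θ : Amb n)))) := by
        rw [intervalIntegral.integral_of_le zero_le_one, intervalIntegral.integral_of_le zero_le_one]
        refine setIntegral_congr_fun measurableSet_Ioc fun r hr => ?_
        have e1 : r ^ (b + α) = r ^ b * (r ^ (α - 1) * r) := by
          rw [← Real.rpow_add_one hr.1.ne', ← Real.rpow_add hr.1]; congr 1; ring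
        have e2 : r ^ (b + α - 1) = r ^ b * r ^ (α - 1) := by
          rw [← Real.rpow_add hr.1]; congr 1; ring
        simp only [e1, e2]; ring
    _ = 0 := by
        rw [intervalIntegral.integral_add i1 i2, intervalIntegral.integral_const_mul, h]; ring

/-- In polar coordinates ∂_e φ splits into a tangential and a radial part. The first is handled on
each sphere by the weak gradient of `c` tested with the dilation φ(r·), the second on each ray by
integration by parts. -/
theorem isWeakGrad_homExt (ha0 : -1 < a) (ha1 : a < 1) {α : ℝ} (hα : 1 ≤ α)
    {c : Sph n → ℝ} {G : Sph n → Amb n} (hc : MemLp c 2 (sphereMeasure n a))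
    (hG : IsWeakSphereGrad a c G) : IsWeakGrad a (homExt α c) (homGrad α c G) := by
  refine ⟨memLp_homGrad ha0 hα hc hG.1, fun φ hφ hφc hφs i => ?_⟩
  set e : Amb n := EuclideanSpace.single i 1 with he
  have hei : ∀ V : Amb n, inner ℝ V e = V i := fun V => by
    rw [real_inner_comm, he, EuclideanSpace.inner_single_left]; simp
  have hci := MemLp.integrable_surface ha1 hc
  have hGi : Integrable (fun θ => inner ℝ (G θ) e) (surfaceMeasure n) :=
    (MemLp.integrable_surface ha1 hG.1).inner_const e
  have hn0 : (0 : ℝ) ≤ n := n.cast_nonneg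
  have hfin := isFiniteMeasure_radialMeasure (b := (n : ℝ)) (by linarith)
  have hD := hφ.continuous_fderiv (by simp)
  have h0 : ∀ θ : Sph n, φ θ = 0 := by
    intro θ
    by_contra h
    have := hφs (subset_tsupport φ h)
    simp at this
  obtain ⟨M, hM⟩ := hφ.continuous.bounded_above_of_compact_support hφc
  obtain ⟨M', hM'⟩ := hD.bounded_above_of_compact_support (hφc.fderiv (𝕜 := ℝ))
  have hM0 : 0 ≤ M := (norm_nonneg _).trans (hM 0)
  have hM0' : 0 ≤ M' := (norm_nonneg _).trans (hM' 0)
  set P := (surfaceMeasure n).prod (radialMeasure (n : ℝ)) with hP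
  have hr : ∀ᵐ p ∂P, p.2 ∈ Set.Ioo (0 : ℝ) 1 := ae_prod_radial_mem _ _
  have hbd : ∀ {g : Sph n → ℝ} (_ : Integrable g (surfaceMeasure n)) (K : Sph n × ℝ → ℝ)
      (_ : Continuous K) (B : ℝ), (∀ p, p.2 ∈ Set.Ioo (0 : ℝ) 1 → ‖K p‖ ≤ B) →
      Integrable (fun p : Sph n × ℝ => g p.1 * (p.2 ^ (α - 1) * K p)) P := by
    intro g hg K hK B hB
    have hm : Measurable fun p : Sph n × ℝ => p.2 ^ (α - 1) * K p :=
      (measurable_snd.pow_const _).mul hK.measurable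
    refine (hg.comp_fst (radialMeasure (n : ℝ))).mul_bdd (c := B) hm.aestronglyMeasurable ?_
    filter_upwards [hr] with p hp
    rw [norm_mul, Real.norm_eq_abs, abs_of_nonneg (Real.rpow_nonneg hp.1.le _)]
    exact (mul_le_of_le_one_left (norm_nonneg _) (Real.rpow_le_one hp.1.le hp.2.le
      (by linarith))).trans (hB p hp)
  have hcφ : Continuous fun p : Sph n × ℝ => φ (p.2 • (p.1 : Amb n)) :=
    hφ.continuous.comp (by fun_prop)
  have hcD : ∀ {v : Sph n × ℝ → Amb n}, Continuous v →
      Continuous fun p : Sph n × ℝ => fderiv ℝ φ (p.2 • (p.1 : Amb n)) (v p) := by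
    intro v hv
    exact (hD.comp (by fun_prop : Continuous fun p : Sph n × ℝ => p.2 • (p.1 : Amb n))).clm_apply hv
  have hcθ : Continuous fun p : Sph n × ℝ => (p.1 : Amb n) := by fun_prop
  have hne : ‖e‖ = 1 := by simp [he]
  have hie : ∀ θ : Sph n, |inner ℝ (θ : Amb n) e| ≤ 1 := fun θ => abs_inner_sph_le hne θ
  have hDb : ∀ (X v : Amb n), ‖v‖ = 1 → |fderiv ℝ φ X v| ≤ M' := fun X v hv => by
    have := (fderiv ℝ φ X).le_opNorm v
    rw [hv, mul_one, Real.norm_eq_abs] at this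
    exact this.trans (hM' X)
  set K1 : Sph n × ℝ → ℝ := fun p => p.2 * fderiv ℝ φ (p.2 • (p.1 : Amb n)) e with hK1
  set K2 : Sph n × ℝ → ℝ := fun p => inner ℝ (p.1 : Amb n) e *
    (p.2 * fderiv ℝ φ (p.2 • (p.1 : Amb n)) (p.1 : Amb n)) with hK2
  set K3 : Sph n × ℝ → ℝ := fun p => inner ℝ (p.1 : Amb n) e * φ (p.2 • (p.1 : Amb n)) with hK3
  have cK1 : Continuous K1 := continuous_snd.mul (hcD continuous_const)
  have cK2 : Continuous K2 := (hcθ.inner continuous_const).mul (continuous_snd.mul (hcD hcθ))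
  have cK3 : Continuous K3 := (hcθ.inner continuous_const).mul hcφ
  have bK1 : ∀ p, p.2 ∈ Set.Ioo (0 : ℝ) 1 → ‖K1 p‖ ≤ M' := fun p hp => by
    rw [hK1, Real.norm_eq_abs, abs_mul, abs_of_pos hp.1]
    exact (mul_le_of_le_one_left (abs_nonneg _) hp.2.le).trans (hDb _ _ hne)
  have bK2 : ∀ p, p.2 ∈ Set.Ioo (0 : ℝ) 1 → ‖K2 p‖ ≤ M' := fun p hp => by
    rw [hK2, Real.norm_eq_abs, abs_mul, abs_mul, abs_of_pos hp.1]
    exact (mul_le_of_le_one_left (mul_nonneg hp.1.le (abs_nonneg _)) (hie p.1)).trans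
      ((mul_le_of_le_one_left (abs_nonneg _) hp.2.le).trans (hDb _ _ (norm_sph p.1)))
  have bK3 : ∀ p, p.2 ∈ Set.Ioo (0 : ℝ) 1 → ‖K3 p‖ ≤ M := fun p _ => by
    rw [hK3, Real.norm_eq_abs, abs_mul]
    exact (mul_le_of_le_one_left (abs_nonneg _) (hie p.1)).trans (hM _)
  have i1 := hbd hci K1 cK1 M' bK1
  have i2 := hbd hci K2 cK2 M' bK2
  have i3 := hbd hci K3 cK3 M bK3
  have i4 := hbd hGi (fun p => φ (p.2 • (p.1 : Amb n))) hcφ M fun p _ => hM _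
  -- the spherical part
  have hA : ∫ p, (p.2 ^ (α - 1) * (c p.1 *
      (p.2 * fderiv ℝ φ (p.2 • (p.1 : Amb n)) e - inner ℝ (p.1 : Amb n) e *
        (p.2 * fderiv ℝ φ (p.2 • (p.1 : Amb n)) (p.1 : Amb n)) -
        n * φ (p.2 • (p.1 : Amb n)) * inner ℝ (p.1 : Amb n) e) +
      inner ℝ (G p.1) e * φ (p.2 • (p.1 : Amb n)))) ∂P = 0 := by
    rw [hP, integral_prod_symm]
    · have hz : ∀ r : ℝ, ∫ θ : Sph n, r ^ (α - 1) * (c θ *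
          (r * fderiv ℝ φ (r • (θ : Amb n)) e - inner ℝ (θ : Amb n) e *
          (r * fderiv ℝ φ (r • (θ : Amb n)) (θ : Amb n)) -
          n * φ (r • (θ : Amb n)) * inner ℝ (θ : Amb n) e) +
          inner ℝ (G θ) e * φ (r • (θ : Amb n))) ∂(surfaceMeasure n) = 0 := by
        intro r
        have hφr : ContDiff ℝ ∞ fun X : Amb n => φ (r • X) := hφ.comp (contDiff_const_smul r)
        have hfd : ∀ X v : Amb n, fderiv ℝ (fun X : Amb n => φ (r • X)) X v =
            r * fderiv ℝ φ (r • X) v := by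
          intro X v
          have h1 : HasFDerivAt (fun X : Amb n => r • X) (r • ContinuousLinearMap.id ℝ (Amb n)) X :=
            (hasFDerivAt_id X).const_smul r
          have h2 := ((hφ.differentiable (by simp)) (r • X)).hasFDerivAt.comp X h1
          have h3 : fderiv ℝ (fun X : Amb n => φ (r • X)) X = _ := h2.fderiv
          rw [h3]; simp
        have hw := hG.2 _ hφr e
        simp only [hfd] at hw
        have j1 : Integrable (fun θ : Sph n => c θ *
            (r * fderiv ℝ φ (r • (θ : Amb n)) e - inner ℝ (θ : Amb n) e *
            (r * fderiv ℝ φ (r • (θ : Amb n)) (θ : Amb n)) -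
            n * φ (r • (θ : Amb n)) * inner ℝ (θ : Amb n) e)) (surfaceMeasure n) := by
          apply integrable_mul_continuous hci
          have := hφ.continuous
          fun_prop
        have j2 : Integrable (fun θ : Sph n => inner ℝ (G θ) e * φ (r • (θ : Amb n)))
            (surfaceMeasure n) := by
          apply integrable_mul_continuous hGi
          have := hφ.continuous
          fun_prop
        rw [integral_const_mul, integral_add j1 j2, hw]; simp
      simp only [hz, integral_zero]
    · refine (((i1.sub i2).sub (i3.const_mul (n : ℝ))).add i4).congr (ae_of_all _ fun p => ?_)
      simp only [hK1, hK2, hK3, Pi.add_apply, Pi.sub_apply]; ring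
  -- the radial part
  have hB : ∫ p, c p.1 * (p.2 ^ (α - 1) * (K2 p + (n + α) * K3 p)) ∂P = 0 := by
    rw [hP, integral_prod]
    · have hz : ∀ θ : Sph n, ∫ r, c θ * (r ^ (α - 1) * (K2 (θ, r) + (n + α) * K3 (θ, r)))
          ∂(radialMeasure (n : ℝ)) = 0 := by
        intro θ
        have := integral_radial_div hn0 hα hφ h0 θ
        calc _ = ∫ r, (c θ * inner ℝ (θ : Amb n) e) * (r ^ (α - 1) *
              (r * fderiv ℝ φ (r • (θ : Amb n)) (θ : Amb n) +
              (n + α) * φ (r • (θ : Amb n)))) ∂(radialMeasure (n : ℝ)) := by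
              congr 1; ext r; simp only [hK2, hK3]; ring
          _ = 0 := by rw [integral_const_mul, this, mul_zero]
      simp only [hz, integral_zero]
    · refine (i2.add (i3.const_mul ((n : ℝ) + α))).congr (ae_of_all _ fun p => ?_)
      simp only [Pi.add_apply]; ring
  -- passage to polar coordinates
  have hm1 : AEStronglyMeasurable (fun X => homExt α c X * fderiv ℝ φ X e) (ballMeasure n 0) := by
    have h1 := (memLp_homExt ha0 (by linarith : 0 ≤ α) hc).1.mono_ac
      ((ballMeasure_ac n 0).trans (restrict_ball_ac n a))
    exact h1.mul (hD.clm_apply continuous_const).aestronglyMeasurable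
  have hm2 : AEStronglyMeasurable (fun X => homGrad α c G X i * φ X) (ballMeasure n 0) := by
    have h1 := (memLp_homGrad ha0 hα hc hG.1).1.mono_ac
      ((ballMeasure_ac n 0).trans (restrict_ball_ac n a))
    have h2 : AEStronglyMeasurable (fun X => homGrad α c G X i) (ballMeasure n 0) :=
      (h1.inner (aestronglyMeasurable_const (b := e))).congr (ae_of_all _ fun X => hei _)
    exact h2.mul hφ.continuous.aestronglyMeasurable
  rw [← ballMeasure_zero, integral_ballMeasure_polar hm1, integral_ballMeasure_polar hm2,
    sphereMeasure_zero, add_zero, ← hP]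
  have q1 : (fun p => homExt α c (polarMap p) * fderiv ℝ φ (polarMap p) e) =ᵐ[P]
      fun p => c p.1 * (p.2 ^ (α - 1) * K1 p) := by
    filter_upwards [hr] with p hp
    have h1 : polarMap p ≠ 0 := smul_ne_zero hp.1.ne' (ne_zero_of_mem_unit_sphere p.1)
    have h2 : ‖polarMap p‖ = p.2 := by
      rw [polarMap, norm_smul, norm_sph, mul_one, Real.norm_eq_abs, abs_of_pos hp.1]
    rw [homExt, radialExt_eq c h1, h2, polarMap, dirMap_smul p.1 hp.1, hK1]
    have h3 : p.2 ^ α = p.2 ^ (α - 1) * p.2 := by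
      rw [← Real.rpow_add_one hp.1.ne', sub_add_cancel]
    rw [h3]; ring
  have q2 : (fun p => homGrad α c G (polarMap p) i * φ (polarMap p)) =ᵐ[P]
      fun p => α * (c p.1 * (p.2 ^ (α - 1) * K3 p)) +
        inner ℝ (G p.1) e * (p.2 ^ (α - 1) * φ (p.2 • (p.1 : Amb n))) := by
    filter_upwards [hr] with p hp
    have h2 : ‖polarMap p‖ = p.2 := by
      rw [polarMap, norm_smul, norm_sph, mul_one, Real.norm_eq_abs, abs_of_pos hp.1]
    rw [← hei, homGrad, h2, polarMap, dirMap_smul p.1 hp.1, real_inner_smul_left, inner_add_left,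
      real_inner_smul_left, hK3]
    ring
  rw [integral_congr_ae q1, integral_congr_ae q2, integral_add (i3.const_mul α) i4,
    integral_const_mul]
  have sA : ∫ p, c p.1 * (p.2 ^ (α - 1) * K1 p) ∂P - ∫ p, c p.1 * (p.2 ^ (α - 1) * K2 p) ∂P -
      n * ∫ p, c p.1 * (p.2 ^ (α - 1) * K3 p) ∂P +
      ∫ p, inner ℝ (G p.1) e * (p.2 ^ (α - 1) * φ (p.2 • (p.1 : Amb n))) ∂P = 0 := by
    have k1 := i1.sub i2
    have k2 := k1.sub (i3.const_mul (n : ℝ))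
    rw [← integral_const_mul, ← integral_sub' i1 i2, ← integral_sub' k1 (i3.const_mul (n : ℝ)),
      ← integral_add' k2 i4]
    refine (integral_congr_ae (ae_of_all _ fun p => ?_)).trans hA
    simp only [hK1, hK2, hK3, Pi.sub_apply, Pi.add_apply]; ring
  have sB : ∫ p, c p.1 * (p.2 ^ (α - 1) * K2 p) ∂P +
      (n + α) * ∫ p, c p.1 * (p.2 ^ (α - 1) * K3 p) ∂P = 0 := by
    rw [← hB, ← integral_const_mul, ← integral_add i2 (i3.const_mul ((n : ℝ) + α))]
    congr 1; ext p
    ring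
  -- Adding the spherical and radial identities cancels the radial derivatives and the curvature
  -- term n against the Jacobian; the remaining α is the radial derivative of r^α.
  linarith

end Ball

section WeakGrad

variable {n : ℕ} {a : ℝ}

/-! ### Uniqueness of weak gradients and of traces -/

theorem IsWeakGrad.add (ha : a < 1) {v v' : Amb n → ℝ} {G G' : Amb n → Amb n}
    (hv : MemLp v 2 (ballMeasure n a)) (hv' : MemLp v' 2 (ballMeasure n a))
    (h : IsWeakGrad a v G) (h' : IsWeakGrad a v' G') :
    IsWeakGrad a (fun X => v X + v' X) (fun X => G X + G' X) := by
  refine ⟨h.1.add h'.1, fun φ hφ hφc hφs i => ?_⟩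
  have hD : Continuous fun X => fderiv ℝ φ X (EuclideanSpace.single i 1) :=
    (hφ.continuous_fderiv (by simp)).clm_apply continuous_const
  have hDc : HasCompactSupport fun X => fderiv ℝ φ X (EuclideanSpace.single i 1) :=
    hφc.fderiv_apply ℝ _
  obtain ⟨M, hM⟩ := hφ.continuous.bounded_above_of_compact_support hφc
  obtain ⟨M', hM'⟩ := hD.bounded_above_of_compact_support hDc
  have hGi : ∀ {G : Amb n → Amb n}, MemLp G 2 (ballMeasure n a) →
      Integrable (fun X => G X i) (volume.restrict (Metric.ball (0 : Amb n) 1)) := fun hG =>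
    (EuclideanSpace.proj (𝕜 := ℝ) i).integrable_comp (MemLp.integrable_ball ha hG)
  have i1 := (MemLp.integrable_ball ha hv).mul_bdd hD.aestronglyMeasurable (ae_of_all _ hM')
  have i2 := (MemLp.integrable_ball ha hv').mul_bdd hD.aestronglyMeasurable (ae_of_all _ hM')
  have i3 := (hGi h.1).mul_bdd hφ.continuous.aestronglyMeasurable (ae_of_all _ hM)
  have i4 := (hGi h'.1).mul_bdd hφ.continuous.aestronglyMeasurable (ae_of_all _ hM)
  have e1 : ∀ X, (G X + G' X) i * φ X = G X i * φ X + G' X i * φ X := fun X => by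
    rw [PiLp.add_apply, add_mul]
  simp only [add_mul, e1]
  rw [integral_add i1 i2, integral_add i3 i4, h.2 φ hφ hφc hφs i, h'.2 φ hφ hφc hφs i]
  ring

theorem IsWeakGrad.unique (ha : a < 1) {v : Amb n → ℝ} {G G' : Amb n → Amb n}
    (h : IsWeakGrad a v G) (h' : IsWeakGrad a v G') : G =ᵐ[ballMeasure n a] G' := by
  have hGi : ∀ {G : Amb n → Amb n} (i : Fin (n + 1)), MemLp G 2 (ballMeasure n a) →
      Integrable (fun X => G X i) (volume.restrict (Metric.ball (0 : Amb n) 1)) := fun i hG =>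
    (EuclideanSpace.proj (𝕜 := ℝ) i).integrable_comp (MemLp.integrable_ball ha hG)
  have key : ∀ i : Fin (n + 1), ∀ᵐ X ∂(volume.restrict (Metric.ball (0 : Amb n) 1)),
      G X i - G' X i = 0 := by
    intro i
    have j1 := hGi i h.1
    have j2 := hGi i h'.1
    have h0 := Metric.isOpen_ball.ae_eq_zero_of_integral_contDiff_smul_eq_zero
      (U := Metric.ball (0 : Amb n) 1) (μ := volume.restrict (Metric.ball (0 : Amb n) 1))
      (f := fun X => G X i - G' X i) ((j1.sub j2).locallyIntegrable.locallyIntegrableOn _)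
      (by
        intro φ hφ hφc hφs
        obtain ⟨M, hM⟩ := hφ.continuous.bounded_above_of_compact_support hφc
        have i3 := j1.mul_bdd hφ.continuous.aestronglyMeasurable (ae_of_all _ hM)
        have i4 := j2.mul_bdd hφ.continuous.aestronglyMeasurable (ae_of_all _ hM)
        have e1 := h.2 φ hφ hφc hφs i
        have e2 := h'.2 φ hφ hφc hφs i
        simp only [smul_eq_mul, mul_comm (φ _), sub_mul]
        rw [integral_sub i3 i4]
        linarith)
    filter_upwards [h0, ae_restrict_mem measurableSet_ball] with X h1 h2 using h1 h2
  rw [Filter.EventuallyEq, ae_ballMeasure_iff]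
  filter_upwards [ae_all_iff.2 key] with X hX
  ext i
  exact sub_eq_zero.1 (hX i)

/-- The energy refers to a chosen weak gradient; uniqueness allows it to be computed with any
explicit one. -/
theorem weakGrad_ae_eq (ha : a < 1) {v : Amb n → ℝ} {G : Amb n → Amb n} (h : IsWeakGrad a v G) :
    weakGrad a v =ᵐ[ballMeasure n a] G := by
  have hex : ∃ G, IsWeakGrad a v G := ⟨G, h⟩
  have : weakGrad a v = hex.choose := by simp [weakGrad, hex]
  rw [this]
  exact hex.choose_spec.unique ha h

theorem enorm_add_sq_le (x y : ℝ) : ‖x + y‖ₑ ^ 2 ≤ 2 * ‖x‖ₑ ^ 2 + 2 * ‖y‖ₑ ^ 2 := by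
  have h : ∀ z : ℝ, ‖z‖ₑ ^ 2 = ENNReal.ofReal (z ^ 2) := fun z => by
    rw [Real.enorm_eq_ofReal_abs, ← ENNReal.ofReal_pow (abs_nonneg _), sq_abs]
  rw [h, h, h, ← ENNReal.ofReal_ofNat 2, ← ENNReal.ofReal_mul (by norm_num),
    ← ENNReal.ofReal_mul (by norm_num), ← ENNReal.ofReal_add (by positivity) (by positivity)]
  apply ENNReal.ofReal_le_ofReal
  nlinarith [sq_nonneg (x - y)]

theorem aestronglyMeasurable_radialExt {c : Sph n → ℝ}
    (hc : AEStronglyMeasurable c (sphereMeasure n a)) :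
    AEStronglyMeasurable (radialExt c) (ballMeasure n a) := by
  refine (aestronglyMeasurable_comp_dirMap hc).congr ?_
  filter_upwards [ae_ball_ne_zero n a] with X hX
  rw [radialExt_eq c hX]

theorem measurableSet_shell (ε : ℝ) : MeasurableSet {X : Amb n | 1 - ε < ‖X‖} :=
  measurableSet_lt measurable_const measurable_norm

theorem IsSphereTrace.add {v v' : Amb n → ℝ} {c c' : Sph n → ℝ}
    (hv : AEStronglyMeasurable v (ballMeasure n a)) (h : IsSphereTrace a v c)
    (h' : IsSphereTrace a v' c') :
    IsSphereTrace a (fun X => v X + v' X) (fun θ => c θ + c' θ) := by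
  refine ⟨h.1.add h'.1, ?_⟩
  have hlim := (ENNReal.Tendsto.const_mul h.2 (Or.inr (by norm_num : (2 : ℝ≥0∞) ≠ ⊤))).add
    (ENNReal.Tendsto.const_mul h'.2 (Or.inr (by norm_num : (2 : ℝ≥0∞) ≠ ⊤)))
  simp only [mul_zero, add_zero] at hlim
  refine tendsto_of_tendsto_of_tendsto_of_le_of_le tendsto_const_nhds hlim
    (fun _ => zero_le) fun ε => ?_
  have hm : AEMeasurable (fun X => 2 * ‖v X - radialExt c X‖ₑ ^ 2) (ballMeasure n a) :=
    ((hv.sub (aestronglyMeasurable_radialExt h.1.1)).enorm.pow_const 2).const_mul 2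
  calc _ ≤ (ENNReal.ofReal ε)⁻¹ * ∫⁻ X in {X : Amb n | 1 - ε < ‖X‖},
        (2 * ‖v X - radialExt c X‖ₑ ^ 2 + 2 * ‖v' X - radialExt c' X‖ₑ ^ 2)
        ∂(ballMeasure n a) := by
        gcongr with X
        have : v X + v' X - radialExt (fun θ => c θ + c' θ) X =
            (v X - radialExt c X) + (v' X - radialExt c' X) := by
          by_cases hX : X = 0
          · simp [radialExt, hX]
          · rw [radialExt_eq _ hX, radialExt_eq _ hX, radialExt_eq _ hX]; ring
        rw [this]
        exact enorm_add_sq_le _ _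
    _ = _ := by
        rw [lintegral_add_left' hm.restrict, lintegral_const_mul' _ _ (by norm_num),
          lintegral_const_mul' _ _ (by norm_num)]
        ring

/-- On the shell the difference is (r^α - 1) c, of size at most αε|c|. The squared integral is O(ε²)
and division by ε still tends to zero. -/
theorem isSphereTrace_homExt (ha : -1 < a) {α : ℝ} (hα : 1 ≤ α) {c : Sph n → ℝ}
    (hc : MemLp c 2 (sphereMeasure n a)) : IsSphereTrace a (homExt α c) c := by
  refine ⟨hc, ?_⟩
  set K := ∫⁻ X, ‖c (dirMap X)‖ₑ ^ 2 ∂(ballMeasure n a) with hK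
  have hKt : K ≠ ⊤ := by
    have := (memLp_comp_dirMap ha hc).eLpNorm_lt_top
    rw [eLpNorm_lt_top_iff_lintegral_rpow_enorm_lt_top (by norm_num) (by norm_num)] at this
    simpa using this.ne
  have hlim : Tendsto (fun ε : ℝ => ENNReal.ofReal (α ^ 2 * ε) * K) (𝓝[>] 0) (𝓝 0) := by
    have h1 : Tendsto (fun ε : ℝ => ENNReal.ofReal (α ^ 2 * ε)) (𝓝[>] 0) (𝓝 0) := by
      have : Tendsto (fun ε : ℝ => ENNReal.ofReal (α ^ 2 * ε)) (𝓝 0)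
          (𝓝 (ENNReal.ofReal (α ^ 2 * 0))) :=
        (ENNReal.continuous_ofReal.comp (by fun_prop)).tendsto _
      simp only [mul_zero, ENNReal.ofReal_zero] at this
      exact this.mono_left nhdsWithin_le_nhds
    simpa using ENNReal.Tendsto.mul_const h1 (Or.inr hKt)
  refine tendsto_of_tendsto_of_tendsto_of_le_of_le' tendsto_const_nhds hlim
    (Eventually.of_forall fun _ => zero_le) ?_
  filter_upwards [self_mem_nhdsWithin] with ε hε
  have hε0 : (0 : ℝ) < ε := hε
  have hsplit : ENNReal.ofReal (α ^ 2 * ε ^ 2) = ENNReal.ofReal ε * ENNReal.ofReal (α ^ 2 * ε) := by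
    rw [← ENNReal.ofReal_mul hε0.le]; congr 1; ring
  calc _ ≤ (ENNReal.ofReal ε)⁻¹ * ∫⁻ X in {X : Amb n | 1 - ε < ‖X‖},
        ENNReal.ofReal (α ^ 2 * ε ^ 2) * ‖c (dirMap X)‖ₑ ^ 2 ∂(ballMeasure n a) := by
        refine mul_le_mul_right (lintegral_mono_ae ?_) _
        filter_upwards [ae_restrict_mem (measurableSet_shell ε),
          ae_restrict_of_ae (ae_ball_norm_mem n a)] with X h1 h2
        have hX : X ≠ 0 := norm_pos_iff.1 h2.1
        have h1' : 1 - ε < ‖X‖ := h1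
        rw [homExt, radialExt_eq c hX]
        have e1 : ‖X‖ ^ α * c (dirMap X) - c (dirMap X) = (‖X‖ ^ α - 1) * c (dirMap X) := by ring
        rw [e1, enorm_mul, mul_pow]
        gcongr
        rw [Real.enorm_eq_ofReal_abs, ← ENNReal.ofReal_pow (abs_nonneg _), ← mul_pow]
        apply ENNReal.ofReal_le_ofReal
        -- Bernoulli's inequality gives 1 - r^α ≤ α(1-r); this is where α ≥ 1 enters.
        have hb := one_add_mul_self_le_rpow_one_add (s := ‖X‖ - 1) (by linarith) hα
        rw [add_sub_cancel] at hb
        have hl : ‖X‖ ^ α ≤ 1 := Real.rpow_le_one h2.1.le h2.2.le (by linarith)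
        have : |‖X‖ ^ α - 1| ≤ α * ε := by
          rw [abs_of_nonpos (by linarith)]
          nlinarith
        gcongr
    _ ≤ (ENNReal.ofReal ε)⁻¹ * (ENNReal.ofReal (α ^ 2 * ε ^ 2) * K) := by
        rw [lintegral_const_mul' _ _ ENNReal.ofReal_ne_top]
        exact mul_le_mul_right (mul_le_mul_right (setLIntegral_le_lintegral _ _) _) _
    _ = _ := by
        rw [hsplit, ← mul_assoc, ← mul_assoc, ENNReal.inv_mul_cancel, one_mul]
        · simpa using hε0
        · exact ENNReal.ofReal_ne_top

/-- The shell has mass at least a fixed multiple of ε, so that the normalization by ε in the trace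
condition cannot hide a nonzero difference. -/
theorem radialMeasure_shell_ge {b : ℝ} (hb : 0 ≤ b) {ε : ℝ} (hε : 0 < ε) (hε2 : ε ≤ 1 / 2) :
    ENNReal.ofReal ((1 / 2) ^ b) * ENNReal.ofReal ε ≤ radialMeasure b (Set.Ioi (1 - ε)) := by
  unfold radialMeasure
  rw [withDensity_apply _ measurableSet_Ioi, Measure.restrict_restrict measurableSet_Ioi]
  calc _ = ∫⁻ _ in Set.Ioo (1 - ε) 1, ENNReal.ofReal ((1 / 2) ^ b) := by
        rw [setLIntegral_const, Real.volume_Ioo]; congr 2; ring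
    _ ≤ ∫⁻ r in Set.Ioo (1 - ε) 1, ENNReal.ofReal (r ^ b) := by
        refine setLIntegral_mono' measurableSet_Ioo fun r hr => ?_
        apply ENNReal.ofReal_le_ofReal
        exact Real.rpow_le_rpow (by norm_num) (by linarith [hr.1]) hb
    _ ≤ _ := by
        apply lintegral_mono_set
        intro r hr
        exact ⟨hr.1, by linarith [hr.1], hr.2⟩

theorem setLIntegral_shell (f : Sph n → ℝ≥0∞) (hf : AEMeasurable f (sphereMeasure n a)) (ε : ℝ) :
    ∫⁻ X in {X : Amb n | 1 - ε < ‖X‖}, f (dirMap X) ∂(ballMeasure n a) =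
      (∫⁻ θ, f θ ∂(sphereMeasure n a)) * radialMeasure (n + a) (Set.Ioi (1 - ε)) := by
  have hm : AEMeasurable (fun X => f (dirMap X)) (ballMeasure n a) :=
    hf.comp_quasiMeasurePreserving (quasiMeasurePreserving_dirMap n a)
  have hm' := hm.indicator (measurableSet_shell (n := n) ε)
  rw [← lintegral_indicator (measurableSet_shell ε)]
  rw [← (measurePreserving_polarMap n a).map_eq] at hm' ⊢
  rw [lintegral_map' hm' measurable_polarMap.aemeasurable,
    ← lintegral_indicator_one measurableSet_Ioi, ← lintegral_prod_mul hf
      (measurable_one.indicator measurableSet_Ioi).aemeasurable]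
  apply lintegral_congr_ae
  filter_upwards [ae_prod_radial_mem _ _] with p hp
  have h2 : ‖polarMap p‖ = p.2 := by
    rw [polarMap, norm_smul, norm_sph, mul_one, Real.norm_eq_abs, abs_of_pos hp.1]
  by_cases h : 1 - ε < p.2
  · rw [Set.indicator_of_mem (by simpa [h2] using h), Set.indicator_of_mem (by simpa using h),
      polarMap, dirMap_smul p.1 hp.1]
    simp
  · rw [Set.indicator_of_notMem (by simpa [h2] using h), Set.indicator_of_notMem (by simpa using h),
      mul_zero]

/-- The shell integral of |c - c'|² is its spherical integral times a shell mass comparable from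
below to ε. After division by ε it stays above a positive multiple of ∫|c - c'|², whereas both trace
conditions send it to zero. -/
theorem IsSphereTrace.unique (hna : 0 ≤ (n : ℝ) + a) {v : Amb n → ℝ}
    (hv : AEStronglyMeasurable v (ballMeasure n a)) {c c' : Sph n → ℝ} (h : IsSphereTrace a v c)
    (h' : IsSphereTrace a v c') : c =ᵐ[sphereMeasure n a] c' := by
  set f : Sph n → ℝ≥0∞ := fun θ => ‖c θ - c' θ‖ₑ ^ 2 with hf
  have hfm : AEMeasurable f (sphereMeasure n a) := (h.1.1.sub h'.1.1).enorm.pow_const 2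
  have hlim := (ENNReal.Tendsto.const_mul h.2 (Or.inr (by norm_num : (2 : ℝ≥0∞) ≠ ⊤))).add
    (ENNReal.Tendsto.const_mul h'.2 (Or.inr (by norm_num : (2 : ℝ≥0∞) ≠ ⊤)))
  simp only [mul_zero, add_zero] at hlim
  have hle : (∫⁻ θ, f θ ∂(sphereMeasure n a)) * ENNReal.ofReal ((1 / 2) ^ ((n : ℝ) + a)) ≤ 0 := by
    refine ge_of_tendsto hlim ?_
    have hsmall : ∀ᶠ ε : ℝ in 𝓝[>] 0, ε ≤ 1 / 2 :=
      (eventually_le_nhds (by norm_num : (0 : ℝ) < 1 / 2)).filter_mono nhdsWithin_le_nhds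
    filter_upwards [self_mem_nhdsWithin, hsmall] with ε hε hε2
    have hε0 : (0 : ℝ) < ε := hε
    have hne : ENNReal.ofReal ε ≠ 0 := by simpa using hε0
    have hm : AEMeasurable (fun X => 2 * ‖v X - radialExt c X‖ₑ ^ 2) (ballMeasure n a) :=
      ((hv.sub (aestronglyMeasurable_radialExt h.1.1)).enorm.pow_const 2).const_mul 2
    calc _ = (ENNReal.ofReal ε)⁻¹ * ((∫⁻ θ, f θ ∂(sphereMeasure n a)) *
          (ENNReal.ofReal ((1 / 2) ^ ((n : ℝ) + a)) * ENNReal.ofReal ε)) := by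
          rw [← mul_assoc (∫⁻ θ, f θ ∂(sphereMeasure n a)), mul_comm _ (ENNReal.ofReal ε),
            ← mul_assoc, ENNReal.inv_mul_cancel hne ENNReal.ofReal_ne_top, one_mul]
      _ ≤ (ENNReal.ofReal ε)⁻¹ * ((∫⁻ θ, f θ ∂(sphereMeasure n a)) *
          radialMeasure (n + a) (Set.Ioi (1 - ε))) := by
          gcongr
          exact radialMeasure_shell_ge hna hε0 hε2
      _ = (ENNReal.ofReal ε)⁻¹ * ∫⁻ X in {X : Amb n | 1 - ε < ‖X‖}, f (dirMap X)
          ∂(ballMeasure n a) := by rw [setLIntegral_shell f hfm]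
      _ ≤ (ENNReal.ofReal ε)⁻¹ * ∫⁻ X in {X : Amb n | 1 - ε < ‖X‖},
          (2 * ‖v X - radialExt c X‖ₑ ^ 2 + 2 * ‖v X - radialExt c' X‖ₑ ^ 2)
          ∂(ballMeasure n a) := by
          refine mul_le_mul_right (lintegral_mono_ae (ae_restrict_of_ae ?_)) _
          filter_upwards [ae_ball_ne_zero n a] with X hX
          have : c (dirMap X) - c' (dirMap X) =
              -(v X - radialExt c X) + (v X - radialExt c' X) := by
            rw [radialExt_eq _ hX, radialExt_eq _ hX]; ring
          rw [hf]
          simp only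
          rw [this]
          refine (enorm_add_sq_le _ _).trans ?_
          rw [enorm_neg]
      _ = _ := by
          rw [lintegral_add_left' hm.restrict, lintegral_const_mul' _ _ (by norm_num),
            lintegral_const_mul' _ _ (by norm_num)]
          ring
  have hz : ∫⁻ θ, f θ ∂(sphereMeasure n a) = 0 := by
    rcases mul_eq_zero.1 (le_antisymm hle (zero_le)) with h0 | h0
    · exact h0
    · rw [ENNReal.ofReal_eq_zero] at h0
      have : (0 : ℝ) < (1 / 2) ^ ((n : ℝ) + a) := by positivity
      linarith
  rw [lintegral_eq_zero_iff' hfm] at hz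
  filter_upwards [hz] with θ hθ
  simpa [hf, sub_eq_zero] using hθ

theorem sphereTrace_ae_eq (hna : 0 ≤ (n : ℝ) + a) {v : Amb n → ℝ}
    (hv : AEStronglyMeasurable v (ballMeasure n a)) {c : Sph n → ℝ} (h : IsSphereTrace a v c) :
    sphereTrace a v =ᵐ[sphereMeasure n a] c := by
  have hex : ∃ c, IsSphereTrace a v c := ⟨c, h⟩
  have : sphereTrace a v = hex.choose := by simp [sphereTrace, hex]
  rw [this]
  exact hex.choose_spec.unique hna hv h

/-! ### The energy of a sum of two homogeneous functions -/

/-- Weak gradients are tangential, so radial and tangential components are orthogonal. Every term is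
a spherical function times a power of r, and r^(α+β-2) integrates against r^(n+a) to 1/(n+a+α+β-1).
-/
theorem integral_norm_sq_homGrad_add (hna : 0 ≤ (n : ℝ) + a) (ha0 : -1 < a) (ha1 : a < 1) {α β : ℝ}
    (hα : 1 ≤ α) (hβ : 1 ≤ β) {ψ φ : Sph n → ℝ} {Gψ Gφ : Sph n → Amb n}
    (hψ : MemLp ψ 2 (sphereMeasure n a)) (hφ : MemLp φ 2 (sphereMeasure n a))
    (hGψ : IsWeakSphereGrad a ψ Gψ) (hGφ : IsWeakSphereGrad a φ Gφ) :
    ∫ X, ‖homGrad α ψ Gψ X + homGrad β φ Gφ X‖ ^ 2 ∂(ballMeasure n a) =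
      (α ^ 2 * ∫ θ, ψ θ ^ 2 ∂(sphereMeasure n a) + ∫ θ, ‖Gψ θ‖ ^ 2 ∂(sphereMeasure n a)) *
        (1 / (n + a + 2 * α - 1)) +
      2 * (α * β * ∫ θ, ψ θ * φ θ ∂(sphereMeasure n a) +
        ∫ θ, inner ℝ (Gψ θ) (Gφ θ) ∂(sphereMeasure n a)) * (1 / (n + a + α + β - 1)) +
      (β ^ 2 * ∫ θ, φ θ ^ 2 ∂(sphereMeasure n a) + ∫ θ, ‖Gφ θ‖ ^ 2 ∂(sphereMeasure n a)) *
        (1 / (n + a + 2 * β - 1)) := by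
  have i1 := (hψ.integrable_sq).const_mul (α ^ 2)
  have i2 : Integrable (fun θ => ‖Gψ θ‖ ^ 2) (sphereMeasure n a) := hGψ.1.integrable_norm_pow (by norm_num)
  have i3 := (integrable_mul_of_memLp hψ hφ).const_mul (α * β)
  have i4 := integrable_inner_of_memLp hGψ.1 hGφ.1
  have i5 := (hφ.integrable_sq).const_mul (β ^ 2)
  have i6 : Integrable (fun θ => ‖Gφ θ‖ ^ 2) (sphereMeasure n a) := hGφ.1.integrable_norm_pow (by norm_num)
  have r1 := integrable_rpow_radialMeasure (b := n + a) (t := 2 * α - 2) (by linarith)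
  have r2 := integrable_rpow_radialMeasure (b := n + a) (t := α + β - 2) (by linarith)
  have r3 := integrable_rpow_radialMeasure (b := n + a) (t := 2 * β - 2) (by linarith)
  have t1 := (integrable_add_fun i1 i2).mul_prod r1
  have t2 := ((integrable_add_fun i3 i4).const_mul 2).mul_prod r2
  have t3 := (integrable_add_fun i5 i6).mul_prod r3
  have hm : AEStronglyMeasurable (fun X => ‖homGrad α ψ Gψ X + homGrad β φ Gφ X‖ ^ 2)
      (ballMeasure n a) :=
    ((memLp_homGrad ha0 hα hψ hGψ.1).add (memLp_homGrad ha0 hβ hφ hGφ.1)).1.norm.pow 2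
  have htan : ∀ᵐ p ∂((sphereMeasure n a).prod (radialMeasure (n + a))),
      inner ℝ (Gψ p.1) (p.1 : Amb n) = 0 ∧ inner ℝ (Gφ p.1) (p.1 : Amb n) = 0 := by
    have h := ((ae_sphereMeasure_iff a).2 (hGψ.tangential ha1 hψ)).and
      ((ae_sphereMeasure_iff a).2 (hGφ.tangential ha1 hφ))
    exact Measure.quasiMeasurePreserving_fst.ae h
  have hpt : (fun p => ‖homGrad α ψ Gψ (polarMap p) + homGrad β φ Gφ (polarMap p)‖ ^ 2)
      =ᵐ[(sphereMeasure n a).prod (radialMeasure (n + a))] fun p =>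
      (α ^ 2 * ψ p.1 ^ 2 + ‖Gψ p.1‖ ^ 2) * p.2 ^ (2 * α - 2) +
      2 * (α * β * (ψ p.1 * φ p.1) + inner ℝ (Gψ p.1) (Gφ p.1)) * p.2 ^ (α + β - 2) +
      (β ^ 2 * φ p.1 ^ 2 + ‖Gφ p.1‖ ^ 2) * p.2 ^ (2 * β - 2) := by
    filter_upwards [htan, ae_prod_radial_mem _ _] with p ⟨hp1, hp2⟩ hp
    have h2 : ‖polarMap p‖ = p.2 := by
      rw [polarMap, norm_smul, norm_sph, mul_one, Real.norm_eq_abs, abs_of_pos hp.1]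
    have e1 : p.2 ^ (2 * α - 2) = p.2 ^ (α - 1) * p.2 ^ (α - 1) := by
      rw [← Real.rpow_add hp.1]; congr 1; ring
    have e2 : p.2 ^ (α + β - 2) = p.2 ^ (α - 1) * p.2 ^ (β - 1) := by
      rw [← Real.rpow_add hp.1]; congr 1; ring
    have e3 : p.2 ^ (2 * β - 2) = p.2 ^ (β - 1) * p.2 ^ (β - 1) := by
      rw [← Real.rpow_add hp.1]; congr 1; ring
    have hθθ : inner ℝ (p.1 : Amb n) (p.1 : Amb n) = (1 : ℝ) := by
      rw [real_inner_self_eq_norm_sq, norm_sph, one_pow]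
    have hp1' : inner ℝ (p.1 : Amb n) (Gψ p.1) = 0 := by rw [real_inner_comm]; exact hp1
    have hp2' : inner ℝ (p.1 : Amb n) (Gφ p.1) = 0 := by rw [real_inner_comm]; exact hp2
    simp only [homGrad, h2]
    rw [polarMap, dirMap_smul p.1 hp.1, ← real_inner_self_eq_norm_sq,
      ← real_inner_self_eq_norm_sq (Gψ p.1), ← real_inner_self_eq_norm_sq (Gφ p.1), e1, e2, e3]
    simp only [inner_add_left, inner_add_right, real_inner_smul_left, real_inner_smul_right, hp1, hp2,
      hp1', hp2', hθθ, real_inner_comm (Gψ p.1) (Gφ p.1)]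
    ring
  rw [integral_ballMeasure_polar hm, integral_congr_ae hpt, integral_add (integrable_add_fun t1 t2) t3,
    integral_add t1 t2, integral_prod_mul (fun θ => α ^ 2 * ψ θ ^ 2 + ‖Gψ θ‖ ^ 2)
      (fun r : ℝ => r ^ (2 * α - 2)),
    integral_prod_mul (fun θ => 2 * (α * β * (ψ θ * φ θ) + inner ℝ (Gψ θ) (Gφ θ)))
      (fun r : ℝ => r ^ (α + β - 2)),
    integral_prod_mul (fun θ => β ^ 2 * φ θ ^ 2 + ‖Gφ θ‖ ^ 2) (fun r : ℝ => r ^ (2 * β - 2)),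
    integral_rpow_radialMeasure (by linarith), integral_rpow_radialMeasure (by linarith),
    integral_rpow_radialMeasure (by linarith), integral_add i1 i2, integral_const_mul 2,
    integral_add i3 i4, integral_add i5 i6, integral_const_mul, integral_const_mul,
    integral_const_mul]
  rw [show (n : ℝ) + a + (2 * α - 2) + 1 = n + a + 2 * α - 1 by ring,
    show (n : ℝ) + a + (α + β - 2) + 1 = n + a + α + β - 1 by ring,
    show (n : ℝ) + a + (2 * β - 2) + 1 = n + a + 2 * β - 1 by ring]

end WeakGrad

section ThinTrace

variable {n : ℕ}

/-! ### The splitting of the ambient space -/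

theorem inner_eq_inner_xPart_add (X Z : Amb n) :
    inner ℝ X Z = inner ℝ (xPart X) (xPart Z) + yCoord X * yCoord Z := by
  simp only [PiLp.inner_apply, Fin.sum_univ_castSucc, xPart, yCoord]
  simp [mul_comm]

theorem norm_sq_eq_xPart_add (X : Amb n) : ‖X‖ ^ 2 = ‖xPart X‖ ^ 2 + yCoord X ^ 2 := by
  rw [← real_inner_self_eq_norm_sq, inner_eq_inner_xPart_add, real_inner_self_eq_norm_sq]; ring

theorem norm_xPart_le (X : Amb n) : ‖xPart X‖ ≤ ‖X‖ := by
  have := norm_sq_eq_xPart_add X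
  refine le_of_sq_le_sq ?_ (norm_nonneg _)
  nlinarith [sq_nonneg (yCoord X)]

theorem norm_le_xPart_add (X : Amb n) : ‖X‖ ≤ ‖xPart X‖ + |yCoord X| := by
  have := norm_sq_eq_xPart_add X
  refine le_of_sq_le_sq ?_ (by positivity)
  have h2 : yCoord X ^ 2 = |yCoord X| ^ 2 := (sq_abs _).symm
  nlinarith [mul_nonneg (norm_nonneg (xPart X)) (abs_nonneg (yCoord X))]

theorem measurePreserving_split (n : ℕ) :
    MeasurePreserving (fun X : Amb n => (yCoord X, xPart X)) volume
      ((volume : Measure ℝ).prod (volume : Measure (EuclideanSpace ℝ (Fin n)))) := by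
  have h1 := PiLp.volume_preserving_ofLp (Fin (n + 1))
  have h2 := volume_preserving_piFinSuccAbove (fun _ : Fin (n + 1) => ℝ) (Fin.last n)
  have h3 := (MeasurePreserving.id (volume : Measure ℝ)).prod (PiLp.volume_preserving_toLp (Fin n))
  have h4 := h3.comp (h2.comp h1)
  have h5 : (fun X : Amb n => (yCoord X, xPart X)) =
      Prod.map id (WithLp.toLp 2) ∘
        (MeasurableEquiv.piFinSuccAbove (fun _ => ℝ) (Fin.last n)) ∘ WithLp.ofLp := by
    funext X
    refine Prod.ext rfl ?_
    ext i
    simp [xPart]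
    rfl
  rw [h5]
  exact h4

/-- The slab projects into the thin ball, and each vertical fibre has length at most 2ε. -/
theorem map_xPart_slab_le (n : ℕ) (ε : ℝ) :
    Measure.map xPart (volume.restrict (Metric.ball (0 : Amb n) 1 ∩ {X : Amb n | |yCoord X| < ε})) ≤
      ENNReal.ofReal (2 * ε) •
        volume.restrict (Metric.ball (0 : EuclideanSpace ℝ (Fin n)) 1) := by
  have hsp := measurePreserving_split n
  have hx : Measurable (xPart : Amb n → EuclideanSpace ℝ (Fin n)) := measurable_snd.comp hsp.measurable
  refine Measure.le_iff.2 fun t ht => ?_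
  rw [Measure.map_apply hx ht, Measure.restrict_apply (hx ht), Measure.smul_apply,
    Measure.restrict_apply ht]
  have hsub : xPart ⁻¹' t ∩ (Metric.ball (0 : Amb n) 1 ∩ {X : Amb n | |yCoord X| < ε}) ⊆
      (fun X : Amb n => (yCoord X, xPart X)) ⁻¹' (Set.Ioo (-ε) ε ×ˢ (t ∩ Metric.ball 0 1)) := by
    rintro X ⟨h1, h2, h3⟩
    refine ⟨abs_lt.1 h3, h1, ?_⟩
    rw [mem_ball_zero_iff] at h2 ⊢
    exact (norm_xPart_le X).trans_lt h2
  refine (measure_mono hsub).trans ?_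
  rw [hsp.measure_preimage (measurableSet_Ioo.prod (ht.inter measurableSet_ball)).nullMeasurableSet,
    Measure.prod_prod, Real.volume_Ioo, smul_eq_mul]
  apply le_of_eq
  congr 2; ring

theorem rpow_sub_rpow_le {x y p : ℝ} (hy : 0 ≤ y) (hxy : y ≤ x) (hp0 : 0 ≤ p) (hp1 : p ≤ 1) :
    x ^ p - y ^ p ≤ (x - y) ^ p := by
  have := Real.rpow_add_le_add_rpow hy (sub_nonneg.2 hxy) hp0 hp1
  rw [add_sub_cancel] at this
  linarith

/-! ### Traces on the thin ball of interpolations -/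

/-- The factor ‖X‖^γ differs from its thin value by at most |y|^γ. The error thus consists of the
trace error of `v` and a remainder bounded by (ε^γ + ε^γ') times a square integrable function of x
alone, which vanishes after averaging over the slab. -/
theorem isThinTrace_interpolation {v Ψ : Amb n → ℝ} {τ Ψ₀ : EuclideanSpace ℝ (Fin n) → ℝ}
    (h : IsThinTrace v τ) (hΨ₀ : Continuous Ψ₀) {K M γ γ' : ℝ} (hK : 0 ≤ K) (hM : 0 ≤ M) (hγ0 : 0 < γ)
    (hγ1 : γ ≤ 1) (hγ' : 0 < γ')
    (hb : ∀ X ∈ Metric.ball (0 : Amb n) 1, |Ψ X - Ψ₀ (xPart X)| ≤ K * |yCoord X| ^ γ')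
    (hb₀ : ∀ x ∈ Metric.ball (0 : EuclideanSpace ℝ (Fin n)) 1, |Ψ₀ x| ≤ M) :
    IsThinTrace (fun X => ‖X‖ ^ γ * v X + (1 - ‖X‖ ^ γ) * Ψ X)
      (fun x => ‖x‖ ^ γ * τ x + (1 - ‖x‖ ^ γ) * Ψ₀ x) := by
  have hfin : IsFiniteMeasure (volume.restrict (Metric.ball (0 : EuclideanSpace ℝ (Fin n)) 1)) :=
    ⟨by simpa using measure_ball_lt_top⟩
  have hr01 : ∀ r : ℝ, 0 ≤ r → r < 1 → 0 ≤ r ^ γ ∧ r ^ γ ≤ 1 := fun r h0 h1 =>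
    ⟨Real.rpow_nonneg h0 _, Real.rpow_le_one h0 h1.le hγ0.le⟩
  have hmeas : Measurable fun x : EuclideanSpace ℝ (Fin n) => ‖x‖ ^ γ := by fun_prop
  refine ⟨MemLp.add ?_ ?_, ?_⟩
  · refine h.1.of_le (hmeas.aestronglyMeasurable.mul h.1.1) ?_
    filter_upwards [ae_restrict_mem measurableSet_ball] with x hx
    rw [mem_ball_zero_iff] at hx
    obtain ⟨h1, h2⟩ := hr01 _ (norm_nonneg x) hx
    rw [norm_mul, Real.norm_of_nonneg h1]
    exact mul_le_of_le_one_left (norm_nonneg _) h2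
  · refine MemLp.of_bound ((measurable_const.sub hmeas).mul hΨ₀.measurable).aestronglyMeasurable M ?_
    filter_upwards [ae_restrict_mem measurableSet_ball] with x hx
    have hx' := mem_ball_zero_iff.1 hx
    obtain ⟨h1, h2⟩ := hr01 _ (norm_nonneg x) hx'
    rw [norm_mul, Real.norm_of_nonneg (by linarith : 0 ≤ 1 - ‖x‖ ^ γ)]
    exact (mul_le_of_le_one_left (norm_nonneg _) (by linarith)).trans (hb₀ x hx)
  -- A majorant depending only on x, so that its average over the slab is controlled by its norm on
  -- the thin ball.
  · set g : EuclideanSpace ℝ (Fin n) → ℝ := fun x => |τ x| + (M + K) with hg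
    have hgm : MemLp g 2 (volume.restrict (Metric.ball (0 : EuclideanSpace ℝ (Fin n)) 1)) :=
      h.1.norm.add (memLp_const _)
    set I := ∫⁻ x in Metric.ball (0 : EuclideanSpace ℝ (Fin n)) 1, ‖g x‖ₑ ^ 2 with hI
    have hIt : I ≠ ⊤ := by
      have := hgm.eLpNorm_lt_top
      rw [eLpNorm_lt_top_iff_lintegral_rpow_enorm_lt_top (by norm_num) (by norm_num)] at this
      simpa using this.ne
    set η : ℝ → ℝ := fun ε => ε ^ γ + ε ^ γ' with hη
    have hηlim : Tendsto (fun ε : ℝ => 2 * (ENNReal.ofReal (η ε ^ 2) * (2 * I))) (𝓝[>] 0) (𝓝 0) := by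
      have hηc : Tendsto (fun ε : ℝ => ENNReal.ofReal (η ε ^ 2)) (𝓝 0)
          (𝓝 (ENNReal.ofReal (η 0 ^ 2))) := by
        refine (ENNReal.continuous_ofReal.comp ?_).tendsto _
        exact ((Real.continuous_rpow_const hγ0.le).add (Real.continuous_rpow_const hγ'.le)).pow 2
      have hη0 : η 0 = 0 := by simp [hη, Real.zero_rpow hγ0.ne', Real.zero_rpow hγ'.ne']
      rw [hη0] at hηc
      simp only [ne_eq, OfNat.ofNat_ne_zero, not_false_eq_true, zero_pow, ENNReal.ofReal_zero] at hηc
      have h1 := ENNReal.Tendsto.mul_const (b := 2 * I)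
        (hηc.mono_left (nhdsWithin_le_nhds (s := Set.Ioi (0 : ℝ))))
        (Or.inr (ENNReal.mul_ne_top (by norm_num) hIt))
      have h2 := ENNReal.Tendsto.const_mul h1 (Or.inr (by norm_num : (2 : ℝ≥0∞) ≠ ⊤))
      simpa using h2
    have hlim := (ENNReal.Tendsto.const_mul h.2 (Or.inr (by norm_num : (2 : ℝ≥0∞) ≠ ⊤))).add hηlim
    simp only [mul_zero, add_zero] at hlim
    refine tendsto_of_tendsto_of_tendsto_of_le_of_le' tendsto_const_nhds hlim
      (Eventually.of_forall fun _ => zero_le) ?_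
    filter_upwards [self_mem_nhdsWithin] with ε hε
    have hε0 : (0 : ℝ) < ε := hε
    set S := Metric.ball (0 : Amb n) 1 ∩ {X : Amb n | |yCoord X| < ε} with hS
    have hSm : MeasurableSet S :=
      measurableSet_ball.inter (measurableSet_lt measurable_yCoord.abs measurable_const)
    have hxm : Measurable (xPart : Amb n → EuclideanSpace ℝ (Fin n)) :=
      measurable_snd.comp (measurePreserving_split n).measurable
    have hmap := map_xPart_slab_le n ε
    have hgae : AEMeasurable (fun x => ‖g x‖ₑ ^ 2) (Measure.map xPart (volume.restrict S)) := by
      refine ((hgm.1.enorm.pow_const 2).mono_ac ?_)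
      exact (Measure.absolutelyContinuous_of_le hmap).trans
        (Measure.smul_absolutelyContinuous)
    have hgae' : AEMeasurable (fun X => 2 * (ENNReal.ofReal (η ε ^ 2) * ‖g (xPart X)‖ₑ ^ 2))
        (volume.restrict S) :=
      ((hgae.comp_measurable hxm).const_mul _).const_mul _
    have hgint : ∫⁻ X in S, ‖g (xPart X)‖ₑ ^ 2 ≤ ENNReal.ofReal (2 * ε) * I := by
      rw [← lintegral_map' hgae hxm.aemeasurable]
      refine (lintegral_mono' hmap le_rfl).trans ?_
      rw [lintegral_smul_measure, smul_eq_mul]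
    have hinv : (ENNReal.ofReal ε)⁻¹ * ENNReal.ofReal (2 * ε) = 2 := by
      rw [mul_comm 2 ε, ENNReal.ofReal_mul hε0.le, ← mul_assoc, ENNReal.inv_mul_cancel
        (by simpa using hε0) ENNReal.ofReal_ne_top, one_mul]
      simp
    calc _ ≤ (ENNReal.ofReal ε)⁻¹ * ∫⁻ X in S, (2 * ‖v X - τ (xPart X)‖ₑ ^ 2 +
          2 * (ENNReal.ofReal (η ε ^ 2) * ‖g (xPart X)‖ₑ ^ 2)) := by
          refine mul_le_mul_right (setLIntegral_mono' hSm fun X hX => ?_) _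
          have hXn : ‖X‖ < 1 := mem_ball_zero_iff.1 hX.1
          have hXy : |yCoord X| < ε := hX.2
          set r := ‖X‖ ^ γ with hr
          set ϱ := ‖xPart X‖ ^ γ with hϱ
          obtain ⟨hr0, hr1⟩ := hr01 _ (norm_nonneg X) hXn
          have hxb : ‖xPart X‖ < 1 := (norm_xPart_le X).trans_lt hXn
          have hdiff0 : 0 ≤ r - ϱ := sub_nonneg.2
            (Real.rpow_le_rpow (norm_nonneg _) (norm_xPart_le X) hγ0.le)
          have hdiff : r - ϱ ≤ ε ^ γ := by
            refine (rpow_sub_rpow_le (norm_nonneg _) (norm_xPart_le X) hγ0.le hγ1).trans ?_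
            refine Real.rpow_le_rpow (sub_nonneg.2 (norm_xPart_le X)) ?_ hγ0.le
            linarith [norm_le_xPart_add X]
          -- The error is split into the trace error of `v`, the variation of the interpolation
          -- factor across the slab, and the variation of Ψ.
          have e1 : r * v X + (1 - r) * Ψ X - (ϱ * τ (xPart X) + (1 - ϱ) * Ψ₀ (xPart X)) =
              r * (v X - τ (xPart X)) + ((r - ϱ) * (τ (xPart X) - Ψ₀ (xPart X)) +
                (1 - r) * (Ψ X - Ψ₀ (xPart X))) := by ring
          rw [e1]
          refine (enorm_add_sq_le _ _).trans (add_le_add ?_ ?_)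
          · gcongr
            rw [enorm_mul]
            refine mul_le_of_le_one_left zero_le ?_
            rw [Real.enorm_eq_ofReal hr0]
            exact ENNReal.ofReal_le_one.2 hr1
          · refine mul_le_mul_right ?_ _
            have h1 : |Ψ₀ (xPart X)| ≤ M := hb₀ _ (mem_ball_zero_iff.2 hxb)
            have h2 : |Ψ X - Ψ₀ (xPart X)| ≤ K * ε ^ γ' := (hb X hX.1).trans (by
              have := Real.rpow_le_rpow (abs_nonneg _) hXy.le hγ'.le
              gcongr)
            have hp1 : 0 ≤ ε ^ γ := by positivity
            have hp2 : 0 ≤ ε ^ γ' := by positivity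
            have h3 : |(r - ϱ) * (τ (xPart X) - Ψ₀ (xPart X)) + (1 - r) * (Ψ X - Ψ₀ (xPart X))| ≤
                η ε * g (xPart X) := by
              refine (abs_add_le _ _).trans ?_
              rw [abs_mul, abs_mul, abs_of_nonneg hdiff0, abs_of_nonneg (by linarith : 0 ≤ 1 - r)]
              have h4 : |τ (xPart X) - Ψ₀ (xPart X)| ≤ |τ (xPart X)| + M :=
                (abs_sub _ _).trans (by linarith)
              have h5 : (r - ϱ) * |τ (xPart X) - Ψ₀ (xPart X)| ≤ ε ^ γ * (|τ (xPart X)| + M) := by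
                gcongr
              have h6 : (1 - r) * |Ψ X - Ψ₀ (xPart X)| ≤ 1 * (K * ε ^ γ') := by
                gcongr
                linarith
              have h7 : 0 ≤ |τ (xPart X)| := abs_nonneg _
              simp only [hη, hg]
              nlinarith [mul_nonneg hp1 hK, mul_nonneg hp2 hM, mul_nonneg hp2 h7]
            have hg0 : 0 ≤ g (xPart X) := by simp only [hg]; positivity
            have hη0 : 0 ≤ η ε := by simp only [hη]; positivity
            rw [Real.enorm_eq_ofReal_abs, Real.enorm_eq_ofReal hg0, ENNReal.ofReal_pow hη0,
              ← mul_pow, ← ENNReal.ofReal_mul hη0]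
            gcongr
      _ = 2 * ((ENNReal.ofReal ε)⁻¹ * ∫⁻ X in S, ‖v X - τ (xPart X)‖ₑ ^ 2) +
          2 * (ENNReal.ofReal (η ε ^ 2) * ((ENNReal.ofReal ε)⁻¹ *
            ∫⁻ X in S, ‖g (xPart X)‖ₑ ^ 2)) := by
          rw [lintegral_add_right' _ hgae', lintegral_const_mul' _ _ (by norm_num),
            lintegral_const_mul' _ _ (by norm_num), lintegral_const_mul' _ _ ENNReal.ofReal_ne_top]
          ring
      _ ≤ _ := by
          refine add_le_add le_rfl (mul_le_mul_right (mul_le_mul_right ?_ _) _)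
          calc _ ≤ (ENNReal.ofReal ε)⁻¹ * (ENNReal.ofReal (2 * ε) * I) := mul_le_mul_right hgint _
            _ = 2 * I := by rw [← mul_assoc, hinv]

/-! ### The profile near the thin space -/

/-- The trace of `slit` on the thin space, as a function of `t = ⟨X, e⟩`. -/
noncomputable def slitThin (s t : ℝ) : ℝ := (t / s - |t|) * (|t| + t) ^ s

theorem slitThin_nonneg {s : ℝ} (hs0 : 0 < s) (hs1 : s < 1) (t : ℝ) : 0 ≤ slitThin s t := by
  rcases le_total 0 t with h | h
  · rw [slitThin, abs_of_nonneg h]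
    have : t ≤ t / s := by rw [le_div_iff₀ hs0]; nlinarith
    exact mul_nonneg (by linarith) (by positivity)
  · rw [slitThin, abs_of_nonpos h, neg_add_cancel, Real.zero_rpow hs0.ne', mul_zero]

theorem continuous_slitThin {s : ℝ} (hs0 : 0 < s) : Continuous (slitThin s) := by
  have : Continuous fun t : ℝ => (|t| + t) ^ s :=
    Continuous.rpow_const (by fun_prop) fun _ => Or.inr hs0.le
  unfold slitThin
  fun_prop

theorem rpow_two_le {s x : ℝ} (hs0 : 0 < s) (hs1 : s < 1) (h0 : 0 ≤ x) (h2 : x ≤ 2) : x ^ s ≤ 2 := by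
  calc x ^ s ≤ 2 ^ s := Real.rpow_le_rpow h0 h2 hs0.le
    _ ≤ 2 ^ (1 : ℝ) := Real.rpow_le_rpow_of_exponent_le (by norm_num) hs1.le
    _ = 2 := Real.rpow_one 2

theorem abs_slitThin_le {s t : ℝ} (hs0 : 0 < s) (hs1 : s < 1) (ht : |t| ≤ 1) :
    |slitThin s t| ≤ 2 * (1 / s + 1) := by
  have h1 : 0 ≤ |t| + t := by linarith [neg_abs_le t]
  have h2 := rpow_two_le hs0 hs1 h1 (by linarith [le_abs_self t])
  have h3 : abs (t / s - |t|) ≤ 1 / s + 1 := by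
    refine (abs_sub _ _).trans (add_le_add ?_ (by rwa [abs_abs]))
    rw [abs_div, abs_of_pos hs0]; gcongr
  rw [slitThin, abs_mul, abs_of_nonneg (Real.rpow_nonneg h1 s), mul_comm]
  exact mul_le_mul h2 h3 (abs_nonneg _) (by norm_num)

/-- Since 0 ≤ ρ - |t| ≤ |y| and x ↦ x^s is s-Hölder, the power of the base changes by at most |y|^s;
the linear error |y| is dominated by |y|^s because |y| ≤ 1. -/
theorem abs_slit_sub_slitThin_le {s : ℝ} (hs0 : 0 < s) (hs1 : s < 1) {e : Amb n} (hne : ‖e‖ = 1)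
    {X : Amb n} (hX : ‖X‖ ≤ 1) :
    |slit s e 0 X - slitThin s (inner ℝ X e)| ≤ (1 / s + 4) * |yCoord X| ^ s := by
  have ht : |inner ℝ X e| ≤ 1 := by
    refine (abs_real_inner_le_norm X e).trans ?_
    rw [hne, mul_one]; exact hX
  have hy : |yCoord X| ≤ 1 := (abs_yCoord_le X).trans hX
  have hρ1 := abs_inner_le_slitRho (X := X) (e := e) (ε := 0) le_rfl
  have hρ2 : slitRho e 0 X ≤ |inner ℝ X e| + |yCoord X| := by
    refine le_of_sq_le_sq ?_ (by positivity)
    rw [slitRho_sq le_rfl]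
    nlinarith [sq_abs (inner ℝ X e), sq_abs (yCoord X),
      mul_nonneg (abs_nonneg (inner ℝ X e)) (abs_nonneg (yCoord X))]
  rw [slit, slitBase, slitThin]
  set t := inner ℝ X e
  set ρ := slitRho e 0 X
  set y := |yCoord X|
  have h0 : 0 ≤ |t| + t := by linarith [neg_abs_le t]
  have hy0 : 0 ≤ y := abs_nonneg _
  have hys : y ≤ y ^ s := by
    conv_lhs => rw [← Real.rpow_one y]
    rcases eq_or_lt_of_le hy0 with h | h
    · rw [← h, Real.zero_rpow one_ne_zero]; positivity
    · exact Real.rpow_le_rpow_of_exponent_ge h hy hs1.le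
  have h2 := rpow_two_le hs0 hs1 h0 (by linarith [le_abs_self t])
  have h3 : |t / s - ρ| ≤ 1 / s + 2 := by
    refine (abs_sub _ _).trans (add_le_add ?_ ?_)
    · rw [abs_div, abs_of_pos hs0]; gcongr
    · rw [abs_of_nonneg ((abs_nonneg t).trans hρ1)]; linarith
  have h4 : |(ρ + t) ^ s - (|t| + t) ^ s| ≤ y ^ s := by
    rw [abs_of_nonneg (sub_nonneg.2 (Real.rpow_le_rpow h0 (by linarith) hs0.le))]
    refine (rpow_sub_rpow_le h0 (by linarith) hs0.le hs1.le).trans ?_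
    exact Real.rpow_le_rpow (by linarith) (by linarith) hs0.le
  have e1 : (t / s - ρ) * (ρ + t) ^ s - (t / s - |t|) * (|t| + t) ^ s =
      (t / s - ρ) * ((ρ + t) ^ s - (|t| + t) ^ s) + (|t| - ρ) * (|t| + t) ^ s := by ring
  rw [e1]
  refine (abs_add_le _ _).trans ?_
  rw [abs_mul, abs_mul, abs_of_nonneg (Real.rpow_nonneg h0 s), abs_of_nonpos (show |t| - ρ ≤ 0 by linarith)]
  have hys0 : 0 ≤ y ^ s := Real.rpow_nonneg hy0 s
  have h5 : |t / s - ρ| * |(ρ + t) ^ s - (|t| + t) ^ s| ≤ (1 / s + 2) * y ^ s := by gcongr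
  have h6 : -(|t| - ρ) * (|t| + t) ^ s ≤ y ^ s * 2 :=
    mul_le_mul (by linarith) h2 (Real.rpow_nonneg h0 s) hys0
  linarith

/-- The `(1 + s)`-homogeneous extension of the profile `C slit + c₀ thinProfile`. -/
noncomputable def profileExt (s : ℝ) (e : Amb n) (C c₀ : ℝ) (X : Amb n) : ℝ :=
  C * slit s e 0 X + c₀ * (‖X‖ ^ (1 - s) * thinProfile s X)

theorem slit_smul {s : ℝ} (e X : Amb n) {r : ℝ} (hr : 0 < r) :
    slit s e 0 (r • X) = r ^ (1 + s) * slit s e 0 X := by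
  have h1 : slitRho e 0 (r • X) = r * slitRho e 0 X := by
    rw [slitRho, slitRho, real_inner_smul_left, yCoord_smul, ← Real.sqrt_sq hr.le,
      ← Real.sqrt_mul (sq_nonneg r), Real.sqrt_sq hr.le]
    congr 1; ring
  have h2 : 0 ≤ slitRho e 0 X + inner ℝ X e := slitBase_nonneg le_rfl
  rw [slit, slit, slitBase, slitBase, h1, real_inner_smul_left, ← mul_add,
    Real.mul_rpow hr.le h2, Real.rpow_add hr, Real.rpow_one]
  ring

theorem thinProfile_smul {s : ℝ} (X : Amb n) {r : ℝ} (hr : 0 < r) :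
    thinProfile s (r • X) = r ^ (2 * s) * thinProfile s X := by
  rw [thinProfile, thinProfile, yCoord_smul, abs_mul, abs_of_pos hr,
    Real.mul_rpow hr.le (abs_nonneg _)]

theorem homExt_profile {s : ℝ} (e : Amb n) (C c₀ : ℝ) {X : Amb n} (hX : X ≠ 0) :
    homExt (1 + s) (profile s e C c₀) X = profileExt s e C c₀ X := by
  have hr := norm_pos_iff.2 hX
  have hXd : X = ‖X‖ • (dirMap X : Amb n) := by
    rw [coe_dirMap hX, smul_smul, mul_inv_cancel₀ hr.ne', one_smul]
  rw [homExt, radialExt_eq _ hX, profile, profileExt]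
  have e1 : slit s e 0 X = ‖X‖ ^ (1 + s) * slit s e 0 (dirMap X : Amb n) := by
    conv_lhs => rw [hXd]
    exact slit_smul _ _ hr
  have e2 : thinProfile s X = ‖X‖ ^ (2 * s) * thinProfile s (dirMap X : Amb n) := by
    conv_lhs => rw [hXd]
    exact thinProfile_smul _ hr
  rw [e1, e2, ← mul_assoc (‖X‖ ^ (1 - s)), ← Real.rpow_add hr,
    show 1 - s + 2 * s = 1 + s by ring]
  ring

/-- The `thinProfile` part is at most |y|^(2s) ≤ |y|^s, so it disappears on the thin space whatever
the sign of c₀, and the trace is C times that of `slit`. -/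
theorem abs_profileExt_sub_le {s : ℝ} (hs0 : 0 < s) (hs1 : s < 1) {e : Amb n} (he : yCoord e = 0)
    (hne : ‖e‖ = 1) {C : ℝ} (hC : 0 ≤ C) (c₀ : ℝ) {X : Amb n} (hX : ‖X‖ ≤ 1) :
    |profileExt s e C c₀ X - C * slitThin s (inner ℝ (xPart X) (xPart e))| ≤
      (C * (1 / s + 4) + |c₀|) * |yCoord X| ^ s := by
  have h1 : inner ℝ (xPart X) (xPart e) = inner ℝ X e := by
    rw [inner_eq_inner_xPart_add, he]; ring
  have h2 := abs_slit_sub_slitThin_le hs0 hs1 hne hX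
  have hy : |yCoord X| ≤ 1 := (abs_yCoord_le X).trans hX
  have h3 : thinProfile s X ≤ |yCoord X| ^ s := by
    rw [thinProfile]
    rcases eq_or_lt_of_le (abs_nonneg (yCoord X)) with h | h
    · rw [← h, Real.zero_rpow (by linarith), Real.zero_rpow hs0.ne']
    · exact Real.rpow_le_rpow_of_exponent_ge h hy (by linarith)
  have h4 : 0 ≤ thinProfile s X := Real.rpow_nonneg (abs_nonneg _) _
  have h5 : ‖X‖ ^ (1 - s) ≤ 1 := Real.rpow_le_one (norm_nonneg _) hX (by linarith)
  have h6 : 0 ≤ ‖X‖ ^ (1 - s) := Real.rpow_nonneg (norm_nonneg _) _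
  rw [h1, profileExt, add_sub_right_comm, ← mul_sub]
  refine (abs_add_le _ _).trans ?_
  rw [abs_mul, abs_mul, abs_of_nonneg hC, abs_of_nonneg (mul_nonneg h6 h4), add_mul, mul_assoc]
  gcongr
  exact (mul_le_of_le_one_left h4 h5).trans h3

end ThinTrace

section Epiperimetric

variable {n : ℕ} {a : ℝ}

/-! ### Evenness -/

theorem norm_reflectY (X : Amb n) : ‖reflectY X‖ = ‖X‖ := by
  rw [reflectY_eq_mirror]; exact LinearIsometryEquiv.norm_map _ X

theorem dirMap_reflectY {X : Amb n} (hX : X ≠ 0) : dirMap (reflectY X) = sphFlip (dirMap X) := by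
  have h0 : reflectY X ≠ 0 := by rwa [← norm_ne_zero_iff, norm_reflectY, norm_ne_zero_iff]
  apply Subtype.ext
  change _ = mirror (yDir n) (dirMap X : Amb n)
  rw [coe_dirMap h0, coe_dirMap hX, norm_reflectY, reflectY_eq_mirror, map_smul]

theorem homExt_reflectY (α : ℝ) (c : Sph n → ℝ) {X : Amb n} (hX : X ≠ 0) :
    homExt α c (reflectY X) = ‖X‖ ^ α * c (sphFlip (dirMap X)) := by
  have h0 : reflectY X ≠ 0 := by rwa [← norm_ne_zero_iff, norm_reflectY, norm_ne_zero_iff]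
  rw [homExt, radialExt_eq c h0, norm_reflectY, dirMap_reflectY hX]

/-- Cancelling the positive factor |X|^α makes the evenness a property of the direction, which
Fubini in polar coordinates transfers from the ball to the sphere. -/
theorem ae_sphFlip_eq_of_homExt_even {α : ℝ} {c : Sph n → ℝ}
    (h : ∀ᵐ X ∂(volume.restrict (Metric.ball (0 : Amb n) 1)),
      homExt α c X = homExt α c (reflectY X)) :
    ∀ᵐ θ ∂(sphereMeasure n a), c (sphFlip θ) = c θ := by
  have h1 : ∀ᵐ X ∂(ballMeasure n a), c (sphFlip (dirMap X)) = c (dirMap X) := by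
    filter_upwards [(ae_ballMeasure_iff a).2 h, ae_ball_ne_zero n a] with X h1 h2
    rw [homExt_reflectY α c h2, homExt, radialExt_eq c h2] at h1
    exact (mul_left_cancel₀ (Real.rpow_pos_of_pos (norm_pos_iff.2 h2) α).ne' h1).symm
  have h2 := (measurePreserving_polarMap n a).quasiMeasurePreserving.ae h1
  have h3 : ∀ᵐ p ∂((sphereMeasure n a).prod (radialMeasure (n + a))),
      c (sphFlip p.1) = c p.1 := by
    filter_upwards [h2, ae_prod_radial_mem _ _] with p hp hr
    rwa [polarMap, dirMap_smul _ hr.1] at hp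
  filter_upwards [Measure.ae_ae_of_ae_prod h3] with θ hθ
  by_contra hne
  refine radialMeasure_univ_ne_zero ((n : ℝ) + a) ?_
  simpa [hne, ae_eq_bot] using hθ

theorem profile_sphFlip {s : ℝ} {e : Amb n} (he : yCoord e = 0) (C c₀ : ℝ) (θ : Sph n) :
    profile s e C c₀ (sphFlip θ) = profile s e C c₀ θ := by
  simp only [profile, slit, slitBase, slitRho, thinProfile, inner_sphFlip he, yCoord_sphFlip,
    abs_neg, neg_sq]

/-! ### The Weiss energy of a sum of two homogeneous functions -/

/-- It covers both energies to be compared: the competitor with α = 1+s, β = 2, and z itself with α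
= β = 1+s. -/
theorem weissEnergy_homExt_add (hna : 0 ≤ (n : ℝ) + a) (ha0 : -1 < a) (ha1 : a < 1) {α β : ℝ}
    (hα : 1 ≤ α) (hβ : 1 ≤ β) (lam : ℝ) {ψ φ : Sph n → ℝ} {Gψ Gφ : Sph n → Amb n}
    (hψ : MemLp ψ 2 (sphereMeasure n a)) (hφ : MemLp φ 2 (sphereMeasure n a))
    (hGψ : IsWeakSphereGrad a ψ Gψ) (hGφ : IsWeakSphereGrad a φ Gφ) :
    weissEnergy a lam (fun X => homExt α ψ X + homExt β φ X) =
      (α ^ 2 * ∫ θ, ψ θ ^ 2 ∂(sphereMeasure n a) + ∫ θ, ‖Gψ θ‖ ^ 2 ∂(sphereMeasure n a)) *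
        (1 / (n + a + 2 * α - 1)) +
      2 * (α * β * ∫ θ, ψ θ * φ θ ∂(sphereMeasure n a) +
        ∫ θ, inner ℝ (Gψ θ) (Gφ θ) ∂(sphereMeasure n a)) * (1 / (n + a + α + β - 1)) +
      (β ^ 2 * ∫ θ, φ θ ^ 2 ∂(sphereMeasure n a) + ∫ θ, ‖Gφ θ‖ ^ 2 ∂(sphereMeasure n a)) *
        (1 / (n + a + 2 * β - 1)) -
      lam * (∫ θ, ψ θ ^ 2 ∂(sphereMeasure n a) + 2 * ∫ θ, ψ θ * φ θ ∂(sphereMeasure n a) +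
        ∫ θ, φ θ ^ 2 ∂(sphereMeasure n a)) := by
  have m1 := memLp_homExt ha0 (by linarith : 0 ≤ α) hψ
  have m2 := memLp_homExt ha0 (by linarith : 0 ≤ β) hφ
  have hG := weakGrad_ae_eq ha1 (IsWeakGrad.add ha1 m1 m2 (isWeakGrad_homExt ha0 ha1 hα hψ hGψ)
    (isWeakGrad_homExt ha0 ha1 hβ hφ hGφ))
  have hT := sphereTrace_ae_eq hna (m1.add m2).1 (IsSphereTrace.add m1.1
    (isSphereTrace_homExt ha0 hα hψ) (isSphereTrace_homExt ha0 hβ hφ))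
  have e1 : ∫ X, ‖weakGrad a (fun X => homExt α ψ X + homExt β φ X) X‖ ^ 2 ∂(ballMeasure n a) =
      ∫ X, ‖homGrad α ψ Gψ X + homGrad β φ Gφ X‖ ^ 2 ∂(ballMeasure n a) :=
    integral_congr_ae (hG.mono fun X hX => by simp only [hX])
  have e2 : ∫ θ, sphereTrace a (fun X => homExt α ψ X + homExt β φ X) θ ^ 2 ∂(sphereMeasure n a) =
      ∫ θ, ψ θ ^ 2 ∂(sphereMeasure n a) + 2 * ∫ θ, ψ θ * φ θ ∂(sphereMeasure n a) +
        ∫ θ, φ θ ^ 2 ∂(sphereMeasure n a) := by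
    have i1 := hψ.integrable_sq
    have i2 := (integrable_mul_of_memLp hψ hφ).const_mul 2
    have i3 := hφ.integrable_sq
    rw [← integral_const_mul, ← integral_add i1 i2,
      ← integral_add (integrable_add_fun i1 i2) i3]
    refine integral_congr_ae (hT.mono fun θ hθ => ?_)
    have hθ' : sphereTrace a (fun X => homExt α ψ X + homExt β φ X) θ = ψ θ + φ θ := hθ
    simp only [hθ']
    ring
  rw [weissEnergy, e1, e2, integral_norm_sq_homGrad_add hna ha0 ha1 hα hβ hψ hφ hGψ hGφ]

/-! ### The competitor -/

/-- The competitor is the interpolation r^(1-s) z + (1 - r^(1-s)) Ψ, where Ψ extends the profile.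
Nonnegativity on the thin ball then follows from that of z and from C ≥ 0; the trace on the sphere
is ψ + φ = c. -/
theorem competitor_mem_admissible {s : ℝ} (hs0 : 0 < s) (hs1 : s < 1) (ha : a = 1 - 2 * s)
    {c : Sph n → ℝ} {G : Sph n → Amb n} (hc : MemLp c 2 (sphereMeasure n a))
    (hz : homExt (1 + s) c ∈ admissible a c) {e : Amb n} (he : yCoord e = 0) (hne : ‖e‖ = 1)
    {C : ℝ} (hC : 0 ≤ C) (c₀ : ℝ) (hψ : IsWeakSphereGrad a (profile s e C c₀) (profileGrad s e C c₀))
    (hφ : IsWeakSphereGrad a (fun θ => c θ - profile s e C c₀ θ) G) :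
    (fun X => homExt (1 + s) (profile s e C c₀) X +
      homExt 2 (fun θ => c θ - profile s e C c₀ θ) X) ∈ admissible a c := by
  have ha0 : -1 < a := by linarith
  have ha1 : a < 1 := by linarith
  have mψ : MemLp (profile s e C c₀) 2 (sphereMeasure n a) := memLp_profile hs0 ha0 e C c₀
  have mφ : MemLp (fun θ => c θ - profile s e C c₀ θ) 2 (sphereMeasure n a) := hc.sub mψ
  have m1 := memLp_homExt ha0 (by linarith : 0 ≤ 1 + s) mψ
  have m2 := memLp_homExt ha0 (by norm_num : (0 : ℝ) ≤ 2) mφ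
  have hζ : ∀ X : Amb n, X ≠ 0 → homExt (1 + s) (profile s e C c₀) X +
      homExt 2 (fun θ => c θ - profile s e C c₀ θ) X =
        ‖X‖ ^ (1 - s) * homExt (1 + s) c X + (1 - ‖X‖ ^ (1 - s)) * profileExt s e C c₀ X := by
    intro X hX
    have hr := norm_pos_iff.2 hX
    have h2 : ‖X‖ ^ (2 : ℝ) = ‖X‖ ^ (1 - s) * ‖X‖ ^ (1 + s) := by
      rw [← Real.rpow_add hr]; norm_num
    rw [← homExt_profile e C c₀ hX]
    simp only [homExt, radialExt_eq _ hX, h2]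
    ring
  obtain ⟨-, ⟨τ, hτ, hτ0⟩, -, heven⟩ := hz
  refine ⟨⟨m1.add m2, _, IsWeakGrad.add ha1 m1 m2
    (isWeakGrad_homExt ha0 ha1 (by linarith) mψ hψ)
    (isWeakGrad_homExt ha0 ha1 (by norm_num) mφ hφ)⟩, ?_, ?_, ?_⟩
  · have hex : ‖xPart e‖ ≤ 1 := hne ▸ norm_xPart_le e
    have hT := isThinTrace_interpolation hτ
      (Ψ := profileExt s e C c₀) (Ψ₀ := fun x => C * slitThin s (inner ℝ x (xPart e)))
      (continuous_const.mul ((continuous_slitThin hs0).comp (by fun_prop)))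
      (K := C * (1 / s + 4) + |c₀|) (M := C * (2 * (1 / s + 1))) (γ := 1 - s) (γ' := s)
      (by positivity) (by positivity) (by linarith) (by linarith) hs0
      (fun X hX => abs_profileExt_sub_le hs0 hs1 he hne hC c₀ (mem_ball_zero_iff.1 hX).le)
      (fun x hx => by
        rw [abs_mul, abs_of_nonneg hC]
        refine mul_le_mul_of_nonneg_left (abs_slitThin_le hs0 hs1 ?_) hC
        refine (abs_real_inner_le_norm _ _).trans ?_
        exact mul_le_one₀ (mem_ball_zero_iff.1 hx).le (norm_nonneg _) hex)
    refine ⟨_, ⟨hT.1, ?_⟩, ?_⟩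
    · convert hT.2 using 5 with ε X
      -- The interpolation formula was derived away from the origin; at the origin both expressions
      -- vanish.
      by_cases hX : X = 0
      · subst hX
        have h1s : (1 - s) ≠ 0 := by linarith
        have h2s : (1 + s) ≠ 0 := by linarith
        have hp : profileExt s e C c₀ (0 : Amb n) = 0 := by
          simp [profileExt, slit, slitBase, slitRho, thinProfile, yCoord, Real.zero_rpow, h1s]
        simp [homExt, radialExt, hp]
      · simp only [hζ X hX]
    · filter_upwards [hτ0, ae_restrict_mem measurableSet_ball] with x hx hxb
      have h1 : ‖x‖ ^ (1 - s) ≤ 1 :=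
        Real.rpow_le_one (norm_nonneg _) (mem_ball_zero_iff.1 hxb).le (by linarith)
      have h2 : 0 ≤ ‖x‖ ^ (1 - s) := by positivity
      have h3 := slitThin_nonneg hs0 hs1 (inner ℝ x (xPart e))
      exact add_nonneg (mul_nonneg h2 hx) (mul_nonneg (by linarith) (mul_nonneg hC h3))
  · have := IsSphereTrace.add m1.1 (isSphereTrace_homExt ha0 (by linarith) mψ)
      (isSphereTrace_homExt ha0 (by norm_num : (1 : ℝ) ≤ 2) mφ)
    simpa only [add_sub_cancel] using this
  · rw [← ae_ballMeasure_iff a] at heven ⊢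
    filter_upwards [heven, ae_ball_ne_zero n a] with X h1 hX
    rw [homExt_reflectY _ _ hX, homExt, radialExt_eq c hX] at h1
    have h2 := mul_left_cancel₀ (Real.rpow_pos_of_pos (norm_pos_iff.2 hX) (1 + s)).ne' h1
    simp only [homExt_reflectY _ _ hX, profile_sphFlip he, ← h2]
    simp only [homExt, radialExt_eq _ hX]

/-- P, Q, R stand for ∫ψ², ∫φ², ∫ψφ, and DP, DQ, S for the corresponding gradient integrals. The
factor 1 - κ equals (N+2)/(N+3-s), the ratio of the denominators of the mixed terms for the
exponents (1+s, 1+s) and (1+s, 2); with it S cancels, and so does R. -/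
theorem epiperimetric_algebra {N s P Q R DP DQ S : ℝ} (hN : 0 ≤ N) (hs0 : 0 < s) (hs1 : s < 1)
    (h1 : DP ≤ (1 + s) * (1 + s + N + (1 - 2 * s) - 1) * P)
    (h2 : 2 * (2 + N + (1 - 2 * s) - 1) * Q ≤ DQ) :
    ((1 + s) ^ 2 * P + DP) * (1 / (N + (1 - 2 * s) + 2 * (1 + s) - 1)) +
        2 * ((1 + s) * 2 * R + S) * (1 / (N + (1 - 2 * s) + (1 + s) + 2 - 1)) +
        (2 ^ 2 * Q + DQ) * (1 / (N + (1 - 2 * s) + 2 * 2 - 1)) - (1 + s) * (P + 2 * R + Q) ≤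
      (1 - (1 + (1 - 2 * s)) / (2 * N + (1 - 2 * s) + 5)) *
        (((1 + s) ^ 2 * P + DP) * (1 / (N + (1 - 2 * s) + 2 * (1 + s) - 1)) +
          2 * ((1 + s) * (1 + s) * R + S) * (1 / (N + (1 - 2 * s) + (1 + s) + (1 + s) - 1)) +
          ((1 + s) ^ 2 * Q + DQ) * (1 / (N + (1 - 2 * s) + 2 * (1 + s) - 1)) -
          (1 + s) * (P + 2 * R + Q)) := by
  have hV : 0 < N + 2 := by linarith
  have hW : 0 < N + 4 - 2 * s := by linarith
  have hT : 0 < 2 * N + 6 - 2 * s := by linarith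
  rw [show N + (1 - 2 * s) + 2 * (1 + s) - 1 = N + 2 by ring,
    show N + (1 - 2 * s) + (1 + s) + (1 + s) - 1 = N + 2 by ring,
    show N + (1 - 2 * s) + (1 + s) + 2 - 1 = (2 * N + 6 - 2 * s) / 2 by ring,
    show N + (1 - 2 * s) + 2 * 2 - 1 = N + 4 - 2 * s by ring,
    show 2 * N + (1 - 2 * s) + 5 = 2 * N + 6 - 2 * s by ring, ← sub_nonneg]
  -- The left side is exactly the difference to be shown nonnegative: the defects of `h1` and `h2`
  -- with their nonnegative coefficients, free of R and S.
  have key : (2 - 2 * s) / ((2 * N + 6 - 2 * s) * (N + 2)) *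
        ((1 + s) * (1 + s + N + (1 - 2 * s) - 1) * P - DP) +
      (2 - 2 * s) / ((N + 4 - 2 * s) * (2 * N + 6 - 2 * s)) *
        (DQ - 2 * (2 + N + (1 - 2 * s) - 1) * Q) ≥ 0 := by
    have := sub_nonneg.2 h1
    have := sub_nonneg.2 h2
    have : 0 ≤ 2 - 2 * s := by linarith
    positivity
  refine key.trans_eq ?_
  field_simp
  ring

theorem theorem1p1 (n : ℕ) (hn : 1 ≤ n) (s a : ℝ) (hs0 : 0 < s) (hs1 : s < 1)
    (ha : a = 1 - 2 * s) (c : Sph n → ℝ) (hc : MemH1Sphere a c)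
    (hz : homExt (1 + s) c ∈ admissible a c) :
    ∃ ζ ∈ admissible a c,
      weissEnergy a (1 + s) ζ ≤
        (1 - (1 + a) / (2 * n + a + 5)) * weissEnergy a (1 + s) (homExt (1 + s) c) := by
  have hn1 : (1 : ℝ) ≤ n := by exact_mod_cast hn
  have ha0 : -1 < a := by linarith
  have ha1 : a < 1 := by linarith
  have hna : 0 ≤ (n : ℝ) + a := by linarith
  obtain ⟨mc, G, hG⟩ := hc
  obtain ⟨e, C, c₀, he, hne, hC, hgap⟩ := exists_profile hn hs0 hs1 ha mc hG
    (ae_sphFlip_eq_of_homExt_even hz.2.2.2)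
  have mψ : MemLp (profile s e C c₀) 2 (sphereMeasure n a) := memLp_profile hs0 ha0 e C c₀
  have hψ := isWeakSphereGrad_profile hn hs0 hs1 ha hne C c₀
  have mφ : MemLp (fun θ => c θ - profile s e C c₀ θ) 2 (sphereMeasure n a) := mc.sub mψ
  have hφ : IsWeakSphereGrad a (fun θ => c θ - profile s e C c₀ θ)
      (fun θ => G θ - profileGrad s e C c₀ θ) := by
    simpa [sub_eq_add_neg] using hG.lin ha1 hψ mc mψ 1 (-1)
  refine ⟨_, competitor_mem_admissible hs0 hs1 ha mc hz he hne hC c₀ hψ hφ, ?_⟩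
  -- Splitting z along the same decomposition lets one energy formula serve both sides of the
  -- inequality.
  have hzs : homExt (1 + s) c = fun X => homExt (1 + s) (profile s e C c₀) X +
      homExt (1 + s) (fun θ => c θ - profile s e C c₀ θ) X := by
    funext X
    by_cases hX : X = 0
    · simp [homExt, radialExt, hX]
    · simp only [homExt, radialExt_eq _ hX]; ring
  have hE := energy_profile_le hn hs0 hs1 ha he hne C c₀
  rw [hzs, weissEnergy_homExt_add hna ha0 ha1 (by linarith) (by norm_num) (1 + s) mψ mφ hψ hφ,
    weissEnergy_homExt_add hna ha0 ha1 (by linarith) (by linarith) (1 + s) mψ mφ hψ hφ]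
  rw [sphEig] at hgap hE
  subst ha
  exact epiperimetric_algebra (by positivity) hs0 hs1 hE hgap

end Epiperimetric
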